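/- Let $n\ge 1$, $s\in(0,1)$, $a:=1-2s$. For $w\in W^{1,1}_{\rm loc}((0,\infty))$ let $G(w):=\int_0^\infty t^{a}\big(|w(t)|^2+|w'(t)|^2\big)\,dt\in[0,\infty]$. The functional $G$ attains its minimum among the functions $w\in W^{1,1}_{\rm loc}((0,\infty))\cap C^0([0,\infty))$ with $w(0)=1$. Let $g$ be any minimizer and $C_\sharp:=G(g)$, which is finite. Write $\widehat f(\xi)=\mathcal F f(\xi)=(2\pi)^{-n/2}\int_{\mathbb R^n}f(x)e^{-ix\cdot\xi}\,dx$ and $\mathcal F^{-1}f(x)=(2\pi)^{-n/2}\int_{\mathbb R^n}f(\xi)e^{ix\cdot\xi}\,d\xi$, and let $$(-\Delta)^su(x)=\frac{C(n,s)}2\int_{\mathbb R^n}\frac{2u(x)-u(x+y)-u(x-y)}{|y|^{n+2s}}\,dy,\qquad C(n,s)=\Big(\int_{\mathbb R^n}\frac{1-\cos\omega_1}{|\omega|^{n+2s}}\,d\omega\Big)^{-1}.$$ Let $u\in\mathcal S(\mathbb R^n)$ (real- or complex-valued) and $$U(x,y):=\mathcal F^{-1}\big(\widehat u(\xi)\,g(|\xi|y)\big)(x),\qquad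 x\in\mathbb R^n,\ y\ge0.$$ The integrals that define $U$ and $(-\Delta)^su$ converge absolutely, and: 1. $\operatorname{div}(y^{a}\nabla U)=0$ at every point $(x,y)$ of $\mathbb R^{n+1}_+:=\mathbb R^n\times(0,\infty)$, in the classical sense ($U$ and $y^a\nabla U$ are differentiable there). 2. $-y^{a}\partial_yU\big|_{y=0}=C_\sharp\,(-\Delta)^su$ in $\mathbb R^n$, both in the sense of distributions, that is, $y^a\partial_yU(\cdot,y)$ (for $y>0$) and $(-\Delta)^su$ are locally integrable and $$-\lim_{y\to0^+}\int_{\mathbb R^n}\varphi(x)\,y^{a}\,\partial_yU(x,y)\,dx=C_\sharp\int_{\mathbb R^n}\varphi(x)\,(-\Delta)^su(x)\,dx\qquad\text{for all }\varphi\in C_c^\infty(\mathbb R^n),$$ and as a pointwise limit: $-\lim_{y\to0^+}y^{a}\partial_yU(x,y)=C_\sharp(-\Delta)^su(x)$ for every $x\in\mathbb R^n$. 3. Let $X_u$ be the set of all $V\in W^{1,1}_{\rm loc}(\mathbb R^{n+1}_+)$ such that, for every $x\in\mathbb R^n$, the map $y\mapsto V(x,y)$ is continuous on $[0,\infty)$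 with $V(x,0)=u(x)$, and let $[V]_a^2:=\int_{\mathbb R^{n+1}_+}y^{a}|\nabla V|^2\,dX\in[0,\infty]$. Then $U\in X_u$ and $$\min_{V\in X_u}[V]_a^2=[U]_a^2=C_\sharp\int_{\mathbb R^n}|\xi|^{2s}\,|\widehat u(\xi)|^2\,d\xi .$$ -/

import Mathlib

open MeasureTheory Filter Topology Set
open scoped ContDiff

noncomputable section

namespace FracExt

/-- Euclidean space `ℝⁿ`. -/
abbrev Rn (n : ℕ) : Type := EuclideanSpace ℝ (Fin n)

/-! ### Weak derivatives -/

section Weak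

variable {E F : Type*} [NormedAddCommGroup E] [NormedSpace ℝ E] [MeasureSpace E]
  [NormedAddCommGroup F] [NormedSpace ℝ F]

/-- `V` and `D` are in `L¹_loc(Ω)`, and `D` is the weak derivative of `V` in `Ω` in the
direction `v`. -/
def HasWeakDeriv (Ω : Set E) (v : E) (V D : E → F) : Prop :=
  LocallyIntegrableOn V Ω ∧ LocallyIntegrableOn D Ω ∧
    ∀ φ : E → ℝ, ContDiff ℝ ∞ φ → HasCompactSupport φ → tsupport φ ⊆ Ω →
      ∫ x in Ω, (fderiv ℝ φ x v) • V x = -∫ x in Ω, φ x • D x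

open Classical in
/-- The weak derivative of `V` in `Ω` in the direction `v` (a representative of it; it is `0` if
there is none). -/
def weakDeriv (Ω : Set E) (v : E) (V : E → F) : E → F :=
  if h : ∃ D, HasWeakDeriv Ω v V D then h.choose else 0

end Weak

/-! ### The one-dimensional minimization problem -/

/-- `w ∈ W^{1,1}_loc((0,∞)) ∩ C⁰([0,∞))` and `w(0) = 1`. -/
def IsAdmissible (w : ℝ → ℝ) : Prop :=
  (∃ D, HasWeakDeriv (Ioi (0 : ℝ)) 1 w D) ∧ ContinuousOn w (Ici 0) ∧ w 0 = 1

/-- `G(w) = ∫₀^∞ t^{1-2s} (|w|² + |w'|²) dt`, possibly infinite. -/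
def G (s : ℝ) (w : ℝ → ℝ) : ENNReal :=
  ∫⁻ t in Ioi (0 : ℝ),
    ENNReal.ofReal (t ^ (1 - 2 * s) * (w t ^ 2 + weakDeriv (Ioi (0 : ℝ)) 1 w t ^ 2))

/-- `g` minimizes `G` among the admissible functions. -/
def IsProfile (s : ℝ) (g : ℝ → ℝ) : Prop :=
  IsAdmissible g ∧ ∀ w, IsAdmissible w → G s g ≤ G s w

/-- The constant `C_♯ = G(g)`. -/
def CSharp (s : ℝ) (g : ℝ → ℝ) : ℝ := (G s g).toReal

/-! ### Fourier transform and fractional Laplacian on `ℝⁿ` -/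

/-- Unitary Fourier transform `(2π)^{-n/2} ∫ f(x) e^{-i x·ξ} dx`. -/
def fourierT {n : ℕ} (f : Rn n → ℂ) (ξ : Rn n) : ℂ :=
  ((2 * Real.pi) ^ (-(n : ℝ) / 2) : ℝ) •
    ∫ x : Rn n, Complex.exp (-Complex.I * ((inner ℝ x ξ : ℝ) : ℂ)) * f x

/-- Unitary inverse Fourier transform `(2π)^{-n/2} ∫ f(ξ) e^{i x·ξ} dξ`. -/
def fourierTInv {n : ℕ} (f : Rn n → ℂ) (x : Rn n) : ℂ :=
  ((2 * Real.pi) ^ (-(n : ℝ) / 2) : ℝ) •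
    ∫ ξ : Rn n, Complex.exp (Complex.I * ((inner ℝ x ξ : ℝ) : ℂ)) * f ξ

/-- `C(n,s) = (∫ (1 - cos ω₁) / |ω|^{n+2s} dω)⁻¹`. -/
def fracConst (n : ℕ) [NeZero n] (s : ℝ) : ℝ :=
  (∫ w : Rn n, (1 - Real.cos (w 0)) / ‖w‖ ^ ((n : ℝ) + 2 * s))⁻¹

/-- The integrand `(2u(x) - u(x+y) - u(x-y)) / |y|^{n+2s}`. -/
def fracIntegrand {n : ℕ} (s : ℝ) (u : Rn n → ℂ) (x y : Rn n) : ℂ :=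
  (2 * u x - u (x + y) - u (x - y)) / ((‖y‖ ^ ((n : ℝ) + 2 * s) : ℝ) : ℂ)

/-- `(-Δ)^s u(x) = (C(n,s)/2) ∫ (2u(x) - u(x+y) - u(x-y)) / |y|^{n+2s} dy`. -/
def fracLaplacian {n : ℕ} [NeZero n] (s : ℝ) (u : Rn n → ℂ) (x : Rn n) : ℂ :=
  (fracConst n s / 2) • ∫ y : Rn n, fracIntegrand s u x y

/-- `[v]_G² = ∫ |ξ|^{2s} |v(ξ)|² dξ`, possibly infinite. -/
def seminormGSq {n : ℕ} (s : ℝ) (v : Rn n → ℂ) : ENNReal :=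
  ∫⁻ ξ : Rn n, ENNReal.ofReal (‖ξ‖ ^ (2 * s) * ‖v ξ‖ ^ 2)

/-! ### The half-space -/

/-- `ℝⁿ × (0,∞)`, an open subset of `ℝⁿ × ℝ` with Lebesgue measure. -/
def halfSpace (n : ℕ) : Set (Rn n × ℝ) := {X | 0 < X.2}

/-- The coordinate direction `x_i`. -/
def dirX {n : ℕ} (i : Fin n) : Rn n × ℝ := (EuclideanSpace.single i 1, 0)

/-- The coordinate direction `y`. -/
def dirY (n : ℕ) : Rn n × ℝ := (0, 1)

/-- The classical partial derivative `∂_{x_i} V`. -/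
def partialX {n : ℕ} (i : Fin n) (V : Rn n × ℝ → ℂ) (X : Rn n × ℝ) : ℂ := fderiv ℝ V X (dirX i)

/-- The classical partial derivative `∂_y V`. -/
def partialY {n : ℕ} (V : Rn n × ℝ → ℂ) (X : Rn n × ℝ) : ℂ := fderiv ℝ V X (dirY n)

/-- The `x_i`-component of `y^{1-2s} ∇V`. -/
def fluxX {n : ℕ} (s : ℝ) (i : Fin n) (V : Rn n × ℝ → ℂ) (X : Rn n × ℝ) : ℂ :=
  (X.2 ^ (1 - 2 * s)) • partialX i V X

/-- The `y`-component of `y^{1-2s} ∇V`. -/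
def fluxY {n : ℕ} (s : ℝ) (V : Rn n × ℝ → ℂ) (X : Rn n × ℝ) : ℂ :=
  (X.2 ^ (1 - 2 * s)) • partialY V X

/-- `div(y^{1-2s} ∇V) = 0` at every point of the half-space in the classical sense: `V` and the
components of `y^{1-2s} ∇V` are differentiable there, and the divergence vanishes. -/
def SolvesExtension {n : ℕ} (s : ℝ) (V : Rn n × ℝ → ℂ) : Prop :=
  ∀ X ∈ halfSpace n, DifferentiableAt ℝ V X ∧ (∀ i, DifferentiableAt ℝ (fluxX s i V) X) ∧
    DifferentiableAt ℝ (fluxY s V) X ∧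
    ∑ i, partialX i (fluxX s i V) X + partialY (fluxY s V) X = 0

/-- `V ∈ W^{1,1}_loc(ℝⁿ × (0,∞))`. -/
def IsW11loc {n : ℕ} (V : Rn n × ℝ → ℂ) : Prop :=
  (∀ i, ∃ D, HasWeakDeriv (halfSpace n) (dirX i) V D) ∧
    ∃ D, HasWeakDeriv (halfSpace n) (dirY n) V D

/-- The weighted Dirichlet energy `[V]_a² = ∫ y^{1-2s} |∇V|² dX`, possibly infinite. -/
def energy {n : ℕ} (s : ℝ) (V : Rn n × ℝ → ℂ) : ENNReal :=
  ∫⁻ X in halfSpace n, ENNReal.ofReal (X.2 ^ (1 - 2 * s) *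
    (∑ i, ‖weakDeriv (halfSpace n) (dirX i) V X‖ ^ 2 +
      ‖weakDeriv (halfSpace n) (dirY n) V X‖ ^ 2))

/-- The class of extensions of `u`: all `V ∈ W^{1,1}_loc` such that for every `x` the map
`y ↦ V(x,y)` is continuous on `[0,∞)` with `V(x,0) = u(x)`. -/
def extensionClass {n : ℕ} (u : Rn n → ℂ) : Set (Rn n × ℝ → ℂ) :=
  {V | IsW11loc V ∧ ∀ x, ContinuousOn (fun y => V (x, y)) (Ici 0) ∧ V (x, 0) = u x}

/-- `U(x,y) = 𝓕⁻¹(û(ξ) g(|ξ| y))(x)`. -/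
def extension {n : ℕ} (g : ℝ → ℝ) (u : Rn n → ℂ) (X : Rn n × ℝ) : ℂ :=
  fourierTInv (fun ξ => fourierT u ξ * ((g (‖ξ‖ * X.2) : ℝ) : ℂ)) X.1

/-- `F y` (for `y > 0`) and `f` are in `L¹_loc(ℝⁿ)` and `F y → f` in the sense of distributions
on `ℝⁿ` as `y → 0⁺`. -/
def DistribTendsto {n : ℕ} (F : ℝ → Rn n → ℂ) (f : Rn n → ℂ) : Prop :=
  (∀ y > 0, LocallyIntegrable (F y)) ∧ LocallyIntegrable f ∧
    ∀ φ : Rn n → ℝ, ContDiff ℝ ∞ φ → HasCompactSupport φ →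
      Tendsto (fun y => ∫ x, φ x • F y x) (𝓝[>] 0) (𝓝 (∫ x, φ x • f x))

end FracExt

end

/-! Write a = 1 - 2s. The Euler-Lagrange equation of `G` is (t^a g')' = t^a g. With h = -t^a g' it
becomes the first-order system g' = -t^(2s-1) h, h' = -t^a g. Both components are explicit: g =
`prof s` is a normalized integral of r^(s-1) exp(-r - t²/(4r)), and h = `flux s` is a multiple of
the same integral with s replaced by 1 - s. Hence g and h are continuous up to t = 0, bounded, and
decay at least like t^(-2), with g(0) = 1 and h(0) = 2^(1-2s) Γ(1-s)/Γ(s).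

The density of `G` at g is -(g h)', so `G s (prof s)` is h(0). Since h(t) is the tail integral of
y^a g over (t,∞), Fubini gives ∫ w' h = ∫ t^a g w - h(0) for every admissible w of finite energy.
Expanding squares, the energy of the difference w - g equals G(w) - h(0) (`integral_admissible`).
Therefore g is a minimizer, the constant `CSharp` is h(0), and every minimizer agrees with g on
[0,∞) (`IsProfile.eqOn`), so it suffices to study `prof s`.

On the Fourier side everything is a superposition F⁻¹(m(ξ) k(|ξ|y)) with m rapidly decaying and k =
g or k = h. The first equation of the system gives -y^a ∂_y U = F⁻¹(|ξ|^(2s) û h(|ξ|y)). This is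
continuous down to y = 0, where it equals h(0) F⁻¹(|ξ|^(2s) û); it is h(0) times the fractional
Laplacian of u, because second differences have symbol 2(1 - cos(y·ξ)), whose integral against
|y|^(-n-2s) is computed by rotation and scaling. The second equation gives div(y^a ∇U) = 0.
Plancherel at each height followed by the scaling t = |ξ|y turns the Dirichlet energy of U into the
one-dimensional one and yields its value.

For minimality it is enough that Re⟨∇V, ∇U⟩ in the weighted space equals [U]² for every V of finite
energy in the class; Young's inequality then gives 2[U]² ≤ [V]² + [U]². Put Q = F⁻¹(|ξ|² û g(|ξ|y)).
Integration by parts on almost every horizontal slice turns the horizontal pairing into ∫ y^a V Q̄.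
On almost every vertical line V is recovered from its weak derivative, the flux of U is the tail
integral of y^a Q, and Fubini gives -∫ y^a (V - u) Q̄ for the vertical pairing. In the sum V
cancels, and what is left depends only on u and equals [U]² by Parseval. Finite energy controls V -
u through the Cauchy-Schwarz bound |V(x,y) - u(x)| ≤ C y^s e(x)^(1/2), with e(x) the weighted energy
of the vertical slice; this supplies all the integrability needed. -/

noncomputable section

namespace FracExt

/-! ### The Bessel-type integral and the profile -/

/-- `∫₀^∞ r^{s-1} e^{-r - t²/(4r)} dr`. -/
def besselInt (s t : ℝ) : ℝ := ∫ r in Ioi (0 : ℝ), r ^ (s - 1) * Real.exp (-r - t ^ 2 / (4 * r))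

lemma besselInt_zero (s : ℝ) (hs : 0 < s) : besselInt s 0 = Real.Gamma s := by
  rw [besselInt, Real.Gamma_eq_integral hs]
  refine setIntegral_congr_fun measurableSet_Ioi fun r hr => ?_
  simp [mul_comm]

lemma measurable_besselIntegrand (s t : ℝ) :
    Measurable fun r : ℝ => r ^ (s - 1) * Real.exp (-r - t ^ 2 / (4 * r)) := by
  fun_prop

lemma integrableOn_gamma {s : ℝ} (hs : 0 < s) :
    IntegrableOn (fun r : ℝ => r ^ (s - 1) * Real.exp (-r)) (Ioi 0) := by
  have := Real.GammaIntegral_convergent hs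
  refine this.congr_fun (fun r _ => ?_) measurableSet_Ioi
  simp [mul_comm]

lemma besselIntegrand_le {s t r : ℝ} (hr : 0 < r) :
    r ^ (s - 1) * Real.exp (-r - t ^ 2 / (4 * r)) ≤ r ^ (s - 1) * Real.exp (-r) := by
  have : 0 ≤ t ^ 2 / (4 * r) := by positivity
  gcongr
  linarith

lemma integrableOn_besselIntegrand {s : ℝ} (hs : 0 < s) (t : ℝ) :
    IntegrableOn (fun r : ℝ => r ^ (s - 1) * Real.exp (-r - t ^ 2 / (4 * r))) (Ioi 0) := by
  refine (integrableOn_gamma hs).mono' (measurable_besselIntegrand s t).aestronglyMeasurable ?_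
  filter_upwards [ae_restrict_mem measurableSet_Ioi] with r hr
  have hr : 0 < r := hr
  rw [Real.norm_of_nonneg (by positivity)]
  exact besselIntegrand_le hr

lemma besselInt_nonneg (s t : ℝ) : 0 ≤ besselInt s t := by
  refine setIntegral_nonneg measurableSet_Ioi fun r hr => ?_
  have hr : 0 < r := hr
  positivity

lemma besselInt_le {s : ℝ} (hs : 0 < s) (t : ℝ) : besselInt s t ≤ Real.Gamma s := by
  rw [← besselInt_zero s hs]
  refine setIntegral_mono_on (integrableOn_besselIntegrand hs t) (integrableOn_besselIntegrand hs 0)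
    measurableSet_Ioi fun r hr => ?_
  have := besselIntegrand_le (s := s) (t := t) (r := r) hr
  simpa using this

lemma exp_neg_div_le {t r : ℝ} (ht : t ≠ 0) (hr : 0 < r) :
    Real.exp (- (t ^ 2 / (4 * r))) ≤ 4 * r / t ^ 2 := by
  have h : 0 < t ^ 2 / (4 * r) := by positivity
  rw [Real.exp_neg, show 4 * r / t ^ 2 = (t ^ 2 / (4 * r))⁻¹ by rw [inv_div]]
  gcongr
  linarith [Real.add_one_le_exp (t ^ 2 / (4 * r))]

/-- From exp(-z) ≤ 1/z with z = t²/(4r). The true decay is exponential, but t^(-2) is enough for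
every domination argument below. -/
lemma besselInt_le_div {s : ℝ} (hs : 0 < s) {t : ℝ} (ht : t ≠ 0) :
    besselInt s t ≤ 4 * Real.Gamma (s + 1) / t ^ 2 := by
  have h1 : besselInt s t ≤ ∫ r in Ioi (0 : ℝ), 4 / t ^ 2 * (r ^ (s + 1 - 1) * Real.exp (-r)) := by
    refine setIntegral_mono_on (integrableOn_besselIntegrand hs t)
      ((integrableOn_gamma (by linarith)).const_mul _) measurableSet_Ioi fun r hr => ?_
    have hr : 0 < r := hr
    rw [sub_eq_add_neg (-r), Real.exp_add, add_sub_cancel_right]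
    have h2 : r ^ s = r ^ (s - 1) * r := by
      rw [← Real.rpow_add_one hr.ne']; simp
    calc _ ≤ r ^ (s - 1) * (Real.exp (-r) * (4 * r / t ^ 2)) := by
          gcongr; exact exp_neg_div_le ht hr
      _ = _ := by rw [h2]; ring
  refine h1.trans_eq ?_
  rw [integral_const_mul, Real.Gamma_eq_integral (by linarith)]
  rw [div_mul_eq_mul_div]
  congr 2
  exact setIntegral_congr_fun measurableSet_Ioi fun r _ => by simp [mul_comm]

lemma continuous_besselInt {s : ℝ} (hs : 0 < s) : Continuous (besselInt s) := by
  refine continuous_of_dominated (bound := fun r => r ^ (s - 1) * Real.exp (-r))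
    (fun t => (measurable_besselIntegrand s t).aestronglyMeasurable) (fun t => ?_)
    (integrableOn_gamma hs) (ae_of_all _ fun r => by fun_prop)
  filter_upwards [ae_restrict_mem measurableSet_Ioi] with r hr
  have hr : 0 < r := hr
  rw [Real.norm_of_nonneg (by positivity)]
  exact besselIntegrand_le hr

/-- The substitution r ↦ t²/(4r) exchanges the two terms in the exponent. This is the symmetry K_σ =
K_(-σ) of the modified Bessel functions, carried out as an inversion followed by a dilation. -/
lemma besselInt_reflect (σ : ℝ) {t : ℝ} (ht : 0 < t) :
    besselInt σ t = (t ^ 2 / 4) ^ σ * besselInt (-σ) t := by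
  have hT : 0 < t ^ 2 / 4 := by positivity
  rw [besselInt, ← integral_comp_rpow_Ioi _ (show (-1 : ℝ) ≠ 0 by norm_num)]
  have h := integral_comp_mul_left_Ioi' (fun x : ℝ => (|(-1 : ℝ)| * x ^ ((-1 : ℝ) - 1)) •
    ((x ^ (-1 : ℝ)) ^ (σ - 1) * Real.exp (-x ^ (-1 : ℝ) - t ^ 2 / (4 * x ^ (-1 : ℝ))))) 0
    (inv_pos.2 hT)
  rw [mul_zero] at h
  rw [← h, besselInt, ← integral_const_mul, smul_eq_mul, ← integral_const_mul]
  refine setIntegral_congr_fun measurableSet_Ioi fun r hr => ?_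
  have hr : 0 < r := hr
  simp only [smul_eq_mul, Real.rpow_neg_one, mul_inv, inv_inv]
  have e1 : -(t ^ 2 / 4 * r⁻¹) - t ^ 2 / (4 * (t ^ 2 / 4 * r⁻¹)) = -r - t ^ 2 / (4 * r) := by
    field_simp
    ring
  have e2 : (t ^ 2 / 4)⁻¹ * (|(-1 : ℝ)| * ((t ^ 2 / 4)⁻¹ * r) ^ ((-1 : ℝ) - 1)) *
      (t ^ 2 / 4 * r⁻¹) ^ (σ - 1) = (t ^ 2 / 4) ^ σ * r ^ (-σ - 1) := by
    -- Writing both positive numbers as exponentials reduces the identity between powers to an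
    -- identity between exponents.
    generalize t ^ 2 / 4 = T at hT
    obtain ⟨τ, rfl⟩ : ∃ τ, Real.exp τ = T := ⟨Real.log T, Real.exp_log hT⟩
    obtain ⟨ρ, rfl⟩ : ∃ ρ, Real.exp ρ = r := ⟨Real.log r, Real.exp_log hr⟩
    rw [abs_neg, abs_one, one_mul]
    simp only [← Real.exp_neg, ← Real.exp_add, ← Real.exp_mul]
    congr 1
    ring
  rw [e1, ← mul_assoc ((t ^ 2 / 4) ^ σ), ← e2]
  ring

/-- Differentiation under the integral produces a factor 1/r, which lowers the exponent from s - 1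
to s - 2. Away from t = 0 the factor exp(-τ²/(4r)) ≤ 4r/τ² absorbs it. -/
lemma hasDerivAt_besselInt_aux {s : ℝ} (hs : 0 < s) {t : ℝ} (ht : 0 < t) :
    HasDerivAt (besselInt s) (-(t / 2) * besselInt (s - 1) t) t := by
  have hmeas : Measurable fun r : ℝ => r ^ (s - 1) * (-(t / (2 * r))
      * Real.exp (-r - t ^ 2 / (4 * r))) := by fun_prop
  have key := (hasDerivAt_integral_of_dominated_loc_of_deriv_le (μ := volume.restrict (Ioi (0:ℝ)))
    (F := fun t r => r ^ (s - 1) * Real.exp (-r - t ^ 2 / (4 * r)))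
    (F' := fun t r => r ^ (s - 1) * (-(t / (2 * r)) * Real.exp (-r - t ^ 2 / (4 * r))))
    -- On τ > t/2 the estimate produces the constant 2/τ, for which 8/(t/2) is a generous majorant.
    (bound := fun r => (8 / (t / 2)) * (r ^ (s - 1) * Real.exp (-r)))
    (Ioi_mem_nhds (show t / 2 < t by linarith))
    (Eventually.of_forall fun t => (measurable_besselIntegrand s t).aestronglyMeasurable)
    (integrableOn_besselIntegrand hs t) hmeas.aestronglyMeasurable ?_
    ((integrableOn_gamma hs).const_mul _) ?_).2
  · refine key.congr_deriv ?_
    rw [besselInt, ← integral_const_mul]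
    refine setIntegral_congr_fun measurableSet_Ioi fun r hr => ?_
    have hr : 0 < r := hr
    have h2 : r ^ (s - 1) = r ^ (s - 1 - 1) * r := by
      rw [← Real.rpow_add_one hr.ne']; simp
    rw [h2]
    field_simp
  · filter_upwards [ae_restrict_mem measurableSet_Ioi] with r hr τ hτ
    have hr : 0 < r := hr
    have hτ : t / 2 < τ := hτ
    have hτ0 : 0 < τ := by linarith
    rw [norm_mul, norm_mul, norm_neg, Real.norm_of_nonneg (by positivity),
      Real.norm_of_nonneg (by positivity), Real.norm_of_nonneg (by positivity),
      sub_eq_add_neg (-r), Real.exp_add]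
    calc _ ≤ r ^ (s - 1) * (τ / (2 * r) * (Real.exp (-r) * (4 * r / τ ^ 2))) := by
          gcongr; exact exp_neg_div_le hτ0.ne' hr
      _ = (2 / τ) * (r ^ (s - 1) * Real.exp (-r)) := by field_simp; norm_num
      _ ≤ (8 / (t / 2)) * (r ^ (s - 1) * Real.exp (-r)) := by gcongr; norm_num
  · filter_upwards [ae_restrict_mem measurableSet_Ioi] with r hr τ hτ
    have hr : 0 < r := hr
    have h1 : HasDerivAt (fun τ : ℝ => -r - τ ^ 2 / (4 * r)) (-(τ / (2 * r))) τ := by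
      have := ((hasDerivAt_pow 2 τ).div_const (4 * r)).const_sub (-r)
      refine this.congr_deriv ?_
      push_cast
      field_simp
      ring
    refine (h1.exp.const_mul (r ^ (s - 1))).congr_deriv ?_
    ring

/-- The parameter s - 1 of the raw derivative is negative; reflection replaces it by 1 - s > 0. The
derivative is thus a power of t times an integral of the same family that stays bounded at t = 0,
and the roles of s and 1 - s become symmetric. -/
lemma hasDerivAt_besselInt {s : ℝ} (hs : 0 < s) {t : ℝ} (ht : 0 < t) :
    HasDerivAt (besselInt s)
      (-(2 ^ (1 - 2 * s) * (t ^ (2 * s - 1) * besselInt (1 - s) t))) t := by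
  refine (hasDerivAt_besselInt_aux hs ht).congr_deriv ?_
  rw [besselInt_reflect (s - 1) ht, neg_sub]
  have e : t / 2 * (t ^ 2 / 4) ^ (s - 1) = 2 ^ (1 - 2 * s) * t ^ (2 * s - 1) := by
    rw [show t ^ 2 / 4 = (t / 2) ^ (2 : ℝ) by norm_num; ring, ← Real.rpow_mul (by positivity),
      show (t / 2) * (t / 2) ^ (2 * (s - 1)) = (t / 2) ^ (2 * (s - 1)) * (t / 2) by ring,
      ← Real.rpow_add_one (by positivity), Real.div_rpow ht.le (by norm_num), div_eq_mul_inv,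
      ← Real.rpow_neg (by norm_num), mul_comm]
    congr 2 <;> ring
  rw [← mul_assoc, ← mul_assoc, ← e]
  ring

/-- The minimizing profile of the one-dimensional problem. -/
def prof (s t : ℝ) : ℝ := besselInt s t / Real.Gamma s

/-- The weighted flux `-t^{1-2s} g'(t)` of the profile. -/
def flux (s t : ℝ) : ℝ := 2 ^ (1 - 2 * s) / Real.Gamma s * besselInt (1 - s) t

section Profile

variable {s : ℝ} (hs0 : 0 < s) (hs1 : s < 1)
include hs0

lemma prof_zero : prof s 0 = 1 := by
  rw [prof, besselInt_zero s hs0, div_self (Real.Gamma_pos_of_pos hs0).ne']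

lemma prof_nonneg (t : ℝ) : 0 ≤ prof s t :=
  div_nonneg (besselInt_nonneg s t) (Real.Gamma_pos_of_pos hs0).le

lemma prof_le_one (t : ℝ) : prof s t ≤ 1 :=
  (div_le_one (Real.Gamma_pos_of_pos hs0)).2 (besselInt_le hs0 t)

lemma continuous_prof : Continuous (prof s) := (continuous_besselInt hs0).div_const _

lemma exists_prof_le_div : ∃ C, 0 ≤ C ∧ ∀ t, t ≠ 0 → prof s t ≤ C / t ^ 2 := by
  refine ⟨4 * Real.Gamma (s + 1) / Real.Gamma s, ?_, fun t ht => ?_⟩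
  · have := Real.Gamma_pos_of_pos hs0
    have := Real.Gamma_pos_of_pos (s := s + 1) (by linarith)
    positivity
  · rw [prof, div_right_comm]
    have := Real.Gamma_pos_of_pos hs0
    gcongr
    exact besselInt_le_div hs0 ht

lemma flux_nonneg (t : ℝ) : 0 ≤ flux s t := by
  have := Real.Gamma_pos_of_pos hs0
  have := besselInt_nonneg (1 - s) t
  unfold flux
  positivity

lemma hasDerivAt_prof {t : ℝ} (ht : 0 < t) :
    HasDerivAt (prof s) (-(t ^ (2 * s - 1) * flux s t)) t := by
  refine ((hasDerivAt_besselInt hs0 ht).div_const (Real.Gamma s)).congr_deriv ?_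
  rw [flux]
  ring

include hs1

omit hs0 in
lemma continuous_flux : Continuous (flux s) :=
  (continuous_besselInt (by linarith)).const_mul _

lemma flux_le (t : ℝ) : flux s t ≤ flux s 0 := by
  have := Real.Gamma_pos_of_pos hs0
  rw [flux, flux, besselInt_zero _ (by linarith)]
  gcongr
  exact besselInt_le (by linarith) t

lemma flux_zero_pos : 0 < flux s 0 := by
  have := Real.Gamma_pos_of_pos hs0
  have := Real.Gamma_pos_of_pos (s := 1 - s) (by linarith)
  rw [flux, besselInt_zero _ (by linarith)]
  positivity

lemma exists_flux_le_div : ∃ C, 0 ≤ C ∧ ∀ t, t ≠ 0 → flux s t ≤ C / t ^ 2 := by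
  have h1 := Real.Gamma_pos_of_pos hs0
  have h2 := Real.Gamma_pos_of_pos (s := 1 - s + 1) (by linarith)
  refine ⟨2 ^ (1 - 2 * s) / Real.Gamma s * (4 * Real.Gamma (1 - s + 1)), by positivity,
    fun t ht => ?_⟩
  rw [flux, mul_div_assoc]
  gcongr
  exact besselInt_le_div (by linarith) ht

omit hs0 in
-- This is the formula for the derivative of the Bessel-type integral with s replaced by 1 - s; the
-- powers of 2 cancel. Together with `hasDerivAt_prof` it is the equation (t^(1-2s) g')' = t^(1-2s)
-- g written as a first-order system whose two unknowns are continuous at 0.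
lemma hasDerivAt_flux {t : ℝ} (ht : 0 < t) :
    HasDerivAt (flux s) (-(t ^ (1 - 2 * s) * prof s t)) t := by
  refine ((hasDerivAt_besselInt (s := 1 - s) (by linarith) ht).const_mul
    (2 ^ (1 - 2 * s) / Real.Gamma s)).congr_deriv ?_
  have e : (2 : ℝ) ^ (1 - 2 * s) * 2 ^ (1 - 2 * (1 - s)) = 1 := by
    rw [← Real.rpow_add (by norm_num)]
    ring_nf
    simp
  rw [prof, sub_sub_cancel, show 2 * (1 - s) - 1 = 1 - 2 * s by ring]
  linear_combination (-(t ^ (1 - 2 * s) * besselInt s t) / Real.Gamma s) * e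

lemma tendsto_flux_atTop : Tendsto (flux s) atTop (𝓝 0) := by
  obtain ⟨C, -, hC⟩ := exists_flux_le_div hs0 hs1
  refine squeeze_zero' (Eventually.of_forall fun t => flux_nonneg hs0 t)
    ((eventually_gt_atTop 0).mono fun t ht => hC t (ne_of_gt ht)) ?_
  exact tendsto_const_nhds.div_atTop (tendsto_pow_atTop two_ne_zero)

lemma integrableOn_weight_prof : IntegrableOn (fun t => t ^ (1 - 2 * s) * prof s t) (Ioi 0) := by
  have h := integrableOn_Ioi_deriv_of_nonpos (a := 0) (g := flux s)
    (continuous_flux hs1).continuousWithinAt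
    (fun t ht => hasDerivAt_flux hs1 ht) (fun t ht => ?_) (tendsto_flux_atTop hs0 hs1)
  · simpa using h.neg
  · have ht : 0 < t := ht
    have := prof_nonneg hs0 t
    have : 0 ≤ t ^ (1 - 2 * s) * prof s t := by positivity
    linarith

/-- Integrates the second equation of the system up to infinity, where the flux vanishes. The flux
as a tail integral allows Fubini to do the work of an integration by parts, with no boundary term at
infinity to discuss. -/
lemma integral_Ioi_weight_prof {t : ℝ} (ht : 0 ≤ t) :
    ∫ τ in Ioi t, τ ^ (1 - 2 * s) * prof s τ = flux s t := by
  have h := integral_Ioi_of_hasDerivAt_of_tendsto (a := t) (f := flux s)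
    (continuous_flux hs1).continuousWithinAt
    (fun τ hτ => hasDerivAt_flux hs1 (ht.trans_lt hτ))
    ((integrableOn_weight_prof hs0 hs1).mono_set (Ioi_subset_Ioi ht)).neg
    (tendsto_flux_atTop hs0 hs1)
  rw [integral_neg] at h
  linarith

omit hs0 hs1 in
lemma weight_mul_deriv_sq {t : ℝ} (ht : 0 < t) :
    t ^ (1 - 2 * s) * (t ^ (2 * s - 1) * flux s t) ^ 2 = t ^ (2 * s - 1) * flux s t ^ 2 := by
  have : t ^ (1 - 2 * s) * t ^ (2 * s - 1) = 1 := by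
    rw [← Real.rpow_add ht]; ring_nf; simp
  linear_combination (t ^ (2 * s - 1) * flux s t ^ 2) * this

/-- By the first-order system the energy density is minus the derivative of `prof s * flux s`. Its
constant sign gives integrability, and the product falls from `flux s 0` at 0 to 0 at infinity. -/
lemma prof_energy :
    IntegrableOn (fun t => t ^ (1 - 2 * s) * (prof s t ^ 2 + (t ^ (2 * s - 1) * flux s t) ^ 2))
      (Ioi 0) ∧
    ∫ t in Ioi (0 : ℝ), t ^ (1 - 2 * s) * (prof s t ^ 2 + (t ^ (2 * s - 1) * flux s t) ^ 2)
      = flux s 0 := by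
  have hd : ∀ t ∈ Ioi (0 : ℝ), HasDerivAt (fun t => prof s t * flux s t)
      (-(t ^ (1 - 2 * s) * (prof s t ^ 2 + (t ^ (2 * s - 1) * flux s t) ^ 2))) t := by
    intro t ht
    refine ((hasDerivAt_prof hs0 ht).mul (hasDerivAt_flux hs1 ht)).congr_deriv ?_
    rw [mul_add, weight_mul_deriv_sq ht]
    ring
  have hneg : ∀ t ∈ Ioi (0 : ℝ),
      -(t ^ (1 - 2 * s) * (prof s t ^ 2 + (t ^ (2 * s - 1) * flux s t) ^ 2)) ≤ 0 := by
    intro t ht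
    have ht : 0 < t := ht
    have : 0 ≤ t ^ (1 - 2 * s) * (prof s t ^ 2 + (t ^ (2 * s - 1) * flux s t) ^ 2) := by positivity
    linarith
  have hlim : Tendsto (fun t => prof s t * flux s t) atTop (𝓝 0) := by
    refine squeeze_zero (fun t => mul_nonneg (prof_nonneg hs0 t) (flux_nonneg hs0 t))
      (fun t => ?_) (tendsto_flux_atTop hs0 hs1)
    exact mul_le_of_le_one_left (flux_nonneg hs0 t) (prof_le_one hs0 t)
  have hc : ContinuousWithinAt (fun t => prof s t * flux s t) (Ici 0) 0 :=
    ((continuous_prof hs0).mul (continuous_flux hs1)).continuousWithinAt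
  constructor
  · simpa using (integrableOn_Ioi_deriv_of_nonpos hc hd hneg hlim).neg
  · have := integral_Ioi_of_hasDerivAt_of_nonpos hc hd hneg hlim
    rw [integral_neg, prof_zero hs0] at this
    linarith

end Profile

/-! ### Weak derivatives -/

section WeakLemmas

variable {E F : Type*} [NormedAddCommGroup E] [NormedSpace ℝ E] [MeasureSpace E] [BorelSpace E]
  [NormedAddCommGroup F] [NormedSpace ℝ F]

omit [NormedSpace ℝ E] in
lemma integrable_smul_of_tsupport_subset {Ω : Set E} {V : E → F} (hV : LocallyIntegrableOn V Ω)
    {φ : E → ℝ} (hφ : Continuous φ) (hc : HasCompactSupport φ) (hs : tsupport φ ⊆ Ω) :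
    Integrable (fun x => φ x • V x) := by
  have h1 : IntegrableOn V (tsupport φ) := hV.integrableOn_compact_subset hs hc
  have h2 : IntegrableOn (fun x => φ x • V x) (tsupport φ) :=
    h1.continuousOn_smul hφ.continuousOn hc
  rwa [integrableOn_iff_integrable_of_support_subset] at h2
  intro x hx
  apply subset_tsupport
  intro h0
  simp [h0] at hx

omit [NormedSpace ℝ E] [BorelSpace E] in
lemma setIntegral_smul_of_tsupport_subset {Ω : Set E} (V : E → F)
    {φ : E → ℝ} (hs : tsupport φ ⊆ Ω) :
    ∫ x in Ω, φ x • V x = ∫ x, φ x • V x := by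
  refine setIntegral_eq_integral_of_forall_compl_eq_zero fun x hx => ?_
  rw [image_eq_zero_of_notMem_tsupport fun h => hx (hs h), zero_smul]

omit [MeasureSpace E] [BorelSpace E] in
lemma tsupport_fderiv_apply_subset' (φ : E → ℝ) (v : E) :
    tsupport (fun x => fderiv ℝ φ x v) ⊆ tsupport φ :=
  tsupport_fderiv_apply_subset ℝ v

lemma HasWeakDeriv.ae_eq [FiniteDimensional ℝ E] [CompleteSpace F] {Ω : Set E} (hΩ : IsOpen Ω)
    {v : E} {V D D' : E → F} (h : HasWeakDeriv Ω v V D) (h' : HasWeakDeriv Ω v V D') :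
    D =ᵐ[volume.restrict Ω] D' := by
  have hl : LocallyIntegrableOn (fun x => D x - D' x) Ω := h.2.1.sub h'.2.1
  have := hΩ.ae_eq_zero_of_integral_contDiff_smul_eq_zero hl fun φ hφ hc hs => by
    simp_rw [smul_sub]
    rw [integral_sub (integrable_smul_of_tsupport_subset h.2.1 hφ.continuous hc hs)
      (integrable_smul_of_tsupport_subset h'.2.1 hφ.continuous hc hs),
      ← setIntegral_smul_of_tsupport_subset D hs, ← setIntegral_smul_of_tsupport_subset D' hs,
      sub_eq_zero, ← neg_inj, ← h.2.2 φ hφ hc hs, ← h'.2.2 φ hφ hc hs]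
  rw [EventuallyEq, ae_restrict_iff' hΩ.measurableSet]
  filter_upwards [this] with x hx hxΩ
  exact sub_eq_zero.1 (hx hxΩ)

omit [BorelSpace E] in
lemma hasWeakDeriv_weakDeriv {Ω : Set E} {v : E} {V : E → F}
    (h : ∃ D, HasWeakDeriv Ω v V D) : HasWeakDeriv Ω v V (weakDeriv Ω v V) := by
  rw [weakDeriv, dif_pos h]
  exact h.choose_spec

/-- Differentiability in Ω supplies the product rule and continuity of the one directional
derivative supplies integrability. Since φ is supported in Ω, no condition on V outside Ω is needed.
-/
lemma hasWeakDeriv_of_differentiableAt [FiniteDimensional ℝ E]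
    [(volume : Measure E).IsAddHaarMeasure] {Ω : Set E} (hΩ : IsOpen Ω)
    {v : E} {V : E → F} (hd : ∀ x ∈ Ω, DifferentiableAt ℝ V x)
    (hc : ContinuousOn (fun x => fderiv ℝ V x v) Ω) :
    HasWeakDeriv Ω v V (fun x => fderiv ℝ V x v) := by
  have hV : LocallyIntegrableOn V Ω :=
    ContinuousOn.locallyIntegrableOn (fun x hx => (hd x hx).continuousAt.continuousWithinAt)
      hΩ.measurableSet
  have hD : LocallyIntegrableOn (fun x => fderiv ℝ V x v) Ω :=
    hc.locallyIntegrableOn hΩ.measurableSet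
  refine ⟨hV, hD, fun φ hφ hcs hs => ?_⟩
  have hs' := (tsupport_fderiv_apply_subset' φ v).trans hs
  have hφ' : Continuous fun x => fderiv ℝ φ x v :=
    (hφ.continuous_fderiv (by simp)).clm_apply continuous_const
  rw [setIntegral_smul_of_tsupport_subset _ hs, setIntegral_smul_of_tsupport_subset V hs']
  rw [integral_smul_fderiv_eq_neg_fderiv_smul_of_integrable, neg_neg]
  · exact integrable_smul_of_tsupport_subset hV hφ'
      (hcs.of_isClosed_subset (isClosed_tsupport _) (tsupport_fderiv_apply_subset' φ v)) hs'
  · exact integrable_smul_of_tsupport_subset hD hφ.continuous hcs hs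
  · exact integrable_smul_of_tsupport_subset hV hφ.continuous hcs hs
  · exact fun x _ => (hφ.differentiable (by simp)) x
  · exact fun x hx => hd x (hs hx)

end WeakLemmas

/-! ### Reconstruction of a function on the half-line from its weak derivative -/

/-- A smooth approximation of the indicator function of `(b, c]`. -/
def stepDiff (k : ℕ) (b c t : ℝ) : ℝ :=
  Real.smoothTransition ((k + 1) * (t - b)) - Real.smoothTransition ((k + 1) * (t - c))

lemma contDiff_step (k : ℕ) (b : ℝ) :
    ContDiff ℝ ∞ fun t : ℝ => Real.smoothTransition ((k + 1) * (t - b)) :=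
  Real.smoothTransition.contDiff.comp (by fun_prop)

lemma contDiff_stepDiff (k : ℕ) (b c : ℝ) : ContDiff ℝ ∞ (stepDiff k b c) :=
  (contDiff_step k b).sub (contDiff_step k c)

lemma stepDiff_eq_zero {k : ℕ} {b c t : ℝ} (hbc : b ≤ c) (ht : t ∉ Icc b (c + 1)) :
    stepDiff k b c t = 0 := by
  have hk : (0 : ℝ) ≤ k := k.cast_nonneg
  rw [mem_Icc, not_and_or, not_le, not_le] at ht
  rcases ht with h | h
  · rw [stepDiff, Real.smoothTransition.zero_of_nonpos, Real.smoothTransition.zero_of_nonpos,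
      sub_zero] <;> exact mul_nonpos_of_nonneg_of_nonpos (by linarith) (by linarith)
  · rw [stepDiff, Real.smoothTransition.one_of_one_le, Real.smoothTransition.one_of_one_le,
      sub_self] <;> nlinarith

lemma tsupport_stepDiff {k : ℕ} {b c : ℝ} (hbc : b ≤ c) :
    tsupport (stepDiff k b c) ⊆ Icc b (c + 1) :=
  closure_minimal (fun _ ht => by_contra fun h => ht (stepDiff_eq_zero hbc h)) isClosed_Icc

lemma hasCompactSupport_stepDiff {k : ℕ} {b c : ℝ} (hbc : b ≤ c) :
    HasCompactSupport (stepDiff k b c) :=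
  isCompact_Icc.of_isClosed_subset (isClosed_tsupport _) (tsupport_stepDiff hbc)

lemma abs_stepDiff_le (k : ℕ) (b c t : ℝ) : |stepDiff k b c t| ≤ 1 := by
  rw [stepDiff, abs_le]
  constructor <;>
  linarith [Real.smoothTransition.le_one ((k + 1) * (t - b)),
    Real.smoothTransition.le_one ((k + 1) * (t - c)),
    Real.smoothTransition.nonneg ((k + 1) * (t - b)),
    Real.smoothTransition.nonneg ((k + 1) * (t - c))]

lemma tendsto_step (b t : ℝ) :
    Tendsto (fun k : ℕ => Real.smoothTransition ((k + 1) * (t - b))) atTop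
      (𝓝 (indicator (Ioi b) 1 t)) := by
  by_cases h : b < t
  · rw [indicator_of_mem (show t ∈ Ioi b from h)]
    have : Tendsto (fun k : ℕ => ((k : ℝ) + 1) * (t - b)) atTop atTop :=
      (tendsto_atTop_add_const_right _ _ tendsto_natCast_atTop_atTop).atTop_mul_const
        (sub_pos.2 h)
    refine tendsto_const_nhds.congr' ?_
    filter_upwards [this.eventually_ge_atTop 1] with k hk
    rw [Real.smoothTransition.one_of_one_le hk, Pi.one_apply]
  · rw [indicator_of_notMem (show t ∉ Ioi b from h)]
    refine tendsto_const_nhds.congr fun k => ?_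
    rw [Real.smoothTransition.zero_of_nonpos]
    exact mul_nonpos_of_nonneg_of_nonpos (by positivity) (by linarith)

lemma tendsto_stepDiff {b c : ℝ} (hbc : b ≤ c) (t : ℝ) :
    Tendsto (fun k : ℕ => stepDiff k b c t) atTop (𝓝 (indicator (Ioc b c) 1 t)) := by
  have h : indicator (Ioc b c) (1 : ℝ → ℝ) t =
      indicator (Ioi b) 1 t - indicator (Ioi c) 1 t := by
    simp only [indicator_apply, mem_Ioc, mem_Ioi, Pi.one_apply]
    split_ifs <;> grind
  rw [h]
  exact (tendsto_step b t).sub (tendsto_step c t)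

section

variable {F : Type*} [NormedAddCommGroup F] [NormedSpace ℝ F]

lemma deriv_smoothTransition_eq_zero {t : ℝ} (ht : t ∉ Icc (0 : ℝ) 1) :
    deriv Real.smoothTransition t = 0 := by
  rw [mem_Icc, not_and_or, not_le, not_le] at ht
  rcases ht with h | h
  · have : Real.smoothTransition =ᶠ[𝓝 t] fun _ => 0 := by
      filter_upwards [Iio_mem_nhds h] with x hx
      exact Real.smoothTransition.zero_of_nonpos (le_of_lt hx)
    rw [this.deriv_eq, deriv_const]
  · have : Real.smoothTransition =ᶠ[𝓝 t] fun _ => 1 := by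
      filter_upwards [Ioi_mem_nhds h] with x hx
      exact Real.smoothTransition.one_of_one_le (le_of_lt hx)
    rw [this.deriv_eq, deriv_const]

lemma continuous_deriv_smoothTransition : Continuous (deriv Real.smoothTransition) :=
  (Real.smoothTransition.contDiff (n := 1)).continuous_deriv le_rfl

lemma deriv_step (k : ℕ) (b t : ℝ) :
    deriv (fun t : ℝ => Real.smoothTransition ((k + 1) * (t - b))) t =
      (k + 1) * deriv Real.smoothTransition ((k + 1) * (t - b)) := by
  have h1 : HasDerivAt (fun t : ℝ => ((k : ℝ) + 1) * (t - b)) (k + 1) t := by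
    simpa using ((hasDerivAt_id t).sub_const b).const_mul ((k : ℝ) + 1)
  have h2 := ((Real.smoothTransition.contDiff (n := 1)).differentiable (by simp)
    (((k : ℝ) + 1) * (t - b))).hasDerivAt
  exact (h2.comp t h1).deriv.trans (mul_comm _ _)

lemma integrable_deriv_step_smul {v : ℝ → F} (hv : ContinuousOn v (Ioi 0)) {b : ℝ} (hb : 0 < b)
    (k : ℕ) : Integrable fun t =>
      deriv (fun t : ℝ => Real.smoothTransition ((k + 1) * (t - b))) t • v t := by
  have hsub : Icc b (b + 1) ⊆ Ioi 0 := fun t ht => hb.trans_le ht.1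
  have : IntegrableOn (fun t =>
      deriv (fun t : ℝ => Real.smoothTransition ((k + 1) * (t - b))) t • v t) (Icc b (b + 1)) := by
    refine ContinuousOn.integrableOn_compact isCompact_Icc (ContinuousOn.smul ?_ (hv.mono hsub))
    exact ((contDiff_step k b).continuous_deriv (by simp)).continuousOn
  rwa [integrableOn_iff_integrable_of_support_subset] at this
  intro t ht
  by_contra h
  apply ht
  simp only
  rw [deriv_step, deriv_smoothTransition_eq_zero, mul_zero, zero_smul]
  intro h'
  apply h
  have hk : (0 : ℝ) ≤ k := k.cast_nonneg
  rw [mem_Icc] at h' ⊢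
  constructor <;> nlinarith

variable [CompleteSpace F]

/-- The derivatives of the smoothed steps form an approximate identity supported in [b, b +
1/(k+1)], of total mass 1. After the dilation τ = (k+1)(t - b) the statement is continuity of v at b
with dominated convergence. -/
lemma tendsto_integral_deriv_step {v : ℝ → F} (hv : ContinuousOn v (Ioi 0)) {b : ℝ} (hb : 0 < b) :
    Tendsto (fun k : ℕ => ∫ t,
      deriv (fun t : ℝ => Real.smoothTransition ((k + 1) * (t - b))) t • v t) atTop (𝓝 (v b)) := by
  have hsub : Icc b (b + 1) ⊆ Ioi 0 := fun t ht => hb.trans_le ht.1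
  have e1 : ∀ k : ℕ, ∫ t, deriv (fun t : ℝ => Real.smoothTransition ((k + 1) * (t - b))) t • v t =
      ∫ τ in Icc (0 : ℝ) 1, deriv Real.smoothTransition τ • v (b + τ / (k + 1)) := by
    intro k
    have hk : (0 : ℝ) < k + 1 := by positivity
    rw [setIntegral_eq_integral_of_forall_compl_eq_zero (fun τ hτ => by
      rw [deriv_smoothTransition_eq_zero hτ, zero_smul])]
    have := Measure.integral_comp_mul_left (fun τ => deriv Real.smoothTransition τ •
      v (b + τ / (k + 1))) ((k : ℝ) + 1)
    rw [abs_of_pos (inv_pos.2 hk), eq_inv_smul_iff₀ hk.ne'] at this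
    rw [← this, ← integral_smul, ← integral_add_right_eq_self _ b]
    refine integral_congr_ae (ae_of_all _ fun t => ?_)
    simp only [deriv_step, mul_smul, add_sub_cancel_right]
    rw [mul_div_cancel_left₀ _ hk.ne', add_comm t]
  simp_rw [e1]
  have e2 : v b = ∫ τ in Icc (0 : ℝ) 1, deriv Real.smoothTransition τ • v b := by
    rw [integral_smul_const, integral_Icc_eq_integral_Ioc,
      ← intervalIntegral.integral_of_le zero_le_one, intervalIntegral.integral_deriv_eq_sub,
      Real.smoothTransition.one, Real.smoothTransition.zero, sub_zero, one_smul]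
    · exact fun x _ => (Real.smoothTransition.contDiff (n := 1)).differentiable (by simp) x
    · exact continuous_deriv_smoothTransition.intervalIntegrable _ _
  rw [e2]
  obtain ⟨C, hC⟩ := isCompact_Icc.exists_bound_of_continuousOn (hv.mono hsub)
  have hmem : ∀ (k : ℕ) (τ : ℝ), τ ∈ Icc (0 : ℝ) 1 → b + τ / (k + 1) ∈ Icc b (b + 1) := by
    intro k τ hτ
    have hk : (0 : ℝ) ≤ k := k.cast_nonneg
    refine ⟨by have := hτ.1; have : 0 ≤ τ / (k + 1) := by positivity
               linarith, ?_⟩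
    have : τ / (k + 1) ≤ 1 := (div_le_one (by positivity)).2 (by linarith [hτ.2])
    linarith
  refine tendsto_integral_of_dominated_convergence
    (fun τ => |deriv Real.smoothTransition τ| * C) (fun k => ?_) ?_ (fun k => ?_) ?_
  · refine ContinuousOn.aestronglyMeasurable ?_ measurableSet_Icc
    refine continuous_deriv_smoothTransition.continuousOn.smul ?_
    exact (hv.mono hsub).comp (by fun_prop) (fun τ hτ => hmem k τ hτ)
  · exact ((continuous_deriv_smoothTransition.abs.mul continuous_const).continuousOn
      ).integrableOn_compact isCompact_Icc
  · filter_upwards [ae_restrict_mem measurableSet_Icc] with τ hτ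
    rw [norm_smul, Real.norm_eq_abs]
    gcongr
    exact hC _ (hmem k τ hτ)
  · refine ae_of_all _ fun τ => Tendsto.const_smul ?_ _
    have h1 : Tendsto (fun k : ℕ => b + τ / ((k : ℝ) + 1)) atTop (𝓝 (b + 0)) :=
      tendsto_const_nhds.add (tendsto_const_nhds.div_atTop
        (tendsto_atTop_add_const_right _ _ tendsto_natCast_atTop_atTop))
    rw [add_zero] at h1
    exact (hv.continuousAt (Ioi_mem_nhds hb)).tendsto.comp h1

/-- Testing with smoothed indicators of (b,c] and passing to the limit gives the fundamental theorem
of calculus. The hypothesis asks for these test functions only, so that it can be verified on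
slices, where each test function comes with its own null set. -/
lemma sub_eq_integral_of_stepDiff {v D : ℝ → F} (hv : ContinuousOn v (Ioi 0))
    (hD : LocallyIntegrableOn D (Ioi 0)) {b c : ℝ} (hb : 0 < b) (hbc : b ≤ c)
    (h : ∀ k : ℕ, ∫ t in Ioi 0, deriv (stepDiff k b c) t • v t =
      -∫ t in Ioi 0, stepDiff k b c t • D t) :
    v c - v b = ∫ t in b..c, D t := by
  have hsub : Icc b (c + 1) ⊆ Ioi 0 := fun t ht => hb.trans_le ht.1
  have h1 : Tendsto (fun k : ℕ => ∫ t in Ioi 0, deriv (stepDiff k b c) t • v t) atTop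
      (𝓝 (v b - v c)) := by
    refine ((tendsto_integral_deriv_step hv hb).sub
      (tendsto_integral_deriv_step hv (hb.trans_le hbc))).congr fun k => ?_
    rw [← integral_sub (integrable_deriv_step_smul hv hb k)
      (integrable_deriv_step_smul hv (hb.trans_le hbc) k)]
    have : ∀ t, deriv (stepDiff k b c) t =
        deriv (fun t : ℝ => Real.smoothTransition ((k + 1) * (t - b))) t -
        deriv (fun t : ℝ => Real.smoothTransition ((k + 1) * (t - c))) t := fun t =>
      deriv_fun_sub ((contDiff_step k b).differentiable (by simp) t)
        ((contDiff_step k c).differentiable (by simp) t)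
    simp_rw [← sub_smul, ← this]
    refine (setIntegral_smul_of_tsupport_subset v ?_).symm
    have h3 : tsupport (deriv (stepDiff k b c)) ⊆ tsupport (stepDiff k b c) :=
      closure_minimal support_deriv_subset (isClosed_tsupport _)
    exact h3.trans ((tsupport_stepDiff hbc).trans hsub)
  have h2 : Tendsto (fun k : ℕ => -∫ t in Ioi 0, stepDiff k b c t • D t) atTop
      (𝓝 (-∫ t in b..c, D t)) := by
    refine Tendsto.neg ?_
    have hDi : IntegrableOn D (Icc b (c + 1)) :=
      hD.integrableOn_compact_subset hsub isCompact_Icc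
    have e1 : ∀ k : ℕ, ∫ t in Ioi 0, stepDiff k b c t • D t =
        ∫ t in Icc b (c + 1), stepDiff k b c t • D t := fun k => by
      rw [setIntegral_smul_of_tsupport_subset D ((tsupport_stepDiff hbc).trans hsub),
        setIntegral_smul_of_tsupport_subset D (tsupport_stepDiff hbc)]
    have e2 : ∫ t in b..c, D t = ∫ t in Icc b (c + 1), indicator (Ioc b c) (1 : ℝ → ℝ) t • D t := by
      rw [intervalIntegral.integral_of_le hbc]
      have : ∀ t, indicator (Ioc b c) (1 : ℝ → ℝ) t • D t = indicator (Ioc b c) D t := fun t => by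
        by_cases ht : t ∈ Ioc b c <;> simp [ht]
      simp_rw [this]
      rw [setIntegral_indicator measurableSet_Ioc, inter_eq_right.2]
      exact fun t ht => ⟨ht.1.le, by linarith [ht.2]⟩
    simp_rw [e1, e2]
    refine tendsto_integral_of_dominated_convergence (fun t => ‖D t‖) (fun k => ?_) hDi.norm
      (fun k => ae_of_all _ fun t => ?_) (ae_of_all _ fun t => ?_)
    · exact (contDiff_stepDiff k b c).continuous.aestronglyMeasurable.smul hDi.aestronglyMeasurable
    · rw [norm_smul, Real.norm_eq_abs]
      exact mul_le_of_le_one_left (norm_nonneg _) (abs_stepDiff_le k b c t)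
    · exact (tendsto_stepDiff hbc t).smul_const _
  have := tendsto_nhds_unique (h1.congr h) h2
  rw [← neg_inj, ← this, neg_sub]

/-- With rational endpoints the family of test functions is countable, so a single null set of
slices suffices. Real endpoints follow because v and the primitive of D are both continuous on
(0,∞). -/
lemma sub_eq_integral_of_stepDiff_rat {v D : ℝ → F} (hv : ContinuousOn v (Ioi 0))
    (hD : LocallyIntegrableOn D (Ioi 0))
    (h : ∀ (b c : ℚ) (k : ℕ), 0 < b → b ≤ c → ∫ t in Ioi 0, deriv (stepDiff k b c) t • v t =
      -∫ t in Ioi 0, stepDiff k b c t • D t) {b c : ℝ} (hb : 0 < b) (hbc : b ≤ c) :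
    v c - v b = ∫ t in b..c, D t := by
  have hII : ∀ x y : ℝ, 0 < x → 0 < y → IntervalIntegrable D volume x y := fun x y hx hy => by
    rw [intervalIntegrable_iff']
    exact hD.integrableOn_compact_subset (fun t ht => (lt_min hx hy).trans_le ht.1)
      isCompact_uIcc
  have key : ∀ q r : ℚ, 0 < q → 0 < r → v r - v q = ∫ t in (q : ℝ)..r, D t := by
    intro q r hq hr
    rcases le_total q r with hqr | hqr
    · exact sub_eq_integral_of_stepDiff hv hD (by exact_mod_cast hq) (by exact_mod_cast hqr)
        fun k => h q r k hq hqr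
    · rw [intervalIntegral.integral_symm, ← sub_eq_integral_of_stepDiff hv hD
        (by exact_mod_cast hr) (by exact_mod_cast hqr) fun k => h r q k hr hqr, neg_sub]
  have hP : ContinuousOn (fun y => v y - v 1 - ∫ t in (1 : ℝ)..y, D t) (Ioi 0) := by
    refine (hv.sub continuousOn_const).sub fun y hy => ContinuousAt.continuousWithinAt ?_
    have hy : 0 < y := hy
    have h1 : ContinuousOn (fun y => ∫ t in (1 : ℝ)..y, D t)
        (uIcc (min 1 (y / 2)) (max 1 (y + 1))) := by
      refine intervalIntegral.continuousOn_primitive_interval' (hII _ _ ?_ ?_) ?_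
      · exact lt_min one_pos (by linarith)
      · exact lt_max_of_lt_left one_pos
      · rw [uIcc_of_le ((min_le_left _ _).trans (le_max_left _ _))]
        exact ⟨min_le_left _ _, le_max_left _ _⟩
    refine h1.continuousAt ?_
    rw [uIcc_of_le ((min_le_left _ _).trans (le_max_left _ _))]
    exact Icc_mem_nhds ((min_le_right _ _).trans_lt (by linarith))
      (lt_of_lt_of_le (by linarith) (le_max_right _ _))
  have hz : ∀ y : ℝ, 0 < y → v y - v 1 = ∫ t in (1 : ℝ)..y, D t := by
    intro y hy
    rw [← sub_eq_zero]
    have h0 : EqOn (fun y => v y - v 1 - ∫ t in (1 : ℝ)..y, D t) (fun _ => 0)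
        (Ioi (0 : ℝ) ∩ range ((↑) : ℚ → ℝ)) := by
      rintro _ ⟨hq, q, rfl⟩
      have := key 1 q one_pos (by exact_mod_cast (mem_Ioi.1 hq))
      rw [Rat.cast_one] at this
      simp [this]
    exact h0.of_subset_closure hP continuousOn_const inter_subset_left
      ((Rat.denseRange_cast (𝕜 := ℝ)).open_subset_closure_inter isOpen_Ioi) hy
  have hc := hb.trans_le hbc
  rw [← intervalIntegral.integral_interval_sub_left (hII 1 c one_pos hc) (hII 1 b one_pos hb),
    ← hz c hc, ← hz b hb]
  abel

lemma HasWeakDeriv.sub_eq_integral {v D : ℝ → F} (h : HasWeakDeriv (Ioi (0 : ℝ)) 1 v D)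
    (hv : ContinuousOn v (Ioi 0)) {b c : ℝ} (hb : 0 < b) (hbc : b ≤ c) :
    v c - v b = ∫ t in b..c, D t := by
  refine sub_eq_integral_of_stepDiff hv h.2.1 hb hbc fun k => ?_
  have := h.2.2 (stepDiff k b c) (contDiff_stepDiff k b c) (hasCompactSupport_stepDiff hbc)
    ((tsupport_stepDiff hbc).trans fun t ht => hb.trans_le ht.1)
  simpa only [fderiv_apply_one_eq_deriv] using this

end

/-! ### Weighted estimates on the half-line -/

section HalfLine

variable {F : Type*} [NormedAddCommGroup F] [NormedSpace ℝ F]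

/-- `∫₀^∞ t^{1-2s} |D|² dt`. -/
def weightedSq (s : ℝ) (D : ℝ → F) : ENNReal :=
  ∫⁻ t in Ioi (0 : ℝ), ENNReal.ofReal (t ^ (1 - 2 * s)) * ‖D t‖ₑ ^ 2

lemma lintegral_rpow_Ioc {s : ℝ} (hs : 0 < s) {y : ℝ} (hy : 0 < y) :
    ∫⁻ t in Ioc 0 y, ENNReal.ofReal (t ^ (2 * s - 1)) = ENNReal.ofReal (y ^ (2 * s) / (2 * s)) := by
  have h1 : IntervalIntegrable (fun t : ℝ => t ^ (2 * s - 1)) volume 0 y :=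
    intervalIntegral.intervalIntegrable_rpow' (by linarith)
  rw [intervalIntegrable_iff_integrableOn_Ioc_of_le hy.le] at h1
  rw [← ofReal_integral_eq_lintegral_ofReal h1, ← intervalIntegral.integral_of_le hy.le,
    integral_rpow (Or.inl (by linarith))]
  · congr 1
    rw [sub_add_cancel, Real.zero_rpow (by linarith), sub_zero]
  · filter_upwards [ae_restrict_mem measurableSet_Ioc] with t ht
    exact Real.rpow_nonneg ht.1.le _

omit [NormedSpace ℝ F] in
-- Cauchy-Schwarz for the factorization 1 = t^(s-1/2) t^(1/2-s); the first factor has square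
-- integral y^(2s)/(2s) on (0,y], finite because s > 0.
lemma lintegral_enorm_Ioc_le {s : ℝ} (hs : 0 < s) {D : ℝ → F}
    (hD : AEStronglyMeasurable D (volume.restrict (Ioi 0))) {y : ℝ} (hy : 0 < y) :
    ∫⁻ t in Ioc 0 y, ‖D t‖ₑ ≤ ENNReal.ofReal (y ^ s) *
      (ENNReal.ofReal ((2 * s) ^ (-1 / 2 : ℝ)) * weightedSq s D ^ (1 / 2 : ℝ)) := by
  have e0 : ENNReal.ofReal (y ^ s) * ENNReal.ofReal ((2 * s) ^ (-1 / 2 : ℝ)) =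
      ENNReal.ofReal (y ^ (2 * s) / (2 * s)) ^ (1 / 2 : ℝ) := by
    rw [ENNReal.ofReal_rpow_of_nonneg (by positivity) (by norm_num), ← ENNReal.ofReal_mul
      (by positivity), Real.div_rpow (by positivity) (by positivity), ← Real.rpow_mul hy.le,
      div_eq_mul_inv (y ^ (2 * s * (1 / 2))), ← Real.rpow_neg (by positivity)]
    ring_nf
  rw [← mul_assoc, e0]
  have hsub : Ioc 0 y ⊆ Ioi 0 := fun t ht => ht.1
  have hD' := hD.mono_measure (Measure.restrict_mono_set volume hsub)
  have e1 : ∫⁻ t in Ioc 0 y, ‖D t‖ₑ = ∫⁻ t in Ioc 0 y,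
      ((fun t => ENNReal.ofReal (t ^ (s - 1 / 2))) *
        fun t => ENNReal.ofReal (t ^ (1 / 2 - s)) * ‖D t‖ₑ) t := by
    refine setLIntegral_congr_fun measurableSet_Ioc fun t ht => ?_
    have ht0 : 0 < t := ht.1
    rw [Pi.mul_apply, ← mul_assoc, ← ENNReal.ofReal_mul (by positivity), ← Real.rpow_add ht0]
    simp
  rw [e1]
  refine (ENNReal.lintegral_mul_le_Lp_mul_Lq _ Real.HolderConjugate.two_two (by fun_prop)
    ?_).trans ?_
  · exact AEMeasurable.mul (by fun_prop) hD'.enorm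
  · gcongr ?_ ^ _ * ?_ ^ _
    · rw [← lintegral_rpow_Ioc hs hy]
      refine (setLIntegral_congr_fun measurableSet_Ioc fun t ht => ?_).le
      have ht0 : 0 < t := ht.1
      rw [ENNReal.ofReal_rpow_of_nonneg (by positivity) (by norm_num), ← Real.rpow_mul ht0.le]
      ring_nf
    · refine (setLIntegral_congr_fun measurableSet_Ioc fun t ht => ?_).trans_le
        (lintegral_mono_set hsub)
      have ht0 : 0 < t := ht.1
      rw [ENNReal.mul_rpow_of_nonneg _ _ (by norm_num),
        ENNReal.ofReal_rpow_of_nonneg (by positivity) (by norm_num), ← Real.rpow_mul ht0.le]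
      norm_num
      ring_nf

omit [NormedSpace ℝ F] in
lemma integrableOn_Ioc_of_weightedSq {s : ℝ} (hs : 0 < s) {D : ℝ → F}
    (hD : AEStronglyMeasurable D (volume.restrict (Ioi 0))) (hf : weightedSq s D ≠ ⊤) (y : ℝ) :
    IntegrableOn D (Ioc 0 y) := by
  rcases le_or_gt y 0 with hy | hy
  · simp [Ioc_eq_empty (not_lt.2 hy)]
  refine ⟨hD.mono_measure (Measure.restrict_mono_set volume fun t ht => ht.1), ?_⟩
  refine (lintegral_enorm_Ioc_le hs hD hy).trans_lt ?_
  exact ENNReal.mul_lt_top ENNReal.ofReal_lt_top (ENNReal.mul_lt_top ENNReal.ofReal_lt_top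
    (ENNReal.rpow_lt_top_of_nonneg (by norm_num) hf))

/-- Finite weighted energy makes D integrable up to 0, so the formula on [b,y] passes to the limit b
→ 0 and reaches the boundary value. -/
lemma sub_eq_integral_Ioc_of_weightedSq [CompleteSpace F] {s : ℝ} (hs : 0 < s) {v D : ℝ → F}
    (hv : ContinuousOn v (Ici 0)) (hD : AEStronglyMeasurable D (volume.restrict (Ioi 0)))
    (hf : weightedSq s D ≠ ⊤)
    (h : ∀ b c : ℝ, 0 < b → b ≤ c → v c - v b = ∫ t in b..c, D t) {y : ℝ} (hy : 0 ≤ y) :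
    v y - v 0 = ∫ t in Ioc 0 y, D t := by
  rcases hy.eq_or_lt with rfl | hy
  · simp
  have hI : IntervalIntegrable D volume 0 y :=
    (intervalIntegrable_iff_integrableOn_Ioc_of_le hy.le).2
      (integrableOn_Ioc_of_weightedSq hs hD hf y)
  rw [← intervalIntegral.integral_of_le hy.le]
  have h1 : Tendsto (fun b => v y - v b) (𝓝[>] 0) (𝓝 (v y - v 0)) :=
    tendsto_const_nhds.sub ((hv 0 self_mem_Ici).mono_left (nhdsWithin_mono _ Ioi_subset_Ici_self))
  have h2 : Tendsto (fun b => ∫ t in b..y, D t) (𝓝[>] 0) (𝓝 (∫ t in (0 : ℝ)..y, D t)) := by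
    have h3 := intervalIntegral.continuousOn_primitive_interval' (hI.symm) left_mem_uIcc
    have h4 := (h3 0 right_mem_uIcc).neg
    have h5 : 𝓝[>] (0 : ℝ) ≤ 𝓝[uIcc y 0] 0 := by
      rw [uIcc_of_ge hy.le, ← nhdsWithin_Ioo_eq_nhdsGT hy]
      exact nhdsWithin_mono _ Ioo_subset_Icc_self
    refine ((h4.mono_left h5).congr fun b => ?_).trans_eq ?_
    · exact (intervalIntegral.integral_symm _ _).symm
    · exact congrArg 𝓝 (intervalIntegral.integral_symm _ _).symm
  refine tendsto_nhds_unique h1 (h2.congr' ?_)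
  filter_upwards [Ioo_mem_nhdsGT hy] with b hb
  exact (h b y hb.1 hb.2.le).symm

end HalfLine

/-- Fubini on the triangle t ≤ y. It replaces integration by parts both in the one-dimensional
problem and on the vertical lines of the half-space. -/
lemma integral_mul_tail {𝕜 : Type*} [RCLike 𝕜] {D q : ℝ → 𝕜}
    (hD : AEStronglyMeasurable D (volume.restrict (Ioi 0)))
    (hq : AEStronglyMeasurable q (volume.restrict (Ioi 0)))
    (hfin : ∫⁻ y in Ioi (0 : ℝ), ‖q y‖ₑ * ∫⁻ t in Ioc 0 y, ‖D t‖ₑ ≠ ⊤) :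
    ∫ t in Ioi (0 : ℝ), D t * ∫ y in Ioi t, q y =
      ∫ y in Ioi (0 : ℝ), q y * ∫ t in Ioc 0 y, D t := by
  set μ := volume.restrict (Ioi (0 : ℝ)) with hμ
  have hS : MeasurableSet {p : ℝ × ℝ | p.1 ≤ p.2} := measurableSet_le measurable_fst measurable_snd
  set f : ℝ → ℝ → 𝕜 := fun t y => indicator {p : ℝ × ℝ | p.1 ≤ p.2} (fun p => D p.1 * q p.2) (t, y)
  have hslice1 : ∀ t ∈ Ioi (0 : ℝ), ∫ y, f t y ∂μ = D t * ∫ y in Ioi t, q y := by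
    intro t ht
    have : ∀ y, f t y = indicator (Ici t) (fun y => D t * q y) y := fun y => by
      simp [f, indicator_apply]
    simp_rw [this]
    have hsub : Ici t ⊆ Ioi 0 := fun y hy => (mem_Ioi.1 ht).trans_le hy
    rw [hμ, setIntegral_indicator measurableSet_Ici, inter_eq_right.2 hsub, integral_const_mul,
      integral_Ici_eq_integral_Ioi]
  have hslice2 : ∀ y, ∫ t, f t y ∂μ = q y * ∫ t in Ioc 0 y, D t := by
    intro y
    have : ∀ t, f t y = indicator (Iic y) (fun t => q y * D t) t := fun t => by
      simp [f, indicator_apply, mul_comm]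
    simp_rw [this]
    rw [hμ, setIntegral_indicator measurableSet_Iic, Ioi_inter_Iic, integral_const_mul]
  have hslice3 : ∀ y, ∫⁻ t, ‖f t y‖ₑ ∂μ = ‖q y‖ₑ * ∫⁻ t in Ioc 0 y, ‖D t‖ₑ := by
    intro y
    have : ∀ t, ‖f t y‖ₑ = indicator (Iic y) (fun t => ‖q y‖ₑ * ‖D t‖ₑ) t := fun t => by
      by_cases h : t ≤ y <;> simp [f, h, mul_comm]
    simp_rw [this]
    rw [hμ, setLIntegral_indicator measurableSet_Iic, Iic_inter_Ioi,
      lintegral_const_mul'' _ (hD.mono_measure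
        (Measure.restrict_mono_set volume fun t ht => ht.1)).enorm]
  have hfm : AEStronglyMeasurable (Function.uncurry f) (μ.prod μ) :=
    (hD.comp_fst.mul hq.comp_snd).indicator hS
  have hint : Integrable (Function.uncurry f) (μ.prod μ) := by
    refine ⟨hfm, ?_⟩
    rw [HasFiniteIntegral, lintegral_prod_symm _ hfm.enorm]
    simp only [Function.uncurry_apply_pair, hslice3]
    exact hfin.lt_top
  rw [← setIntegral_congr_fun measurableSet_Ioi hslice1, ← hμ, integral_integral_swap hint]
  simp_rw [hslice2]

/-- The condition p > -1 handles the origin, and p - 2 < -1 handles infinity. It is applied with p =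
1 - s and p = 1 - 2s, both in (-1,1). -/
lemma integrableOn_rpow_mul_min {p : ℝ} (hp : -1 < p) (hp' : p < 1) :
    IntegrableOn (fun y : ℝ => y ^ p * min 1 (1 / y ^ 2)) (Ioi 0) := by
  have hm : Measurable fun y : ℝ => y ^ p * min 1 (1 / y ^ 2) := by fun_prop
  rw [← Ioc_union_Ioi_eq_Ioi zero_le_one]
  refine IntegrableOn.union ?_ ?_
  · have h1 : IntegrableOn (fun y : ℝ => y ^ p) (Ioc 0 1) :=
      (intervalIntegrable_iff_integrableOn_Ioc_of_le zero_le_one).1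
        (intervalIntegral.intervalIntegrable_rpow' hp)
    refine h1.mono' hm.aestronglyMeasurable ?_
    filter_upwards [ae_restrict_mem measurableSet_Ioc] with y hy
    have hy0 : 0 < y := hy.1
    rw [Real.norm_of_nonneg (by positivity)]
    exact mul_le_of_le_one_right (by positivity) (min_le_left _ _)
  · have h1 : IntegrableOn (fun y : ℝ => y ^ (p - 2)) (Ioi 1) :=
      integrableOn_Ioi_rpow_of_lt (by linarith) one_pos
    refine h1.mono' hm.aestronglyMeasurable ?_
    filter_upwards [ae_restrict_mem measurableSet_Ioi] with y hy
    have hy0 : 0 < y := one_pos.trans hy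
    rw [Real.norm_of_nonneg (by positivity), Real.rpow_sub hy0]
    norm_num [div_eq_mul_inv]
    gcongr
    exact min_le_right _ _

/-! ### The one-dimensional minimization problem -/

section Minimization

variable {s : ℝ} (hs0 : 0 < s) (hs1 : s < 1)
include hs0

lemma exists_prof_le_min : ∃ K, 0 ≤ K ∧ ∀ t, t ≠ 0 → prof s t ≤ K * min 1 (1 / t ^ 2) := by
  obtain ⟨C, hC0, hC⟩ := exists_prof_le_div hs0
  refine ⟨max 1 C, by positivity, fun t ht => ?_⟩
  rw [mul_min_of_nonneg _ _ (by positivity)]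
  refine le_min ?_ ?_
  · rw [mul_one]
    exact (prof_le_one hs0 t).trans (le_max_left _ _)
  · rw [mul_one_div]
    refine (hC t ht).trans ?_
    gcongr
    exact le_max_right _ _

lemma hasWeakDeriv_prof (hs1 : s < 1) :
    HasWeakDeriv (Ioi (0 : ℝ)) 1 (prof s) fun t => -(t ^ (2 * s - 1) * flux s t) := by
  have h := hasWeakDeriv_of_differentiableAt (v := (1 : ℝ)) isOpen_Ioi
    (fun t ht => (hasDerivAt_prof hs0 ht).differentiableAt) (Ω := Ioi (0 : ℝ)) ?_
  · refine ⟨h.1, ?_, fun φ h1 h2 h3 => (h.2.2 φ h1 h2 h3).trans ?_⟩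
    · refine h.2.1.congr ?_
      filter_upwards [ae_restrict_mem measurableSet_Ioi] with t ht
      rw [fderiv_apply_one_eq_deriv, (hasDerivAt_prof hs0 ht).deriv]
    · congr 1
      refine setIntegral_congr_fun measurableSet_Ioi fun t ht => ?_
      simp only [fderiv_apply_one_eq_deriv, (hasDerivAt_prof hs0 ht).deriv]
  · have : ContinuousOn (fun t : ℝ => -(t ^ (2 * s - 1) * flux s t)) (Ioi 0) := by
      refine (ContinuousOn.mul ?_ (continuous_flux hs1).continuousOn).neg
      exact fun t ht => (Real.continuousAt_rpow_const _ _ (Or.inl (ne_of_gt ht))).continuousWithinAt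
    refine this.congr fun t ht => ?_
    rw [fderiv_apply_one_eq_deriv, (hasDerivAt_prof hs0 ht).deriv]

include hs1

lemma isAdmissible_prof : IsAdmissible (prof s) :=
  ⟨⟨_, hasWeakDeriv_prof hs0 hs1⟩, (continuous_prof hs0).continuousOn, prof_zero hs0⟩

lemma G_prof : G s (prof s) = ENNReal.ofReal (flux s 0) := by
  have h := (hasWeakDeriv_weakDeriv ⟨_, hasWeakDeriv_prof hs0 hs1⟩).ae_eq isOpen_Ioi
    (hasWeakDeriv_prof hs0 hs1)
  rw [← (prof_energy hs0 hs1).2, G,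
    ofReal_integral_eq_lintegral_ofReal (prof_energy hs0 hs1).1]
  · refine lintegral_congr_ae ?_
    filter_upwards [h] with t ht
    rw [ht, neg_sq]
  · filter_upwards [ae_restrict_mem measurableSet_Ioi] with t ht
    have ht : 0 < t := ht
    positivity

/-- The inner integral grows at most like y^s, so the integrand is dominated by a constant times
y^(1-s) min(1, y^(-2)). This is the hypothesis of `integral_mul_tail` for an admissible function. -/
lemma lintegral_weight_prof_ne_top {w : ℝ → ℝ}
    (hw : AEStronglyMeasurable w (volume.restrict (Ioi 0))) (hf : weightedSq s w ≠ ⊤) :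
    ∫⁻ y in Ioi (0 : ℝ), ‖y ^ (1 - 2 * s) * prof s y‖ₑ * ∫⁻ t in Ioc 0 y, ‖w t‖ₑ ≠ ⊤ := by
  obtain ⟨K, hK0, hK⟩ := exists_prof_le_min hs0
  set M := ENNReal.ofReal ((2 * s) ^ (-1 / 2 : ℝ)) * weightedSq s w ^ (1 / 2 : ℝ) with hM
  have hMt : M ≠ ⊤ := (ENNReal.mul_lt_top ENNReal.ofReal_lt_top
    (ENNReal.rpow_lt_top_of_nonneg (by norm_num) hf)).ne
  have h1 := (((integrableOn_rpow_mul_min (p := 1 - s) (by linarith) (by linarith)).const_mul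
    K)).2
  refine ne_top_of_le_ne_top (ENNReal.mul_lt_top h1 hMt.lt_top).ne ?_
  rw [← lintegral_mul_const' _ _ hMt]
  refine setLIntegral_mono' measurableSet_Ioi fun y hy => ?_
  have hy : 0 < y := hy
  refine (mul_le_mul_right (lintegral_enorm_Ioc_le hs0 hw hy) _).trans ?_
  rw [← mul_assoc, ← hM]
  gcongr
  rw [Real.enorm_of_nonneg (mul_nonneg (by positivity) (prof_nonneg hs0 y)),
    Real.enorm_of_nonneg (by positivity), ← ENNReal.ofReal_mul
      (mul_nonneg (by positivity) (prof_nonneg hs0 y))]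
  refine ENNReal.ofReal_le_ofReal ?_
  have e : y ^ (1 - s) = y ^ (1 - 2 * s) * y ^ s := by
    rw [← Real.rpow_add hy]; ring_nf
  simp only [e]
  calc _ ≤ y ^ (1 - 2 * s) * (K * min 1 (1 / y ^ 2)) * y ^ s := by gcongr; exact hK y hy.ne'
    _ = _ := by ring

/-- The integral identities satisfied by an admissible function of finite energy. -/
lemma integral_admissible {w D : ℝ → ℝ} (hw : HasWeakDeriv (Ioi (0 : ℝ)) 1 w D)
    (hc : ContinuousOn w (Ici 0)) (hw0 : w 0 = 1)
    (hi : IntegrableOn (fun t => t ^ (1 - 2 * s) * (w t ^ 2 + D t ^ 2)) (Ioi 0)) :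
    IntegrableOn (fun t => t ^ (1 - 2 * s) *
      ((w t - prof s t) ^ 2 + (D t + t ^ (2 * s - 1) * flux s t) ^ 2)) (Ioi 0) ∧
    ∫ t in Ioi (0 : ℝ), t ^ (1 - 2 * s) *
      ((w t - prof s t) ^ 2 + (D t + t ^ (2 * s - 1) * flux s t) ^ 2) =
    (∫ t in Ioi (0 : ℝ), t ^ (1 - 2 * s) * (w t ^ 2 + D t ^ 2)) - flux s 0 := by
  have hwm : AEStronglyMeasurable w (volume.restrict (Ioi 0)) := hw.1.aestronglyMeasurable
  have hDm : AEStronglyMeasurable D (volume.restrict (Ioi 0)) := hw.2.1.aestronglyMeasurable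
  have hgm : AEStronglyMeasurable (prof s) (volume.restrict (Ioi 0)) :=
    (continuous_prof hs0).aestronglyMeasurable
  have hhm : AEStronglyMeasurable (flux s) (volume.restrict (Ioi 0)) :=
    (continuous_flux hs1).aestronglyMeasurable
  have hpm : ∀ p : ℝ, AEStronglyMeasurable (fun t : ℝ => t ^ p) (volume.restrict (Ioi 0)) :=
    fun p => Measurable.aestronglyMeasurable (by fun_prop)
  obtain ⟨hg, hgv⟩ := prof_energy hs0 hs1
  have hDf : weightedSq s D ≠ ⊤ := by
    refine ne_top_of_le_ne_top hi.2.ne (setLIntegral_mono' measurableSet_Ioi fun t ht => ?_)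
    have ht : 0 < t := ht
    rw [← ofReal_norm, ← ofReal_norm, ← ENNReal.ofReal_pow (norm_nonneg _),
      ← ENNReal.ofReal_mul (by positivity), Real.norm_eq_abs, sq_abs]
    refine ENNReal.ofReal_le_ofReal (le_trans ?_ (le_abs_self _))
    simp only
    gcongr
    nlinarith [sq_nonneg (w t)]
  have h1 : IntegrableOn (fun t => t ^ (1 - 2 * s) * prof s t * w t) (Ioi 0) := by
    refine (hi.add hg).mono' (((hpm _).mul hgm).mul hwm) ?_
    filter_upwards [ae_restrict_mem measurableSet_Ioi] with t ht
    have ht : 0 < t := ht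
    have hp : 0 ≤ t ^ (1 - 2 * s) := by positivity
    rw [mul_assoc, norm_mul, Real.norm_of_nonneg hp, Pi.add_apply, ← mul_add]
    gcongr
    rw [Real.norm_eq_abs, abs_le]
    constructor <;> nlinarith [sq_nonneg (w t - prof s t), sq_nonneg (w t + prof s t),
      sq_nonneg (D t), sq_nonneg (t ^ (2 * s - 1) * flux s t), sq_nonneg (w t),
      sq_nonneg (prof s t)]
  have h2 : IntegrableOn (fun t => D t * flux s t) (Ioi 0) := by
    refine (hi.add hg).mono' (hDm.mul hhm) ?_
    filter_upwards [ae_restrict_mem measurableSet_Ioi] with t ht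
    have ht : 0 < t := ht
    have hp : 0 ≤ t ^ (1 - 2 * s) := by positivity
    have : t ^ (1 - 2 * s) * t ^ (2 * s - 1) = 1 := by
      rw [← Real.rpow_add ht]; ring_nf; simp
    have e : D t * flux s t = t ^ (1 - 2 * s) * (D t * (t ^ (2 * s - 1) * flux s t)) := by
      linear_combination (-(D t * flux s t)) * this
    rw [e, norm_mul, Real.norm_of_nonneg hp, Pi.add_apply, ← mul_add]
    gcongr
    generalize t ^ (2 * s - 1) * flux s t = z
    rw [Real.norm_eq_abs, abs_le]
    constructor <;> nlinarith [sq_nonneg (D t - z), sq_nonneg (D t + z),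
      sq_nonneg (w t), sq_nonneg (prof s t), sq_nonneg (D t), sq_nonneg z]
  have hftc : ∀ y : ℝ, 0 ≤ y → w y - 1 = ∫ t in Ioc 0 y, D t := fun y hy => by
    rw [← hw0]
    exact sub_eq_integral_Ioc_of_weightedSq hs0 hc hDm hDf
      (fun b c hb hbc => hw.sub_eq_integral (hc.mono Ioi_subset_Ici_self) hb hbc) hy
  -- The flux is replaced by its tail integral and the order of integration is exchanged; the inner
  -- integral of D is then w - 1, and the constant 1 contributes the total integral of t^(1-2s) g,
  -- which is `flux s 0`.
  have h3 : ∫ t in Ioi (0 : ℝ), D t * flux s t =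
      (∫ t in Ioi (0 : ℝ), t ^ (1 - 2 * s) * prof s t * w t) - flux s 0 := by
    have e1 := integral_mul_tail hDm ((hpm (1 - 2 * s)).mul hgm)
      (lintegral_weight_prof_ne_top hs0 hs1 hDm hDf)
    have e2 : ∫ t in Ioi (0 : ℝ), D t * ∫ y in Ioi t, y ^ (1 - 2 * s) * prof s y =
        ∫ t in Ioi (0 : ℝ), D t * flux s t :=
      setIntegral_congr_fun measurableSet_Ioi fun t ht => by
        rw [integral_Ioi_weight_prof hs0 hs1 (le_of_lt ht)]
    have e3 : ∫ y in Ioi (0 : ℝ), y ^ (1 - 2 * s) * prof s y * ∫ t in Ioc 0 y, D t =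
        ∫ y in Ioi (0 : ℝ), (y ^ (1 - 2 * s) * prof s y * w y - y ^ (1 - 2 * s) * prof s y) :=
      setIntegral_congr_fun measurableSet_Ioi fun t ht => by
        rw [← hftc t (le_of_lt ht)]
        ring
    rw [← e2]
    refine (e1.trans e3).trans ?_
    rw [integral_sub h1 (integrableOn_weight_prof hs0 hs1),
      integral_Ioi_weight_prof hs0 hs1 le_rfl]
  -- The cross terms of the two squares are 2 D h and -2 t^(1-2s) g w, with g and h the profile and
  -- its flux. By `h3` their integrals add up to -2 `flux s 0`, and the energy of the profile gives
  -- back one `flux s 0`.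
  have e : ∀ t ∈ Ioi (0 : ℝ), t ^ (1 - 2 * s) *
      ((w t - prof s t) ^ 2 + (D t + t ^ (2 * s - 1) * flux s t) ^ 2) =
      t ^ (1 - 2 * s) * (w t ^ 2 + D t ^ 2) +
      t ^ (1 - 2 * s) * (prof s t ^ 2 + (t ^ (2 * s - 1) * flux s t) ^ 2)
      + 2 * (D t * flux s t) - 2 * (t ^ (1 - 2 * s) * prof s t * w t) := by
    intro t ht
    have ht : 0 < t := ht
    have : t ^ (1 - 2 * s) * t ^ (2 * s - 1) = 1 := by
      rw [← Real.rpow_add ht]; ring_nf; simp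
    linear_combination (2 * (D t * flux s t)) * this
  constructor
  · exact IntegrableOn.congr_fun (((hi.add hg).add (h2.const_mul 2)).sub (h1.const_mul 2))
      (fun t ht => (e t ht).symm) measurableSet_Ioi
  · rw [setIntegral_congr_fun measurableSet_Ioi e, integral_sub, integral_add, integral_add,
      integral_const_mul, integral_const_mul, h3, hgv]
    · ring
    · exact hi
    · exact hg
    · exact hi.add hg
    · exact h2.const_mul 2
    · exact (hi.add hg).add (h2.const_mul 2)
    · exact h1.const_mul 2

omit hs0 hs1 in
lemma integrableOn_of_G_ne_top {w : ℝ → ℝ} (hw : IsAdmissible w) (hG : G s w ≠ ⊤) :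
    IntegrableOn (fun t => t ^ (1 - 2 * s) * (w t ^ 2 + weakDeriv (Ioi (0 : ℝ)) 1 w t ^ 2))
      (Ioi 0) ∧
    G s w = ENNReal.ofReal (∫ t in Ioi (0 : ℝ),
      t ^ (1 - 2 * s) * (w t ^ 2 + weakDeriv (Ioi (0 : ℝ)) 1 w t ^ 2)) := by
  have h := hasWeakDeriv_weakDeriv hw.1
  have hm : AEStronglyMeasurable (fun t : ℝ => t ^ (1 - 2 * s) *
      (w t ^ 2 + weakDeriv (Ioi (0 : ℝ)) 1 w t ^ 2)) (volume.restrict (Ioi 0)) :=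
    AEStronglyMeasurable.mul (Measurable.aestronglyMeasurable (by fun_prop))
      ((h.1.aestronglyMeasurable.pow 2).add (h.2.1.aestronglyMeasurable.pow 2))
  have hpos : 0 ≤ᵐ[volume.restrict (Ioi 0)] fun t : ℝ => t ^ (1 - 2 * s) *
      (w t ^ 2 + weakDeriv (Ioi (0 : ℝ)) 1 w t ^ 2) := by
    filter_upwards [ae_restrict_mem measurableSet_Ioi] with t ht
    have ht : 0 < t := ht
    positivity
  have hi : IntegrableOn (fun t => t ^ (1 - 2 * s) *
      (w t ^ 2 + weakDeriv (Ioi (0 : ℝ)) 1 w t ^ 2)) (Ioi 0) :=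
    ⟨hm, (hasFiniteIntegral_iff_ofReal hpos).2 hG.lt_top⟩
  exact ⟨hi, (ofReal_integral_eq_lintegral_ofReal hi hpos).symm⟩

omit hs0 hs1 in
lemma weighted_sq_nonneg (w D : ℝ → ℝ) :
    0 ≤ᵐ[volume.restrict (Ioi 0)] fun t : ℝ => t ^ (1 - 2 * s) * (w t ^ 2 + D t ^ 2) := by
  filter_upwards [ae_restrict_mem measurableSet_Ioi] with t ht
  have ht : 0 < t := ht
  positivity

lemma flux_zero_le_G {w : ℝ → ℝ} (hw : IsAdmissible w) : ENNReal.ofReal (flux s 0) ≤ G s w := by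
  by_cases hG : G s w = ⊤
  · simp [hG]
  obtain ⟨hi, hv⟩ := integrableOn_of_G_ne_top hw hG
  have h := (integral_admissible hs0 hs1 (hasWeakDeriv_weakDeriv hw.1) hw.2.1 hw.2.2 hi).2
  rw [hv]
  refine ENNReal.ofReal_le_ofReal ?_
  have := integral_nonneg_of_ae (weighted_sq_nonneg (s := s) (fun t => w t - prof s t)
    (fun t => weakDeriv (Ioi (0 : ℝ)) 1 w t + t ^ (2 * s - 1) * flux s t))
  linarith

theorem isProfile_prof : IsProfile s (prof s) :=
  ⟨isAdmissible_prof hs0 hs1, fun _ hw => (G_prof hs0 hs1).trans_le (flux_zero_le_G hs0 hs1 hw)⟩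

lemma IsProfile.G_eq {g : ℝ → ℝ} (hg : IsProfile s g) : G s g = ENNReal.ofReal (flux s 0) :=
  le_antisymm ((hg.2 _ (isAdmissible_prof hs0 hs1)).trans_eq (G_prof hs0 hs1))
    (flux_zero_le_G hs0 hs1 hg.1)

lemma IsProfile.CSharp_eq {g : ℝ → ℝ} (hg : IsProfile s g) : CSharp s g = flux s 0 := by
  rw [CSharp, hg.G_eq hs0 hs1, ENNReal.toReal_ofReal (flux_zero_pos hs0 hs1).le]

/-- Equality of energies makes the weighted square of the difference integrate to 0, so the two
functions agree almost everywhere on (0,∞) and then everywhere by continuity. Values at negative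
arguments are unconstrained, hence the restriction to [0,∞). -/
lemma IsProfile.eqOn {g : ℝ → ℝ} (hg : IsProfile s g) : EqOn g (prof s) (Ici 0) := by
  have hG := hg.G_eq hs0 hs1
  obtain ⟨hi, hv⟩ := integrableOn_of_G_ne_top hg.1 (by rw [hG]; exact ENNReal.ofReal_ne_top)
  obtain ⟨h1, h2⟩ := integral_admissible hs0 hs1 (hasWeakDeriv_weakDeriv hg.1.1) hg.1.2.1
    hg.1.2.2 hi
  have hn := weighted_sq_nonneg (s := s) (fun t => g t - prof s t)
    (fun t => weakDeriv (Ioi (0 : ℝ)) 1 g t + t ^ (2 * s - 1) * flux s t)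
  rw [hG, ENNReal.ofReal_eq_ofReal_iff (flux_zero_pos hs0 hs1).le
    (integral_nonneg_of_ae (weighted_sq_nonneg _ _))] at hv
  rw [← hv, sub_self, integral_eq_zero_iff_of_nonneg_ae hn h1] at h2
  have hae : g =ᵐ[volume.restrict (Ioi 0)] prof s := by
    filter_upwards [h2, ae_restrict_mem measurableSet_Ioi] with t ht ht0
    have ht0 : 0 < t := ht0
    have hp : 0 < t ^ (1 - 2 * s) := by positivity
    have := (mul_eq_zero.1 ht).resolve_left hp.ne'
    nlinarith [sq_nonneg (g t - prof s t),
      sq_nonneg (weakDeriv (Ioi (0 : ℝ)) 1 g t + t ^ (2 * s - 1) * flux s t)]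
  have hIoi : EqOn g (prof s) (Ioi 0) :=
    Measure.eqOn_open_of_ae_eq hae isOpen_Ioi (hg.1.2.1.mono Ioi_subset_Ici_self)
      (continuous_prof hs0).continuousOn
  intro t ht
  rcases (mem_Ici.1 ht).eq_or_lt with rfl | h
  · rw [hg.1.2.2, prof_zero hs0]
  · exact hIoi h

end Minimization

/-! ### The unitary Fourier transform -/

section Fourier

open scoped FourierTransform SchwartzMap ComplexConjugate

/-- Plancherel for the Fourier integral itself: the isometry of L² is defined by extension, so the
point is to identify it with the integral when f is also integrable. -/
theorem lintegral_fourier_sq {E : Type*} [NormedAddCommGroup E] [InnerProductSpace ℝ E]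
    [FiniteDimensional ℝ E] [MeasurableSpace E] [BorelSpace E] {f : E → ℂ} (hf : Integrable f)
    (hf2 : MemLp f 2) : MemLp (𝓕 f) 2 ∧ eLpNorm (𝓕 f) 2 volume = eLpNorm f 2 volume := by
  set F : Lp ℂ 2 (volume : Measure E) := hf2.toLp f with hF
  have hcont : Continuous (𝓕 f) := VectorFourier.fourierIntegral_continuous
    Real.continuous_fourierChar (innerSL ℝ).continuous₂ hf
  -- Both candidates have the same pairing with every test function φ, namely that of f with the
  -- transform of φ: for the L² transform this is its meaning as a tempered distribution, for the
  -- integral it is Fubini.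
  have hae : ∀ᵐ x, (𝓕 F : Lp ℂ 2 (volume : Measure E)) x = 𝓕 f x := by
    refine ae_eq_of_integral_contDiff_smul_eq
      ((Lp.memLp (𝓕 F : Lp ℂ 2 (volume : Measure E))).locallyIntegrable (by norm_num))
      hcont.locallyIntegrable fun g hg hgc => ?_
    have hg₁ : HasCompactSupport (Complex.ofRealCLM ∘ g) := hgc.comp_left rfl
    have hg₂ : ContDiff ℝ ∞ (Complex.ofRealCLM ∘ g) := by fun_prop
    set φ : 𝓢(E, ℂ) := hg₁.toSchwartzMap hg₂ with hφ
    have hφg : ∀ x, φ x = (g x : ℂ) := fun x => rfl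
    have h1 := congrArg (fun T : 𝓢'(E, ℂ) => T φ) (Lp.fourier_toTemperedDistribution_eq F)
    simp only [TemperedDistribution.fourier_apply, Lp.toTemperedDistribution_apply] at h1
    have h2 : ∫ x, g x • (𝓕 F : Lp ℂ 2 (volume : Measure E)) x =
        ∫ x, φ x • (𝓕 F : Lp ℂ 2 (volume : Measure E)) x := rfl
    have h3 : ∫ x, g x • 𝓕 f x = ∫ x, 𝓕 f x • φ x :=
      integral_congr_ae (ae_of_all _ fun x => by simp [hφg, mul_comm])
    rw [h2, ← h1, h3]
    have h4 := VectorFourier.integral_fourierIntegral_smul_eq_flip (L := innerₗ E)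
      Real.continuous_fourierChar continuous_inner hf (φ.integrable (μ := volume))
    refine Eq.trans ?_ h4.symm
    refine integral_congr_ae ?_
    filter_upwards [hf2.coeFn_toLp] with x hx
    rw [hF, hx, smul_eq_mul, smul_eq_mul, mul_comm]
    congr 1
    rw [flip_innerₗ]
    rfl
  have hae' : (𝓕 F : Lp ℂ 2 (volume : Measure E)) =ᵐ[volume] 𝓕 f := hae
  have hn : ‖(𝓕 F : Lp ℂ 2 (volume : Measure E))‖ₑ = ‖F‖ₑ := by
    rw [← ofReal_norm, ← ofReal_norm, Lp.norm_fourier_eq]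
  refine ⟨(memLp_congr_ae hae').1 (Lp.memLp _), ?_⟩
  rw [← eLpNorm_congr_ae hae', ← Lp.enorm_def, hn, hF, Lp.enorm_toLp]

variable {n : ℕ}

/-- The normalization constant `(2π)^{-n/2}`. -/
def fc (n : ℕ) : ℝ := (2 * Real.pi) ^ (-(n : ℝ) / 2)

lemma fc_pos (n : ℕ) : 0 < fc n := Real.rpow_pos_of_pos (by positivity) _

lemma fc_sq (n : ℕ) : fc n * fc n * (2 * Real.pi) ^ n = 1 := by
  rw [fc, ← Real.rpow_add (by positivity), ← Real.rpow_natCast, ← Real.rpow_add (by positivity)]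
  ring_nf
  simp

lemma fourierT_eq (f : Rn n → ℂ) (ξ : Rn n) :
    fourierT f ξ = fc n • 𝓕 f ((2 * Real.pi)⁻¹ • ξ) := by
  rw [fourierT, Real.fourier_eq', fc]
  congr 2
  ext x
  rw [smul_eq_mul, inner_smul_right]
  congr 2
  push_cast
  field_simp

lemma fourierTInv_eq (f : Rn n → ℂ) (x : Rn n) :
    fourierTInv f x = fc n • 𝓕 f (-((2 * Real.pi)⁻¹ • x)) := by
  rw [fourierTInv, Real.fourier_eq', fc]
  congr 2
  ext ξ
  rw [smul_eq_mul, inner_neg_right, inner_smul_right, real_inner_comm]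
  congr 2
  push_cast
  field_simp

/-- The Fourier transform of a Schwartz function as a Schwartz function. -/
def hatS (u : 𝓢(Rn n, ℂ)) : 𝓢(Rn n, ℂ) :=
  fc n • SchwartzMap.compCLMOfContinuousLinearEquiv ℝ
    (ContinuousLinearEquiv.smulLeft (R₁ := ℝ) (M₁ := Rn n)
      (Units.mk0 ((2 * Real.pi)⁻¹) (inv_ne_zero (by positivity)))) (𝓕 u)

lemma hatS_apply (u : 𝓢(Rn n, ℂ)) (ξ : Rn n) : hatS u ξ = fourierT u ξ := by
  rw [fourierT_eq]
  rfl

theorem fourierTInv_fourierT (u : 𝓢(Rn n, ℂ)) (x : Rn n) : fourierTInv (fourierT u) x = u x := by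
  rw [fourierTInv]
  have e : ∀ ξ : Rn n, Complex.exp (Complex.I * ((inner ℝ x ξ : ℝ) : ℂ)) * fourierT u ξ =
      fc n • (fun η : Rn n => Complex.exp (((2 * Real.pi * inner ℝ η x : ℝ) : ℂ) * Complex.I) •
        𝓕 (u : Rn n → ℂ) η) ((2 * Real.pi)⁻¹ • ξ) := by
    intro ξ
    simp only [fourierT_eq, inner_smul_left, smul_eq_mul, mul_smul_comm]
    rw [real_inner_comm]
    congr 3
    simp
    field_simp
  simp_rw [e]
  rw [integral_smul, Measure.integral_comp_smul volume (fun η : Rn n =>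
    Complex.exp (((2 * Real.pi * inner ℝ η x : ℝ) : ℂ) * Complex.I) • 𝓕 (u : Rn n → ℂ) η)]
  have h1 : 𝓕⁻ (𝓕 (u : Rn n → ℂ)) x = u x := by
    have := congrArg (fun v : 𝓢(Rn n, ℂ) => v x)
      (FourierTransform.fourierInv_fourier_eq (E := 𝓢(Rn n, ℂ)) (F := 𝓢(Rn n, ℂ)) u)
    simpa only [SchwartzMap.fourierInv_coe, SchwartzMap.fourier_coe] using this
  rw [Real.fourierInv_eq'] at h1
  rw [h1, smul_smul, smul_smul]
  have h2 : (2 * Real.pi) ^ (-(n : ℝ) / 2) * fc n *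
      |(((2 * Real.pi)⁻¹) ^ Module.finrank ℝ (Rn n))⁻¹| = 1 := by
    rw [finrank_euclideanSpace_fin, inv_pow, inv_inv, abs_of_pos (by positivity)]
    exact fc_sq n
  rw [h2, one_smul]

lemma continuous_fourierTInv {f : Rn n → ℂ} (hf : Integrable f) : Continuous (fourierTInv f) := by
  have h : Continuous (𝓕 f) := VectorFourier.fourierIntegral_continuous
    Real.continuous_fourierChar (innerSL ℝ).continuous₂ hf
  have : fourierTInv f = fun x => fc n • 𝓕 f (-((2 * Real.pi)⁻¹ • x)) :=
    funext (fourierTInv_eq f)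
  rw [this]
  fun_prop

lemma continuous_fourierT {f : Rn n → ℂ} (hf : Integrable f) : Continuous (fourierT f) := by
  have h : Continuous (𝓕 f) := VectorFourier.fourierIntegral_continuous
    Real.continuous_fourierChar (innerSL ℝ).continuous₂ hf
  have : fourierT f = fun x => fc n • 𝓕 f ((2 * Real.pi)⁻¹ • x) :=
    funext (fourierT_eq f)
  rw [this]
  fun_prop

lemma norm_exp_I_mul (r : ℝ) : ‖Complex.exp (Complex.I * (r : ℂ))‖ = 1 := by
  rw [mul_comm]
  exact Complex.norm_exp_ofReal_mul_I r

lemma norm_fourierTInv_le (f : Rn n → ℂ) (x : Rn n) : ‖fourierTInv f x‖ ≤ fc n * ∫ ξ, ‖f ξ‖ := by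
  rw [fourierTInv, ← fc, norm_smul, Real.norm_of_nonneg (fc_pos n).le]
  refine mul_le_mul_of_nonneg_left ?_ (fc_pos n).le
  refine (norm_integral_le_integral_norm _).trans_eq ?_
  simp_rw [norm_mul, norm_exp_I_mul, one_mul]

theorem lintegral_fourierTInv_sq {f : Rn n → ℂ} (hf : Integrable f) (hf2 : MemLp f 2) :
    ∫⁻ x, ‖fourierTInv f x‖ₑ ^ 2 = ∫⁻ ξ, ‖f ξ‖ₑ ^ 2 := by
  have h2pi : (0 : ℝ) < 2 * Real.pi := by positivity
  have hcont : Continuous (𝓕 f) := VectorFourier.fourierIntegral_continuous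
    Real.continuous_fourierChar (innerSL ℝ).continuous₂ hf
  have h1 := (lintegral_fourier_sq hf hf2).2
  rw [eLpNorm_eq_lintegral_rpow_enorm_toReal two_ne_zero ENNReal.ofNat_ne_top,
    eLpNorm_eq_lintegral_rpow_enorm_toReal two_ne_zero ENNReal.ofNat_ne_top] at h1
  have h2 := ENNReal.rpow_left_injective (x := 1 / ENNReal.toReal 2) (by norm_num) h1
  simp only [ENNReal.toReal_ofNat, ENNReal.rpow_ofNat] at h2
  rw [← h2]
  simp_rw [fourierTInv_eq, enorm_smul, mul_pow, ← neg_smul, ← inv_neg]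
  have hc : (-(2 * Real.pi))⁻¹ ≠ 0 := inv_ne_zero (by linarith)
  have hm : Measurable fun x => ‖𝓕 f x‖ₑ ^ 2 := by
    have := hcont.measurable
    fun_prop
  have hm' : Measurable fun x : Rn n => (-(2 * Real.pi))⁻¹ • x := by fun_prop
  have hm2 : Measurable fun x : Rn n => ‖𝓕 f ((-(2 * Real.pi))⁻¹ • x)‖ₑ ^ 2 := hm.comp hm'
  rw [lintegral_const_mul _ hm2, ← lintegral_map hm hm',
    Measure.map_addHaar_smul volume hc, lintegral_smul_measure, smul_eq_mul, ← mul_assoc]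
  refine (congrArg (· * _) ?_).trans (one_mul _)
  rw [Real.enorm_of_nonneg (fc_pos n).le, ← ENNReal.ofReal_pow (fc_pos n).le,
    ← ENNReal.ofReal_mul (by positivity), finrank_euclideanSpace_fin, inv_pow, inv_inv, abs_pow,
    abs_neg, abs_of_pos h2pi, sq, fc_sq, ENNReal.ofReal_one]

/-- Parseval's relation by Fubini alone. Only integrability of both factors is needed, so it applies
to truncations of V without any information on their transforms. -/
theorem integral_mul_conj_fourierTInv {f m : Rn n → ℂ} (hf : Integrable f) (hm : Integrable m) :
    ∫ x, f x * conj (fourierTInv m x) = ∫ ξ, fourierT f ξ * conj (m ξ) := by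
  have hint : Integrable (Function.uncurry fun x ξ : Rn n =>
      Complex.exp (-Complex.I * ((inner ℝ x ξ : ℝ) : ℂ)) * (f x * conj (m ξ)))
      (volume.prod volume) := by
    have h0 : Integrable (fun p : Rn n × Rn n => f p.1 * conj (m p.2)) (volume.prod volume) :=
      hf.mul_prod (g := fun ξ => conj (m ξ))
        ((LinearIsometryEquiv.integrable_comp_iff Complex.conjLIE).2 hm)
    refine h0.bdd_mul (c := 1) (Continuous.aestronglyMeasurable (by fun_prop))
      (ae_of_all _ fun p => ?_)
    rw [neg_mul, ← mul_neg, ← Complex.ofReal_neg, norm_exp_I_mul]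
  have e1 : ∀ x, f x * conj (fourierTInv m x) = fc n • ∫ ξ : Rn n,
      Complex.exp (-Complex.I * ((inner ℝ x ξ : ℝ) : ℂ)) * (f x * conj (m ξ)) := by
    intro x
    rw [fourierTInv, Complex.real_smul, map_mul, Complex.conj_ofReal, ← integral_conj,
      Complex.real_smul, fc, mul_left_comm, ← integral_const_mul]
    congr 2
    ext ξ
    rw [map_mul, ← Complex.exp_conj, map_mul, Complex.conj_I, Complex.conj_ofReal]
    ring
  have e2 : ∀ ξ, fourierT f ξ * conj (m ξ) = fc n • ∫ x : Rn n,
      Complex.exp (-Complex.I * ((inner ℝ x ξ : ℝ) : ℂ)) * (f x * conj (m ξ)) := by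
    intro ξ
    rw [fourierT, smul_mul_assoc, ← integral_mul_const, fc]
    simp_rw [mul_assoc]
  simp_rw [e1, e2]
  rw [integral_smul, integral_smul, integral_integral_swap hint]

end Fourier

/-! ### Rapidly decaying multipliers -/

section Rapid

open scoped SchwartzMap

variable {n : ℕ}

/-- A measurable function that decays faster than every power. -/
def Rapid (m : Rn n → ℂ) : Prop :=
  AEStronglyMeasurable m ∧ ∀ p : ℝ, 0 ≤ p → ∃ C, ∀ ξ, ‖ξ‖ ^ p * ‖m ξ‖ ≤ C

lemma rpow_le_one_add_pow {r p : ℝ} (hr : 0 ≤ r) (hp : 0 ≤ p) : r ^ p ≤ 1 + r ^ ⌈p⌉₊ := by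
  rcases le_total r 1 with h | h
  · have := Real.rpow_le_one hr h hp
    have : 0 ≤ r ^ ⌈p⌉₊ := by positivity
    linarith
  · have := Real.rpow_le_rpow_of_exponent_le h (Nat.le_ceil p)
    rw [Real.rpow_natCast] at this
    linarith

lemma rapid_schwartz (f : 𝓢(Rn n, ℂ)) : Rapid (f : Rn n → ℂ) := by
  refine ⟨f.continuous.aestronglyMeasurable, fun p hp => ?_⟩
  obtain ⟨C₀, -, h₀⟩ := f.decay 0 0
  obtain ⟨C₁, -, h₁⟩ := f.decay ⌈p⌉₊ 0
  refine ⟨C₀ + C₁, fun ξ => ?_⟩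
  have a₀ := h₀ ξ
  have a₁ := h₁ ξ
  rw [norm_iteratedFDeriv_zero] at a₀ a₁
  rw [pow_zero] at a₀
  calc _ ≤ (1 + ‖ξ‖ ^ ⌈p⌉₊) * ‖f ξ‖ := by
        gcongr; exact rpow_le_one_add_pow (norm_nonneg _) hp
    _ ≤ _ := by linarith

lemma Rapid.of_le {m m' : Rn n → ℂ} (hm : Rapid m) (hm' : AEStronglyMeasurable m') {C q : ℝ}
    (hC : 0 ≤ C) (hq : 0 ≤ q) (h : ∀ ξ, ‖m' ξ‖ ≤ C * (‖ξ‖ ^ q * ‖m ξ‖)) : Rapid m' := by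
  refine ⟨hm', fun p hp => ?_⟩
  obtain ⟨K, hK⟩ := hm.2 (p + q) (by linarith)
  refine ⟨C * K, fun ξ => ?_⟩
  calc _ ≤ ‖ξ‖ ^ p * (C * (‖ξ‖ ^ q * ‖m ξ‖)) := by gcongr; exact h ξ
    _ = C * (‖ξ‖ ^ (p + q) * ‖m ξ‖) := by
      rw [Real.rpow_add_of_nonneg (norm_nonneg _) hp hq]; ring
    _ ≤ _ := by gcongr; exact hK ξ

lemma Rapid.integrable_rpow_mul {m : Rn n → ℂ} (hm : Rapid m) {p : ℝ} (hp : 0 ≤ p) :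
    Integrable fun ξ => ‖ξ‖ ^ p * ‖m ξ‖ := by
  obtain ⟨C₀, h₀⟩ := hm.2 p hp
  obtain ⟨C₁, h₁⟩ := hm.2 (p + (n + 1)) (by positivity)
  have hi := (integrable_one_add_norm (E := Rn n) (μ := volume) (r := (n : ℝ) + 1)
    (by rw [finrank_euclideanSpace_fin]; linarith)).const_mul (2 ^ ((n : ℝ) + 1) * (C₀ + C₁))
  refine hi.mono' ?_ (ae_of_all _ fun ξ => ?_)
  · exact (Measurable.aestronglyMeasurable (by fun_prop)).mul hm.1.norm
  rw [Real.norm_of_nonneg (by positivity), Real.rpow_neg (by positivity), ← div_eq_mul_inv,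
    le_div_iff₀ (by positivity)]
  have hC₀ := h₀ ξ
  have hC₁ := h₁ ξ
  have e : (1 + ‖ξ‖) ^ ((n : ℝ) + 1) ≤ 2 ^ ((n : ℝ) + 1) * (1 + ‖ξ‖ ^ ((n : ℝ) + 1)) := by
    rcases le_total ‖ξ‖ 1 with h | h
    · calc _ ≤ (2 : ℝ) ^ ((n : ℝ) + 1) := by gcongr; linarith
        _ ≤ _ := by
          refine le_mul_of_one_le_right (by positivity) ?_
          have : 0 ≤ ‖ξ‖ ^ ((n : ℝ) + 1) := by positivity
          linarith
    · calc _ ≤ (2 * ‖ξ‖) ^ ((n : ℝ) + 1) := by gcongr; linarith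
        _ = 2 ^ ((n : ℝ) + 1) * ‖ξ‖ ^ ((n : ℝ) + 1) :=
          Real.mul_rpow (by norm_num) (by positivity)
        _ ≤ _ := by gcongr; linarith
  calc _ ≤ ‖ξ‖ ^ p * ‖m ξ‖ * (2 ^ ((n : ℝ) + 1) * (1 + ‖ξ‖ ^ ((n : ℝ) + 1))) := by gcongr
    _ = 2 ^ ((n : ℝ) + 1) * (‖ξ‖ ^ p * ‖m ξ‖ + ‖ξ‖ ^ (p + ((n : ℝ) + 1)) * ‖m ξ‖) := by
      rw [Real.rpow_add_of_nonneg (norm_nonneg _) hp (by positivity)]; ring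
    _ ≤ _ := by gcongr

lemma Rapid.integrable {m : Rn n → ℂ} (hm : Rapid m) : Integrable m := by
  have := hm.integrable_rpow_mul le_rfl
  simp only [Real.rpow_zero, one_mul] at this
  exact (integrable_norm_iff hm.1).1 this

lemma Rapid.memLp_two {m : Rn n → ℂ} (hm : Rapid m) : MemLp m 2 := by
  rw [memLp_two_iff_integrable_sq_norm hm.1]
  obtain ⟨C, hC⟩ := hm.2 0 le_rfl
  refine (hm.integrable.norm.const_mul C).mono' (hm.1.norm.pow 2) (ae_of_all _ fun ξ => ?_)
  have := hC ξ
  rw [Real.rpow_zero, one_mul] at this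
  rw [Real.norm_of_nonneg (by positivity), sq]
  gcongr

lemma Rapid.mul_bounded {m : Rn n → ℂ} (hm : Rapid m) {b : Rn n → ℝ}
    (hb : AEStronglyMeasurable b) {C : ℝ} (hC : 0 ≤ C) (h : ∀ ξ, |b ξ| ≤ C) :
    Rapid fun ξ => m ξ * (b ξ : ℂ) := by
  refine hm.of_le (q := 0) (hm.1.mul (Complex.continuous_ofReal.comp_aestronglyMeasurable hb)) hC
    le_rfl fun ξ => ?_
  rw [norm_mul, Complex.norm_real, Real.norm_eq_abs, Real.rpow_zero, one_mul, mul_comm]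
  gcongr
  exact h ξ

/-- Multiplication by |ξ|^q in general destroys smoothness at the origin and so leaves the Schwartz
class. Decay alone survives, and decay is all that the superpositions require. -/
lemma Rapid.norm_rpow_mul {m : Rn n → ℂ} (hm : Rapid m) {q : ℝ} (hq : 0 ≤ q) :
    Rapid fun ξ => ((‖ξ‖ ^ q : ℝ) : ℂ) * m ξ := by
  refine hm.of_le (q := q) (AEStronglyMeasurable.mul ?_ hm.1) zero_le_one hq fun ξ => ?_
  · exact Measurable.aestronglyMeasurable (by fun_prop)
  · rw [norm_mul, Complex.norm_real, Real.norm_of_nonneg (by positivity), one_mul]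

lemma Rapid.inner_mul {m : Rn n → ℂ} (hm : Rapid m) (v : Rn n) :
    Rapid fun ξ => Complex.I * ((inner ℝ v ξ : ℝ) : ℂ) * m ξ := by
  refine hm.of_le (q := 1) (C := ‖v‖) (AEStronglyMeasurable.mul ?_ hm.1) (norm_nonneg _)
    zero_le_one fun ξ => ?_
  · exact Measurable.aestronglyMeasurable (by fun_prop)
  · rw [norm_mul, norm_mul, Complex.norm_I, one_mul, Complex.norm_real, Real.rpow_one, ← mul_assoc]
    gcongr
    exact norm_inner_le_norm v ξ

end Rapid

/-! ### Fourier superpositions of a dilated profile -/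

section Superposition

variable {n : ℕ}

/-- `𝓕⁻¹(m(ξ) k(|ξ| y))(x)`. -/
def superpos (m : Rn n → ℂ) (k : ℝ → ℝ) (X : Rn n × ℝ) : ℂ :=
  fourierTInv (fun ξ => m ξ * ((k (‖ξ‖ * X.2) : ℝ) : ℂ)) X.1

lemma Rapid.mul_profile {m : Rn n → ℂ} (hm : Rapid m) {k : ℝ → ℝ} (hk : Continuous k) {M : ℝ}
    (hM : ∀ t, |k t| ≤ M) (y : ℝ) : Rapid fun ξ => m ξ * ((k (‖ξ‖ * y) : ℝ) : ℂ) :=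
  hm.mul_bounded (Continuous.aestronglyMeasurable (by fun_prop)) ((abs_nonneg _).trans (hM 0))
    fun _ => hM _

lemma continuous_superpos {m : Rn n → ℂ} (hm : Rapid m) {k : ℝ → ℝ} (hk : Continuous k) {M : ℝ}
    (hM : ∀ t, |k t| ≤ M) : Continuous (superpos m k) := by
  suffices h : Continuous fun X : Rn n × ℝ => ∫ ξ : Rn n,
      Complex.exp (Complex.I * ((inner ℝ X.1 ξ : ℝ) : ℂ)) * (m ξ * ((k (‖ξ‖ * X.2) : ℝ) : ℂ)) from
    h.const_smul (fc n)
  refine continuous_of_dominated (bound := fun ξ => ‖m ξ‖ * M) (fun X => ?_)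
    (fun X => ae_of_all _ fun ξ => ?_) (hm.integrable.norm.mul_const M)
    (ae_of_all _ fun ξ => by fun_prop)
  · exact AEStronglyMeasurable.mul (Continuous.aestronglyMeasurable (by fun_prop))
      (hm.mul_profile hk hM X.2).1
  · rw [norm_mul, norm_exp_I_mul, one_mul, norm_mul, Complex.norm_real, Real.norm_eq_abs]
    gcongr
    exact hM _

lemma norm_superpos_le {m : Rn n → ℂ} (hm : Rapid m) {k : ℝ → ℝ} {M : ℝ}
    (hM : ∀ t, |k t| ≤ M) (X : Rn n × ℝ) : ‖superpos m k X‖ ≤ fc n * ∫ ξ, ‖m ξ‖ * M := by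
  refine (norm_fourierTInv_le _ _).trans ?_
  refine mul_le_mul_of_nonneg_left ?_ (fc_pos n).le
  refine integral_mono_of_nonneg (ae_of_all _ fun _ => norm_nonneg _)
    (hm.integrable.norm.mul_const M) (ae_of_all _ fun ξ => ?_)
  simp only
  rw [norm_mul, Complex.norm_real, Real.norm_eq_abs]
  gcongr
  exact hM _

/-- The derivative of the integrand of `superpos`. -/
def superposDeriv (m : Rn n → ℂ) (k k' : ℝ → ℝ) (X : Rn n × ℝ) (ξ : Rn n) : Rn n × ℝ →L[ℝ] ℂ :=
  (Complex.exp (Complex.I * ((inner ℝ X.1 ξ : ℝ) : ℂ)) * (m ξ * ((k (‖ξ‖ * X.2) : ℝ) : ℂ)) *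
    Complex.I) • (Complex.ofRealCLM.comp ((innerSL ℝ ξ).comp (ContinuousLinearMap.fst ℝ _ ℝ))) +
  (Complex.exp (Complex.I * ((inner ℝ X.1 ξ : ℝ) : ℂ)) *
    (m ξ * (((‖ξ‖ * k' (‖ξ‖ * X.2) : ℝ)) : ℂ))) •
    (Complex.ofRealCLM.comp (ContinuousLinearMap.snd ℝ (Rn n) ℝ))

lemma superposDeriv_apply (m : Rn n → ℂ) (k k' : ℝ → ℝ) (X : Rn n × ℝ) (ξ : Rn n) (v : Rn n × ℝ) :
    superposDeriv m k k' X ξ v =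
      Complex.exp (Complex.I * ((inner ℝ X.1 ξ : ℝ) : ℂ)) *
        (Complex.I * ((inner ℝ v.1 ξ : ℝ) : ℂ) * m ξ * ((k (‖ξ‖ * X.2) : ℝ) : ℂ)) +
      v.2 * (Complex.exp (Complex.I * ((inner ℝ X.1 ξ : ℝ) : ℂ)) *
        (m ξ * (((‖ξ‖ * k' (‖ξ‖ * X.2) : ℝ)) : ℂ))) := by
  simp only [superposDeriv, _root_.add_apply, _root_.smul_apply,
    ContinuousLinearMap.comp_apply, Complex.ofRealCLM_apply, innerSL_apply_apply,
    ContinuousLinearMap.coe_fst', ContinuousLinearMap.coe_snd', smul_eq_mul, real_inner_comm]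
  ring

lemma aestronglyMeasurable_superposDeriv {m : Rn n → ℂ} (hm : Rapid m) {k k' : ℝ → ℝ}
    (hk : Continuous k) (hk' : Measurable k') {M : ℝ} (hM : ∀ t, |k t| ≤ M) (X : Rn n × ℝ) :
    AEStronglyMeasurable (superposDeriv m k k' X) := by
  have hexp : AEStronglyMeasurable fun ξ : Rn n =>
      Complex.exp (Complex.I * ((inner ℝ X.1 ξ : ℝ) : ℂ)) :=
    Continuous.aestronglyMeasurable (by fun_prop)
  have h1 : AEStronglyMeasurable fun ξ : Rn n =>
      Complex.exp (Complex.I * ((inner ℝ X.1 ξ : ℝ) : ℂ)) *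
        (m ξ * ((k (‖ξ‖ * X.2) : ℝ) : ℂ)) * Complex.I :=
    (hexp.mul (hm.mul_profile hk hM X.2).1).mul aestronglyMeasurable_const
  have h2 : AEStronglyMeasurable fun ξ : Rn n => Complex.ofRealCLM.comp
      ((innerSL ℝ ξ).comp (ContinuousLinearMap.fst ℝ (Rn n) ℝ)) :=
    Continuous.aestronglyMeasurable (by fun_prop)
  have h4 : AEStronglyMeasurable fun ξ : Rn n => ((‖ξ‖ * k' (‖ξ‖ * X.2) : ℝ) : ℂ) :=
    Measurable.aestronglyMeasurable (by fun_prop)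
  have h3 : AEStronglyMeasurable fun ξ : Rn n =>
      Complex.exp (Complex.I * ((inner ℝ X.1 ξ : ℝ) : ℂ)) *
        (m ξ * ((‖ξ‖ * k' (‖ξ‖ * X.2) : ℝ) : ℂ)) := hexp.mul (hm.1.mul h4)
  exact (h1.smul h2).add (h3.smul aestronglyMeasurable_const)

lemma hasFDerivAt_superposIntegrand {m : Rn n → ℂ} {k k' : ℝ → ℝ}
    (hd : ∀ t, 0 < t → HasDerivAt k (k' t) t) {Y : Rn n × ℝ} (hY0 : 0 < Y.2) (ξ : Rn n) :
    HasFDerivAt (fun Y : Rn n × ℝ => Complex.exp (Complex.I * ((inner ℝ Y.1 ξ : ℝ) : ℂ)) *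
      (m ξ * ((k (‖ξ‖ * Y.2) : ℝ) : ℂ))) (superposDeriv m k k' Y ξ) Y := by
  have h1 : HasFDerivAt (fun Y : Rn n × ℝ =>
      Complex.exp (Complex.I * ((inner ℝ Y.1 ξ : ℝ) : ℂ)))
      ((Complex.exp (Complex.I * ((inner ℝ Y.1 ξ : ℝ) : ℂ)) * Complex.I) •
      (Complex.ofRealCLM.comp ((innerSL ℝ ξ).comp (ContinuousLinearMap.fst ℝ _ ℝ)))) Y := by
    have h2 : HasFDerivAt (fun Y : Rn n × ℝ => ((inner ℝ Y.1 ξ : ℝ) : ℂ))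
        (Complex.ofRealCLM.comp ((innerSL ℝ ξ).comp (ContinuousLinearMap.fst ℝ _ ℝ))) Y := by
      have := (Complex.ofRealCLM.comp
        ((innerSL ℝ ξ).comp (ContinuousLinearMap.fst ℝ (Rn n) ℝ))).hasFDerivAt (x := Y)
      refine this.congr_of_eventuallyEq (Eventually.of_forall fun Z => ?_)
      simp [real_inner_comm]
    refine ((h2.const_mul Complex.I).cexp).congr_fderiv ?_
    rw [smul_smul]
  have h3 : HasFDerivAt (fun Y : Rn n × ℝ => m ξ * ((k (‖ξ‖ * Y.2) : ℝ) : ℂ))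
      ((m ξ * (((‖ξ‖ * k' (‖ξ‖ * Y.2) : ℝ)) : ℂ)) •
        (Complex.ofRealCLM.comp (ContinuousLinearMap.snd ℝ (Rn n) ℝ))) Y := by
    have h4 : HasDerivAt (fun y : ℝ => k (‖ξ‖ * y)) (‖ξ‖ * k' (‖ξ‖ * Y.2)) Y.2 := by
      -- At ξ = 0 the integrand does not depend on y, and the factor ‖ξ‖ cancels whatever value `k'`
      -- has at 0.
      rcases eq_or_ne ξ 0 with rfl | hξ
      · simpa using hasDerivAt_const Y.2 (k 0)
      have h5 : HasDerivAt (fun y : ℝ => ‖ξ‖ * y) ‖ξ‖ Y.2 := by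
        simpa using (hasDerivAt_id Y.2).const_mul ‖ξ‖
      have := (hd (‖ξ‖ * Y.2) (mul_pos (norm_pos_iff.2 hξ) hY0)).comp Y.2 h5
      rwa [mul_comm] at this
    have h6 := (h4.ofReal_comp.const_mul (m ξ)).hasFDerivAt.comp Y
      (hasFDerivAt_snd (𝕜 := ℝ) (p := Y))
    refine h6.congr_fderiv ?_
    ext v <;> simp [mul_comm]
  refine (h1.mul h3).congr_fderiv ?_
  ext v <;> simp [superposDeriv]
  ring

/-- The y-derivative of k(|ξ|y) is at most M |ξ|^(1+b) y^b. The condition b > -1 keeps the power of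
|ξ| positive, so rapid decay of m dominates it locally uniformly in y > 0. The exponents used are b
= 2s - 1 for the profile and b = 1 - 2s for the flux. -/
theorem hasFDerivAt_superpos {m : Rn n → ℂ} (hm : Rapid m) {k k' : ℝ → ℝ} (hk : Continuous k)
    (hk' : Measurable k') {M b : ℝ} (hM : ∀ t, |k t| ≤ M)
    (hd : ∀ t, 0 < t → HasDerivAt k (k' t) t) (hb : -1 < b)
    (hM' : ∀ t, 0 < t → |k' t| ≤ M * t ^ b) {X : Rn n × ℝ} (hX : 0 < X.2) :
    Integrable (superposDeriv m k k' X) ∧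
    HasFDerivAt (superpos m k) (fc n • ∫ ξ, superposDeriv m k k' X ξ) X := by
  have hM0 : 0 ≤ M := (abs_nonneg _).trans (hM 0)
  -- The sum of the two endpoint values bounds y^b on (X.2/2, 2 X.2) whatever the sign of b.
  set c : ℝ := (X.2 / 2) ^ b + (2 * X.2) ^ b with hc
  have hcp : 0 ≤ c := by positivity
  set S : Set (Rn n × ℝ) := {Y | Y.2 ∈ Ioo (X.2 / 2) (2 * X.2)} with hS
  have hSX : S ∈ 𝓝 X :=
    continuous_snd.continuousAt.preimage_mem_nhds (Ioo_mem_nhds (by linarith) (by linarith))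
  have hbound : ∀ Y ∈ S, ∀ ξ : Rn n, ‖superposDeriv m k k' Y ξ‖ ≤
      M * (‖ξ‖ ^ (1 : ℝ) * ‖m ξ‖) + M * c * (‖ξ‖ ^ (1 + b) * ‖m ξ‖) := by
    intro Y hY ξ
    have hY0 : 0 < Y.2 := lt_trans (by positivity) hY.1
    refine ContinuousLinearMap.opNorm_le_bound _ (by positivity) fun v => ?_
    rw [superposDeriv_apply, add_mul]
    refine (norm_add_le _ _).trans (add_le_add ?_ ?_)
    · rw [norm_mul, norm_exp_I_mul, one_mul, norm_mul, norm_mul, norm_mul, Complex.norm_I, one_mul,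
        Complex.norm_real, Complex.norm_real, Real.norm_eq_abs (k _), Real.rpow_one]
      calc _ ≤ ‖v.1‖ * ‖ξ‖ * ‖m ξ‖ * M := by
            gcongr
            · exact norm_inner_le_norm _ _
            · exact hM _
        _ ≤ ‖v‖ * ‖ξ‖ * ‖m ξ‖ * M := by gcongr; exact norm_fst_le v
        _ = _ := by ring
    · rw [norm_mul, norm_mul, norm_exp_I_mul, one_mul, norm_mul, Complex.norm_real,
        Complex.norm_real, norm_mul, norm_norm, Real.norm_eq_abs (k' _)]
      rcases eq_or_ne ξ 0 with rfl | hξ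
      · simp only [norm_zero, zero_mul, mul_zero]
        positivity
      have hξ0 : 0 < ‖ξ‖ := norm_pos_iff.2 hξ
      have h1 : |k' (‖ξ‖ * Y.2)| ≤ M * (‖ξ‖ ^ b * c) := by
        refine (hM' _ (by positivity)).trans ?_
        rw [Real.mul_rpow hξ0.le hY0.le]
        gcongr
        rcases le_total 0 b with h | h
        · have : Y.2 ^ b ≤ (2 * X.2) ^ b := Real.rpow_le_rpow hY0.le hY.2.le h
          have : 0 ≤ (X.2 / 2) ^ b := by positivity
          linarith
        · have : Y.2 ^ b ≤ (X.2 / 2) ^ b :=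
            Real.rpow_le_rpow_of_nonpos (by positivity) hY.1.le h
          have : 0 ≤ (2 * X.2) ^ b := by positivity
          linarith
      calc _ ≤ ‖v‖ * (‖m ξ‖ * (‖ξ‖ * (M * (‖ξ‖ ^ b * c)))) := by
            gcongr
            exact norm_snd_le v
        _ = _ := by rw [Real.rpow_add hξ0, Real.rpow_one]; ring
  have hF'm := aestronglyMeasurable_superposDeriv hm hk hk' hM X
  have hbi : Integrable fun ξ : Rn n =>
      M * (‖ξ‖ ^ (1 : ℝ) * ‖m ξ‖) + M * c * (‖ξ‖ ^ (1 + b) * ‖m ξ‖) :=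
    ((hm.integrable_rpow_mul zero_le_one).const_mul _).add
      ((hm.integrable_rpow_mul (by linarith)).const_mul _)
  refine ⟨hbi.mono' hF'm (ae_of_all _ fun ξ => hbound X (mem_of_mem_nhds hSX) ξ), ?_⟩
  have key := hasFDerivAt_integral_of_dominated_of_fderiv_le (μ := volume)
    (F := fun (Y : Rn n × ℝ) (ξ : Rn n) => Complex.exp (Complex.I * ((inner ℝ Y.1 ξ : ℝ) : ℂ)) *
      (m ξ * ((k (‖ξ‖ * Y.2) : ℝ) : ℂ))) hSX
    (Eventually.of_forall fun Y => ?_) ?_ hF'm (ae_of_all _ fun ξ Y hY => hbound Y hY ξ) hbi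
    (ae_of_all _ fun ξ Y hY => ?_)
  · exact key.const_smul (fc n)
  · exact AEStronglyMeasurable.mul (Continuous.aestronglyMeasurable (by fun_prop))
      (hm.mul_profile hk hM Y.2).1
  · refine (hm.mul_profile hk hM X.2).integrable.bdd_mul (c := 1)
      (Continuous.aestronglyMeasurable (by fun_prop)) (ae_of_all _ fun ξ => ?_)
    rw [norm_exp_I_mul]
  · have hY0 : 0 < Y.2 := lt_trans (by positivity) hY.1
    exact hasFDerivAt_superposIntegrand hd hY0 ξ

/-- The derivative of `superpos` in the direction `v`. -/
theorem fderiv_superpos {m : Rn n → ℂ} (hm : Rapid m) {k k' : ℝ → ℝ} (hk : Continuous k)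
    (hk' : Measurable k') {M b : ℝ} (hM : ∀ t, |k t| ≤ M)
    (hd : ∀ t, 0 < t → HasDerivAt k (k' t) t) (hb : -1 < b)
    (hM' : ∀ t, 0 < t → |k' t| ≤ M * t ^ b) {X : Rn n × ℝ} (hX : 0 < X.2) :
    (∀ v : Rn n, fderiv ℝ (superpos m k) X (v, 0) =
      superpos (fun ξ => Complex.I * ((inner ℝ v ξ : ℝ) : ℂ) * m ξ) k X) ∧
    fderiv ℝ (superpos m k) X (0, 1) =
      fourierTInv (fun ξ => m ξ * (((‖ξ‖ * k' (‖ξ‖ * X.2) : ℝ)) : ℂ)) X.1 := by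
  obtain ⟨hi, h⟩ := hasFDerivAt_superpos hm hk hk' hM hd hb hM' hX
  rw [h.fderiv]
  constructor
  · intro v
    rw [_root_.smul_apply, ContinuousLinearMap.integral_apply hi, superpos,
      fourierTInv, ← fc]
    simp [superposDeriv_apply]
  · rw [_root_.smul_apply, ContinuousLinearMap.integral_apply hi,
      fourierTInv, ← fc]
    simp [superposDeriv_apply]

end Superposition

/-! ### The extension: regularity, equation and flux -/

section Extension

open scoped SchwartzMap

variable {n : ℕ} {s : ℝ} (hs0 : 0 < s) (hs1 : s < 1) (u : 𝓢(Rn n, ℂ))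

lemma extension_eq_superpos : extension (prof s) u = superpos (hatS u) (prof s) := by
  ext X
  simp only [extension, superpos, hatS_apply]

include hs0 in
lemma abs_prof_le (t : ℝ) : |prof s t| ≤ 1 := by
  rw [abs_of_nonneg (prof_nonneg hs0 t)]
  exact prof_le_one hs0 t

include hs0 hs1 in
lemma abs_flux_le (t : ℝ) : |flux s t| ≤ flux s 0 := by
  rw [abs_of_nonneg (flux_nonneg hs0 t)]
  exact flux_le hs0 hs1 t

/-- The multiplier `|ξ|^{2s} û`. -/
def fluxMul (s : ℝ) (u : 𝓢(Rn n, ℂ)) (ξ : Rn n) : ℂ := ((‖ξ‖ ^ (2 * s) : ℝ) : ℂ) * hatS u ξ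

/-- The multiplier `|ξ|² û`. -/
def lapMul (u : 𝓢(Rn n, ℂ)) (ξ : Rn n) : ℂ := ((‖ξ‖ ^ (2 : ℝ) : ℝ) : ℂ) * hatS u ξ

/-- The multiplier `i ξ_i û`. -/
def gradMul (i : Fin n) (u : 𝓢(Rn n, ℂ)) (ξ : Rn n) : ℂ := Complex.I * ((ξ i : ℝ) : ℂ) * hatS u ξ

include hs0 in
lemma rapid_fluxMul : Rapid (fluxMul s u) := (rapid_schwartz (hatS u)).norm_rpow_mul (by linarith)

lemma rapid_lapMul : Rapid (lapMul u) := (rapid_schwartz (hatS u)).norm_rpow_mul (by norm_num)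

lemma gradMul_eq (i : Fin n) : gradMul i u = fun ξ =>
    Complex.I * ((inner ℝ (EuclideanSpace.single i (1 : ℝ)) ξ : ℝ) : ℂ) * hatS u ξ := by
  ext ξ
  simp [gradMul, EuclideanSpace.inner_single_left]

lemma rapid_gradMul (i : Fin n) : Rapid (gradMul i u) := by
  rw [gradMul_eq]
  exact (rapid_schwartz (hatS u)).inner_mul _

section

variable {m : Rn n → ℂ} (hm : Rapid m)
include hs0 hs1

lemma abs_deriv_prof_le {t : ℝ} (ht : 0 < t) :
    |-(t ^ (2 * s - 1) * flux s t)| ≤ max 1 (flux s 0) * t ^ (2 * s - 1) := by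
  rw [abs_neg, abs_mul, abs_of_nonneg (by positivity), mul_comm]
  gcongr
  exact (abs_flux_le hs0 hs1 t).trans (le_max_right _ _)

omit hs1 in
lemma abs_deriv_flux_le {t : ℝ} (ht : 0 < t) :
    |-(t ^ (1 - 2 * s) * prof s t)| ≤ max 1 (flux s 0) * t ^ (1 - 2 * s) := by
  rw [abs_neg, abs_mul, abs_of_nonneg (by positivity), mul_comm]
  gcongr
  exact (abs_prof_le hs0 t).trans (le_max_left _ _)

omit hs0 in
lemma measurable_deriv_prof : Measurable fun t : ℝ => -(t ^ (2 * s - 1) * flux s t) := by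
  have := (continuous_flux hs1).measurable
  fun_prop

omit hs1 in
lemma measurable_deriv_flux : Measurable fun t : ℝ => -(t ^ (1 - 2 * s) * prof s t) := by
  have := (continuous_prof hs0).measurable
  fun_prop

include hm

lemma differentiableAt_superpos_prof {X : Rn n × ℝ} (hX : 0 < X.2) :
    DifferentiableAt ℝ (superpos m (prof s)) X :=
  (hasFDerivAt_superpos hm (continuous_prof hs0) (measurable_deriv_prof hs1)
    (fun t => (abs_prof_le hs0 t).trans (le_max_left _ _))
    (fun _ ht => hasDerivAt_prof hs0 ht) (by linarith)
    (fun _ ht => abs_deriv_prof_le hs0 hs1 ht) hX).2.differentiableAt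

lemma differentiableAt_superpos_flux {X : Rn n × ℝ} (hX : 0 < X.2) :
    DifferentiableAt ℝ (superpos m (flux s)) X :=
  (hasFDerivAt_superpos hm (continuous_flux hs1) (measurable_deriv_flux hs0)
    (fun t => (abs_flux_le hs0 hs1 t).trans (le_max_right _ _))
    (fun _ ht => hasDerivAt_flux hs1 ht) (by linarith)
    (fun _ ht => abs_deriv_flux_le hs0 ht) hX).2.differentiableAt

lemma fderiv_superpos_prof {X : Rn n × ℝ} (hX : 0 < X.2) :
    (∀ v : Rn n, fderiv ℝ (superpos m (prof s)) X (v, 0) =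
      superpos (fun ξ => Complex.I * ((inner ℝ v ξ : ℝ) : ℂ) * m ξ) (prof s) X) ∧
    fderiv ℝ (superpos m (prof s)) X (0, 1) = fourierTInv (fun ξ => m ξ *
      (((‖ξ‖ * -((‖ξ‖ * X.2) ^ (2 * s - 1) * flux s (‖ξ‖ * X.2)) : ℝ)) : ℂ)) X.1 :=
  fderiv_superpos hm (continuous_prof hs0) (measurable_deriv_prof hs1)
    (fun t => (abs_prof_le hs0 t).trans (le_max_left _ _))
    (fun _ ht => hasDerivAt_prof hs0 ht) (by linarith)
    (fun _ ht => abs_deriv_prof_le hs0 hs1 ht) hX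

lemma fderiv_superpos_flux {X : Rn n × ℝ} (hX : 0 < X.2) :
    fderiv ℝ (superpos m (flux s)) X (0, 1) = fourierTInv (fun ξ => m ξ *
      (((‖ξ‖ * -((‖ξ‖ * X.2) ^ (1 - 2 * s) * prof s (‖ξ‖ * X.2)) : ℝ)) : ℂ)) X.1 :=
  (fderiv_superpos hm (continuous_flux hs1) (measurable_deriv_flux hs0)
    (fun t => (abs_flux_le hs0 hs1 t).trans (le_max_right _ _))
    (fun _ ht => hasDerivAt_flux hs1 ht) (by linarith)
    (fun _ ht => abs_deriv_flux_le hs0 ht) hX).2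

end

lemma fourierTInv_smul (c : ℂ) (f : Rn n → ℂ) (x : Rn n) :
    fourierTInv (fun ξ => c * f ξ) x = c * fourierTInv f x := by
  rw [fourierTInv, fourierTInv, mul_smul_comm, ← integral_const_mul]
  simp_rw [mul_left_comm]

include hs0 hs1

lemma partialX_extension (i : Fin n) {X : Rn n × ℝ} (hX : 0 < X.2) :
    partialX i (extension (prof s) u) X = superpos (gradMul i u) (prof s) X := by
  rw [partialX, dirX, extension_eq_superpos, gradMul_eq]
  exact (fderiv_superpos_prof hs0 hs1 (rapid_schwartz _) hX).1 _

/-- The factor |ξ| from the chain rule combines with (|ξ|y)^(2s-1) into |ξ|^(2s) y^(2s-1). The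
possibly singular power of y thus leaves the Fourier integral and is cancelled exactly by the weight
y^(1-2s) in `fluxY_extension`. -/
lemma partialY_extension {X : Rn n × ℝ} (hX : 0 < X.2) :
    partialY (extension (prof s) u) X =
      -(X.2 ^ (2 * s - 1)) • superpos (fluxMul s u) (flux s) X := by
  rw [partialY, dirY, extension_eq_superpos,
    (fderiv_superpos_prof hs0 hs1 (rapid_schwartz _) hX).2, superpos, Complex.real_smul,
    ← fourierTInv_smul]
  congr 1
  ext ξ
  rcases eq_or_ne ξ 0 with rfl | hξ
  · simp [fluxMul, Real.zero_rpow (by linarith : 2 * s ≠ 0)]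
  have hξ0 : 0 < ‖ξ‖ := norm_pos_iff.2 hξ
  have e : ‖ξ‖ ^ (2 * s) = ‖ξ‖ ^ (2 * s - 1) * ‖ξ‖ := by
    rw [← Real.rpow_add_one hξ0.ne']; ring_nf
  rw [fluxMul, e, Real.mul_rpow hξ0.le hX.le]
  push_cast
  ring

lemma fluxY_extension {X : Rn n × ℝ} (hX : 0 < X.2) :
    fluxY s (extension (prof s) u) X = -superpos (fluxMul s u) (flux s) X := by
  rw [fluxY, partialY_extension hs0 hs1 u hX, smul_smul, mul_neg, ← Real.rpow_add hX]
  ring_nf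
  simp

lemma partialY_superpos_fluxMul {X : Rn n × ℝ} (hX : 0 < X.2) :
    partialY (superpos (fluxMul s u) (flux s)) X =
      -(X.2 ^ (1 - 2 * s)) • superpos (lapMul u) (prof s) X := by
  rw [partialY, dirY, fderiv_superpos_flux hs0 hs1 (rapid_fluxMul hs0 u) hX, superpos,
    Complex.real_smul, ← fourierTInv_smul]
  congr 1
  ext ξ
  rcases eq_or_ne ξ 0 with rfl | hξ
  · simp [lapMul]
  have hξ0 : 0 < ‖ξ‖ := norm_pos_iff.2 hξ
  have e : ‖ξ‖ ^ (2 : ℝ) = ‖ξ‖ ^ (2 * s) * ‖ξ‖ ^ (1 - 2 * s) * ‖ξ‖ := by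
    rw [← Real.rpow_add hξ0, ← Real.rpow_add_one hξ0.ne']; ring_nf
  rw [fluxMul, lapMul, e, Real.mul_rpow hξ0.le hX.le]
  push_cast
  ring

omit hs1 in
lemma sum_superpos_gradMul (X : Rn n × ℝ) :
    ∑ i, superpos (fun ξ => Complex.I * ((ξ i : ℝ) : ℂ) * gradMul i u ξ) (prof s) X =
      -superpos (lapMul u) (prof s) X := by
  have hr : ∀ i, Rapid fun ξ : Rn n => Complex.I * ((ξ i : ℝ) : ℂ) * gradMul i u ξ := by
    intro i
    have := (rapid_gradMul u i).inner_mul (EuclideanSpace.single i (1 : ℝ))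
    simpa [EuclideanSpace.inner_single_left] using this
  simp only [superpos, fourierTInv]
  rw [← Finset.smul_sum, ← integral_finsetSum, ← smul_neg, ← integral_neg]
  · congr 2
    ext ξ
    rw [← Finset.mul_sum, ← Finset.sum_mul, ← mul_neg, ← neg_mul]
    congr 2
    have e : ((‖ξ‖ ^ (2 : ℝ) : ℝ) : ℂ) = ∑ i, ((ξ i : ℝ) : ℂ) ^ 2 := by
      rw [Real.rpow_two, EuclideanSpace.norm_sq_eq]
      push_cast
      simp [← Complex.ofReal_pow]
    rw [lapMul, e, Finset.sum_mul, ← Finset.sum_neg_distrib]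
    refine Finset.sum_congr rfl fun i _ => ?_
    rw [gradMul]
    linear_combination (((ξ i : ℝ) : ℂ) ^ 2 * hatS u ξ) * Complex.I_sq
  · intro i _
    refine ((hr i).mul_profile (continuous_prof hs0) (abs_prof_le hs0) X.2).integrable.bdd_mul
      (c := 1) (Continuous.aestronglyMeasurable (by fun_prop)) (ae_of_all _ fun ξ => ?_)
    rw [norm_exp_I_mul]

omit hs0 hs1 in
lemma isOpen_halfSpace : IsOpen (halfSpace n) := isOpen_lt continuous_const continuous_snd

omit hs0 hs1 in
instance : (volume : Measure (Rn n × ℝ)).IsAddHaarMeasure :=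
  inferInstanceAs ((volume : Measure (Rn n)).prod (volume : Measure ℝ)).IsAddHaarMeasure

/-- The horizontal terms carry the symbol -|ξ|², the sum of the (iξ_i)². The vertical term carries
+|ξ|² by the equation h' = -t^(1-2s) g of the system; both come with the factor y^(1-2s) g(|ξ|y), so
they cancel. -/
theorem solvesExtension_prof : SolvesExtension s (extension (prof s) u) := by
  intro X hX
  have hX : 0 < X.2 := hX
  have hnear : ∀ᶠ Y in 𝓝 X, 0 < Y.2 := isOpen_halfSpace.mem_nhds hX
  have hw : HasFDerivAt (fun Y : Rn n × ℝ => Y.2 ^ (1 - 2 * s))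
      (((1 - 2 * s) * X.2 ^ (1 - 2 * s - 1)) • ContinuousLinearMap.snd ℝ (Rn n) ℝ) X := by
    exact (hasFDerivAt_snd (𝕜 := ℝ) (p := X)).rpow_const (Or.inl hX.ne')
  have hfx : ∀ i, fluxX s i (extension (prof s) u) =ᶠ[𝓝 X]
      fun Y => Y.2 ^ (1 - 2 * s) • superpos (gradMul i u) (prof s) Y := fun i =>
    hnear.mono fun Y hY => by rw [fluxX, partialX_extension hs0 hs1 u i hY]
  have hfy : fluxY s (extension (prof s) u) =ᶠ[𝓝 X] fun Y => -superpos (fluxMul s u) (flux s) Y :=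
    hnear.mono fun Y hY => fluxY_extension hs0 hs1 u hY
  have hdx : ∀ i, HasFDerivAt
      (fun Y => Y.2 ^ (1 - 2 * s) • superpos (gradMul i u) (prof s) Y) _ X :=
    fun i => hw.smul (differentiableAt_superpos_prof hs0 hs1 (rapid_gradMul u i) hX).hasFDerivAt
  have hdy := differentiableAt_superpos_flux hs0 hs1 (rapid_fluxMul hs0 u) hX
  refine ⟨?_, fun i => ?_, ?_, ?_⟩
  · rw [extension_eq_superpos]
    exact differentiableAt_superpos_prof hs0 hs1 (rapid_schwartz _) hX
  · exact ((hdx i).congr_of_eventuallyEq (hfx i)).differentiableAt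
  · exact hdy.neg.congr_of_eventuallyEq hfy
  · have h1 : ∀ i, partialX i (fluxX s i (extension (prof s) u)) X = X.2 ^ (1 - 2 * s) •
        superpos (fun ξ => Complex.I * ((ξ i : ℝ) : ℂ) * gradMul i u ξ) (prof s) X := by
      intro i
      rw [partialX, ((hdx i).congr_of_eventuallyEq (hfx i)).fderiv, dirX]
      have := (fderiv_superpos_prof hs0 hs1 (rapid_gradMul u i) hX).1 (EuclideanSpace.single i 1)
      simp only [EuclideanSpace.inner_single_left, map_one, one_mul] at this
      simp [this]
    have h2 : partialY (fluxY s (extension (prof s) u)) X =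
        X.2 ^ (1 - 2 * s) • superpos (lapMul u) (prof s) X := by
      rw [partialY, hfy.fderiv_eq, fderiv_fun_neg, neg_apply]
      have := partialY_superpos_fluxMul hs0 hs1 u hX
      rw [partialY] at this
      rw [this, neg_smul, neg_neg]
    simp_rw [h1, h2]
    rw [← Finset.smul_sum, sum_superpos_gradMul hs0 u, smul_neg, neg_add_cancel]

theorem extension_prof_mem_class : extension (prof s) u ∈ extensionClass (u : Rn n → ℂ) := by
  have hc : Continuous (extension (prof s) u) := by
    rw [extension_eq_superpos]
    exact continuous_superpos (rapid_schwartz _) (continuous_prof hs0) (abs_prof_le hs0)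
  have hd : ∀ X ∈ halfSpace n, DifferentiableAt ℝ (extension (prof s) u) X :=
    fun X hX => (solvesExtension_prof hs0 hs1 u X hX).1
  refine ⟨⟨fun i => ⟨_, hasWeakDeriv_of_differentiableAt isOpen_halfSpace hd ?_⟩,
    ⟨_, hasWeakDeriv_of_differentiableAt isOpen_halfSpace hd ?_⟩⟩, fun x => ⟨?_, ?_⟩⟩
  · refine ContinuousOn.congr (f := superpos (gradMul i u) (prof s)) ?_
      fun X hX => partialX_extension hs0 hs1 u i hX
    exact (continuous_superpos (rapid_gradMul u i) (continuous_prof hs0)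
      (abs_prof_le hs0)).continuousOn
  · refine ContinuousOn.congr (f := fun X => -(X.2 ^ (2 * s - 1)) •
      superpos (fluxMul s u) (flux s) X) ?_ fun X hX => partialY_extension hs0 hs1 u hX
    have h : ContinuousOn (fun X : Rn n × ℝ => -(X.2 ^ (2 * s - 1))) (halfSpace n) :=
      (continuous_snd.continuousOn.rpow_const fun X hX => Or.inl (ne_of_gt hX)).neg
    exact h.smul (continuous_superpos (rapid_fluxMul hs0 u)
      (continuous_flux hs1) (abs_flux_le hs0 hs1)).continuousOn
  · exact (hc.comp (by fun_prop)).continuousOn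
  · simp only [extension, mul_zero, prof_zero hs0, Complex.ofReal_one, mul_one]
    exact fourierTInv_fourierT u x

end Extension

/-! ### The fractional Laplacian as a Fourier multiplier -/

section FracLap

open scoped SchwartzMap

variable {n : ℕ} [NeZero n] {s : ℝ} (hs0 : 0 < s) (hs1 : s < 1)

/-- The kernel `(1 - cos (w · ξ)) / |w|^{n+2s}`. -/
def kernel (s : ℝ) (ξ w : Rn n) : ℝ := (1 - Real.cos (inner ℝ w ξ)) / ‖w‖ ^ ((n : ℝ) + 2 * s)

omit [NeZero n] in
lemma kernel_nonneg (ξ w : Rn n) : 0 ≤ kernel s ξ w :=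
  div_nonneg (sub_nonneg.2 (Real.cos_le_one _)) (by positivity)

omit [NeZero n] in
lemma measurable_kernel : Measurable fun p : Rn n × Rn n => kernel s p.2 p.1 := by
  unfold kernel
  fun_prop

instance : Nontrivial (Rn n) :=
  Module.nontrivial_of_finrank_pos (R := ℝ) (by simp [NeZero.pos])

include hs0 hs1 in
-- In polar coordinates the Jacobian r^(n-1) leaves r^(1-2s) min(1, r^(-2)) on the half-line.
lemma integrable_radial :
    Integrable fun w : Rn n => ‖w‖ ^ 2 * min 1 (1 / ‖w‖ ^ 2) / ‖w‖ ^ ((n : ℝ) + 2 * s) := by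
  have h := (integrable_fun_norm_addHaar (volume : Measure (Rn n))
    (f := fun r : ℝ => r ^ 2 * min 1 (1 / r ^ 2) / r ^ ((n : ℝ) + 2 * s))).2
  refine h ?_
  refine (integrableOn_rpow_mul_min (p := 1 - 2 * s) (by linarith) (by linarith)).congr_fun
    (fun r hr => ?_) measurableSet_Ioi
  have hr : 0 < r := hr
  have hn : 1 ≤ n := NeZero.one_le
  simp only [finrank_euclideanSpace_fin, smul_eq_mul]
  have e : r ^ (1 - 2 * s) = r ^ (n - 1) * r ^ 2 / r ^ ((n : ℝ) + 2 * s) := by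
    rw [← pow_add, ← Real.rpow_natCast, ← Real.rpow_sub hr]
    congr 1
    push_cast [hn]
    ring
  rw [e]
  ring

omit [NeZero n] in
-- Combines 1 - cos θ ≤ θ²/2, which governs small w, with 1 - cos θ ≤ 2, which governs large w.
lemma kernel_le (ξ w : Rn n) : kernel s ξ w ≤
    (2 + ‖ξ‖ ^ 2) * (‖w‖ ^ 2 * min 1 (1 / ‖w‖ ^ 2) / ‖w‖ ^ ((n : ℝ) + 2 * s)) := by
  rw [kernel, ← mul_div_assoc]
  gcongr
  rcases eq_or_ne w 0 with rfl | hw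
  · simp
  have hw0 : 0 < ‖w‖ := norm_pos_iff.2 hw
  have e : ‖w‖ ^ 2 * min 1 (1 / ‖w‖ ^ 2) = min (‖w‖ ^ 2) 1 := by
    rw [mul_min_of_nonneg _ _ (by positivity), mul_one, mul_one_div_cancel (by positivity)]
  rw [e, mul_min_of_nonneg _ _ (by positivity), mul_one]
  refine le_min ?_ ?_
  · have h1 := Real.one_sub_sq_div_two_le_cos (x := inner ℝ w ξ)
    have h2 : (inner ℝ w ξ : ℝ) ^ 2 ≤ (‖w‖ * ‖ξ‖) ^ 2 := by
      rw [← sq_abs]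
      gcongr
      exact abs_real_inner_le_norm w ξ
    nlinarith [sq_nonneg ‖w‖, sq_nonneg (‖w‖ * ‖ξ‖)]
  · have := Real.neg_one_le_cos (inner ℝ w ξ)
    nlinarith [sq_nonneg ‖ξ‖]

include hs0 hs1 in
lemma integrable_kernel (ξ : Rn n) : Integrable (kernel s ξ) := by
  refine ((integrable_radial hs0 hs1).const_mul (2 + ‖ξ‖ ^ 2)).mono' ?_ (ae_of_all _ fun w => ?_)
  · exact (measurable_kernel.comp (measurable_id.prodMk measurable_const)).aestronglyMeasurable
  · rw [Real.norm_of_nonneg (kernel_nonneg ξ w)]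
    exact kernel_le ξ w

lemma inv_fracConst_eq :
    (fracConst n s)⁻¹ = ∫ w, kernel s (EuclideanSpace.single (0 : Fin n) 1) w := by
  rw [fracConst, inv_inv]
  simp [kernel, EuclideanSpace.inner_single_right]

include hs0 hs1 in
-- Ensures that the normalizing constant is the inverse of a genuine positive number rather than the
-- default value 0. The kernel is positive on a nonempty open set, which contains the first basis
-- vector because cos 1 < 1.
lemma inv_fracConst_pos : 0 < (fracConst n s)⁻¹ := by
  rw [inv_fracConst_eq, integral_pos_iff_support_of_nonneg (kernel_nonneg _)
    (integrable_kernel hs0 hs1 _)]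
  have hopen : IsOpen {w : Rn n | Real.cos (w 0) < 1} :=
    isOpen_lt (by fun_prop) continuous_const
  refine (hopen.measure_pos volume ⟨EuclideanSpace.single 0 1, ?_⟩).trans_le
    (measure_mono fun w hw => ?_)
  · have h1 : Real.cos 1 < 1 := lt_of_le_of_ne (Real.cos_le_one 1) fun h => one_ne_zero
      ((Real.cos_eq_one_iff_of_lt_of_lt (by linarith [Real.pi_gt_three])
        (by linarith [Real.pi_gt_three])).1 h)
    simpa using h1
  · have hw : Real.cos (w 0) < 1 := hw
    have hw0 : w ≠ 0 := by
      rintro rfl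
      simp at hw
    have : 0 < ‖w‖ := norm_pos_iff.2 hw0
    refine ne_of_gt (div_pos ?_ (by positivity))
    simpa [EuclideanSpace.inner_single_right] using hw

include hs0 in
-- Invariance under isometries reduces ξ to a multiple of the first basis vector, and the dilation w
-- ↦ ‖ξ‖w produces ‖ξ‖^(n+2s) from the denominator and ‖ξ‖^(-n) from the Jacobian.
lemma integral_kernel (ξ : Rn n) : ∫ w, kernel s ξ w = ‖ξ‖ ^ (2 * s) * (fracConst n s)⁻¹ := by
  rcases eq_or_ne ξ 0 with rfl | hξ
  · simp [kernel, Real.zero_rpow (by linarith : 2 * s ≠ 0)]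
  have hξ0 : 0 < ‖ξ‖ := norm_pos_iff.2 hξ
  set e : Rn n := EuclideanSpace.single (0 : Fin n) 1 with he
  -- The reflection in the hyperplane orthogonal to the difference of two unit vectors maps one to
  -- the other; if they coincide the span is zero and the reflection is the identity.
  set R := (Submodule.span ℝ {e - ‖ξ‖⁻¹ • ξ})ᗮ.reflection with hR
  have hRe : R e = ‖ξ‖⁻¹ • ξ := by
    refine Submodule.reflection_sub ?_
    rw [norm_smul, norm_inv, norm_norm, inv_mul_cancel₀ hξ0.ne', he]
    simp
  have h1 : ∫ w, kernel s ξ w = ∫ w, kernel s ξ (R w) :=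
    (R.measurePreserving.integral_comp R.toHomeomorph.measurableEmbedding _).symm
  have h2 : ∀ w, kernel s ξ (R w) = ‖ξ‖ ^ ((n : ℝ) + 2 * s) * kernel s e (‖ξ‖ • w) := by
    intro w
    have h3 : (inner ℝ (R w) ξ : ℝ) = inner ℝ (‖ξ‖ • w) e := by
      have : ξ = ‖ξ‖ • R e := by rw [hRe, smul_smul, mul_inv_cancel₀ hξ0.ne', one_smul]
      conv_lhs => rw [this]
      rw [inner_smul_right, R.inner_map_map, inner_smul_left]
      rfl
    rw [kernel, kernel, h3, R.norm_map, norm_smul, norm_norm,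
      Real.mul_rpow (norm_nonneg _) (norm_nonneg _)]
    have : ‖ξ‖ ^ ((n : ℝ) + 2 * s) ≠ 0 := by positivity
    field_simp
  rw [h1]
  simp_rw [h2]
  rw [integral_const_mul, Measure.integral_comp_smul, ← inv_fracConst_eq,
    finrank_euclideanSpace_fin, smul_eq_mul, ← mul_assoc, abs_of_pos (by positivity),
    Real.rpow_add hξ0, Real.rpow_natCast]
  congr 1
  field_simp

variable (u : 𝓢(Rn n, ℂ)) (x : Rn n)

omit [NeZero n] in
-- By Fourier inversion a translation by ±y multiplies û by exp(±i y·ξ), so the second difference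
-- multiplies it by 2(1 - cos(y·ξ)).
lemma fracIntegrand_eq (y : Rn n) : fracIntegrand s u x y = fc n • ∫ ξ,
    Complex.exp (Complex.I * ((inner ℝ x ξ : ℝ) : ℂ)) * hatS u ξ * ((2 * kernel s ξ y : ℝ) : ℂ) := by
  have hi : ∀ z : Rn n, Integrable fun ξ : Rn n =>
      Complex.exp (Complex.I * ((inner ℝ z ξ : ℝ) : ℂ)) * fourierT u ξ := fun z => by
    have : Integrable (fourierT u) := by
      have := (hatS u).integrable (μ := volume)
      exact this.congr (ae_of_all _ fun ξ => hatS_apply u ξ)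
    refine this.bdd_mul (c := 1) (Continuous.aestronglyMeasurable (by fun_prop))
      (ae_of_all _ fun ξ => ?_)
    rw [norm_exp_I_mul]
  rw [fracIntegrand, ← fourierTInv_fourierT u x, ← fourierTInv_fourierT u (x + y),
    ← fourierTInv_fourierT u (x - y)]
  simp only [fourierTInv]
  rw [← fc]
  rw [mul_smul_comm, ← smul_sub, ← smul_sub, ← integral_const_mul, ← integral_sub
    ((hi x).const_mul 2) (hi _), ← integral_sub ?_ (hi _), smul_div_assoc, ← integral_div]
  swap
  · exact ((hi x).const_mul 2).sub (hi (x + y))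
  congr 2
  ext ξ
  rw [hatS_apply, kernel, inner_add_left, inner_sub_left]
  push_cast
  rw [mul_add, mul_sub, Complex.exp_add, Complex.exp_sub, Complex.cos, mul_comm _ Complex.I,
    neg_mul, mul_comm _ Complex.I, Complex.exp_neg, div_eq_mul_inv (Complex.exp _)]
  ring

include hs0 hs1

/-- Integrating the absolute value in y first gives a multiple of |ξ|^(2s) |û|, which is integrable.
This justifies the exchange of integrals and also proves that the integral defining the fractional
Laplacian converges absolutely. -/
lemma integrable_fracKernel : Integrable (Function.uncurry fun y ξ : Rn n =>
    Complex.exp (Complex.I * ((inner ℝ x ξ : ℝ) : ℂ)) * hatS u ξ * ((2 * kernel s ξ y : ℝ) : ℂ))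
    (volume.prod volume) := by
  have hm : AEStronglyMeasurable (Function.uncurry fun y ξ : Rn n =>
      Complex.exp (Complex.I * ((inner ℝ x ξ : ℝ) : ℂ)) * hatS u ξ * ((2 * kernel s ξ y : ℝ) : ℂ))
      (volume.prod volume) := by
    have h1 := measurable_kernel (n := n) (s := s)
    have h2 := (hatS u).continuous.measurable
    refine Measurable.aestronglyMeasurable ?_
    simp only [Function.uncurry_def]
    fun_prop
  rw [integrable_prod_iff' hm]
  have hn : ∀ y ξ : Rn n, ‖Complex.exp (Complex.I * ((inner ℝ x ξ : ℝ) : ℂ)) * hatS u ξ *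
      ((2 * kernel s ξ y : ℝ) : ℂ)‖ = ‖hatS u ξ‖ * 2 * kernel s ξ y := fun y ξ => by
    rw [norm_mul, norm_mul, norm_exp_I_mul, one_mul, Complex.norm_real,
      Real.norm_of_nonneg (mul_nonneg zero_le_two (kernel_nonneg ξ y)), mul_assoc]
  refine ⟨ae_of_all _ fun ξ => ?_, ?_⟩
  · simp only [Function.uncurry_apply_pair]
    exact (((integrable_kernel hs0 hs1 ξ).const_mul 2).ofReal).const_mul _
  · simp only [Function.uncurry_apply_pair, hn, integral_const_mul, integral_kernel hs0]
    have := ((rapid_schwartz (hatS u)).integrable_rpow_mul (p := 2 * s) (by linarith)).mul_const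
      (2 * (fracConst n s)⁻¹)
    refine this.congr (ae_of_all _ fun ξ => ?_)
    simp only
    ring

theorem integrable_fracIntegrand : Integrable (fracIntegrand s u x) := by
  have := (integrable_fracKernel hs0 hs1 u x).integral_prod_left.smul (fc n)
  exact this.congr (ae_of_all _ fun y => (fracIntegrand_eq u x y).symm)

theorem fracLaplacian_eq : fracLaplacian s u x = fourierTInv (fluxMul s u) x := by
  have hpos := inv_fracConst_pos (n := n) hs0 hs1
  rw [fracLaplacian]
  simp_rw [fracIntegrand_eq]
  rw [integral_smul, integral_integral_swap (integrable_fracKernel hs0 hs1 u x), fourierTInv, ← fc,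
    smul_comm]
  congr 1
  rw [← integral_smul]
  congr 1
  ext ξ
  rw [integral_const_mul, integral_complex_ofReal, integral_const_mul, integral_kernel hs0, fluxMul,
    Complex.real_smul]
  have : fracConst n s ≠ 0 := fun h => by simp [h] at hpos
  have : (fracConst n s : ℂ) ≠ 0 := by exact_mod_cast this
  push_cast
  field_simp

omit [NeZero n] hs0 hs1 in
lemma superpos_zero (m : Rn n → ℂ) (k : ℝ → ℝ) :
    superpos m k (x, 0) = k 0 • fourierTInv m x := by
  rw [superpos, Complex.real_smul, ← fourierTInv_smul]
  simp only [mul_zero, mul_comm (m _)]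

/-- The superposition of `flux s` is continuous on the whole space, including y = 0, where the
argument of `flux s` is 0 and the constant `flux s 0` factors out. -/
theorem tendsto_flux_prof :
    Tendsto (fun y => -fluxY s (extension (prof s) u) (x, y)) (𝓝[>] 0)
      (𝓝 (flux s 0 • fracLaplacian s u x)) := by
  have hc := continuous_superpos (rapid_fluxMul hs0 u) (continuous_flux hs1) (abs_flux_le hs0 hs1)
  have h1 : Tendsto (fun y => superpos (fluxMul s u) (flux s) (x, y)) (𝓝[>] 0)
      (𝓝 (superpos (fluxMul s u) (flux s) (x, 0))) :=
    ((hc.comp (by fun_prop : Continuous fun y : ℝ => (x, y))).tendsto 0).mono_left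
      nhdsWithin_le_nhds
  rw [superpos_zero, ← fracLaplacian_eq hs0 hs1] at h1
  refine h1.congr' ?_
  filter_upwards [self_mem_nhdsWithin] with y hy
  rw [fluxY_extension hs0 hs1 u (mem_Ioi.1 hy), neg_neg]

omit x in
theorem distribTendsto_flux_prof :
    DistribTendsto (fun y x => -fluxY s (extension (prof s) u) (x, y))
      (fun x => flux s 0 • fracLaplacian s u x) := by
  have hc := continuous_superpos (rapid_fluxMul hs0 u) (continuous_flux hs1) (abs_flux_le hs0 hs1)
  have hcy : ∀ y > 0, Continuous fun x => -fluxY s (extension (prof s) u) (x, y) := fun y hy => by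
    have : (fun x => -fluxY s (extension (prof s) u) (x, y)) =
        fun x => superpos (fluxMul s u) (flux s) (x, y) := by
      ext x
      rw [fluxY_extension hs0 hs1 u hy, neg_neg]
    rw [this]
    exact hc.comp (by fun_prop)
  refine ⟨fun y hy => (hcy y hy).locallyIntegrable, ?_, fun φ hφ hφc => ?_⟩
  · simp_rw [fracLaplacian_eq hs0 hs1]
    exact ((continuous_fourierTInv (rapid_fluxMul hs0 u).integrable).const_smul
      (flux s 0)).locallyIntegrable
  · refine tendsto_integral_filter_of_dominated_convergence
      (fun x => ‖φ x‖ * (fc n * ∫ ξ, ‖fluxMul s u ξ‖ * flux s 0)) ?_ ?_ ?_ ?_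
    · filter_upwards [self_mem_nhdsWithin] with y hy
      exact (hφ.continuous.smul (hcy y hy)).aestronglyMeasurable
    · filter_upwards [self_mem_nhdsWithin] with y hy
      refine ae_of_all _ fun x => ?_
      rw [norm_smul, fluxY_extension hs0 hs1 u (mem_Ioi.1 hy), neg_neg]
      gcongr
      exact norm_superpos_le (rapid_fluxMul hs0 u) (abs_flux_le hs0 hs1) _
    · exact (hφ.continuous.integrable_of_hasCompactSupport hφc).norm.mul_const _
    · exact ae_of_all _ fun x => (tendsto_flux_prof hs0 hs1 u x).const_smul _

end FracLap

/-! ### Slices of weakly differentiable functions on the half-space -/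

section Slices

/-- The fundamental lemma of the calculus of variations applied to a ↦ ∫ H(a,b) db. The exceptional
set depends on H, hence on the test function used in the other variable; this is why only countable
families of test functions are used on slices. -/
lemma ae_integral_slice_eq_zero {A B F : Type*} [NormedAddCommGroup A] [NormedSpace ℝ A]
    [FiniteDimensional ℝ A] [MeasureSpace A] [BorelSpace A] [SigmaFinite (volume : Measure A)]
    [MeasureSpace B] [SigmaFinite (volume : Measure B)]
    [NormedAddCommGroup F] [NormedSpace ℝ F] [CompleteSpace F]
    {Ω : Set A} (hΩ : IsOpen Ω) {H : A × B → F}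
    (hH : ∀ K ⊆ Ω, IsCompact K → IntegrableOn H (K ×ˢ univ) (volume.prod volume))
    (h : ∀ χ : A → ℝ, ContDiff ℝ ∞ χ → HasCompactSupport χ → tsupport χ ⊆ Ω →
      ∫ z, χ z.1 • H z ∂(volume.prod volume) = 0) :
    ∀ᵐ a, a ∈ Ω → ∫ b, H (a, b) = 0 := by
  refine hΩ.ae_eq_zero_of_integral_contDiff_smul_eq_zero ?_ fun χ hχ hc hs => ?_
  · rw [locallyIntegrableOn_iff hΩ.isLocallyClosed]
    intro K hK hKc
    have := hH K hK hKc
    rw [IntegrableOn, ← Measure.prod_restrict, Measure.restrict_univ] at this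
    exact this.integral_prod_left
  · have hi : Integrable (fun z : A × B => χ z.1 • H z) (volume.prod volume) := by
      have h1 := hH _ hs hc
      obtain ⟨C, hC⟩ := hc.exists_bound_of_continuous hχ.continuous
      have h2 : IntegrableOn (fun z : A × B => χ z.1 • H z) (tsupport χ ×ˢ univ)
          (volume.prod volume) := by
        refine Integrable.bdd_smul (φ := fun z : A × B => χ z.1) h1 C ?_
          (ae_of_all _ fun z => hC z.1)
        exact (hχ.continuous.measurable.comp measurable_fst).aestronglyMeasurable
      rwa [integrableOn_iff_integrable_of_support_subset] at h2
      intro z hz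
      refine ⟨?_, mem_univ _⟩
      by_contra h0
      exact hz (by simp [image_eq_zero_of_notMem_tsupport h0])
    rw [← h χ hχ hc hs, integral_prod _ hi]
    simp_rw [integral_smul]

variable {n : ℕ}

lemma halfSpace_eq : halfSpace n = univ ×ˢ Ioi (0 : ℝ) := by
  ext X
  simp [halfSpace]

lemma volume_restrict_halfSpace : (volume : Measure (Rn n × ℝ)).restrict (halfSpace n) =
    (volume : Measure (Rn n)).prod (volume.restrict (Ioi (0 : ℝ))) := by
  rw [halfSpace_eq, Measure.volume_eq_prod, ← Measure.prod_restrict, Measure.restrict_univ]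

section Tensor

variable {χ : Rn n → ℝ} {ψ : ℝ → ℝ}

lemma tsupport_tensor_subset (χ : Rn n → ℝ) (ψ : ℝ → ℝ) :
    tsupport (fun X : Rn n × ℝ => χ X.1 * ψ X.2) ⊆ tsupport χ ×ˢ tsupport ψ := by
  refine closure_minimal (fun X hX => ⟨subset_tsupport _ ?_, subset_tsupport _ ?_⟩)
    ((isClosed_tsupport _).prod (isClosed_tsupport _))
  · exact left_ne_zero_of_mul hX
  · exact right_ne_zero_of_mul hX

lemma fderiv_tensor (hχ : ContDiff ℝ ∞ χ) (hψ : ContDiff ℝ ∞ ψ) (X v : Rn n × ℝ) :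
    fderiv ℝ (fun X : Rn n × ℝ => χ X.1 * ψ X.2) X v =
      fderiv ℝ χ X.1 v.1 * ψ X.2 + χ X.1 * (deriv ψ X.2 * v.2) := by
  have h1 : HasFDerivAt (fun X : Rn n × ℝ => χ X.1) _ X :=
    ((hχ.differentiable (by simp) X.1).hasFDerivAt).comp X (hasFDerivAt_fst (𝕜 := ℝ))
  have h2 : HasFDerivAt (fun X : Rn n × ℝ => ψ X.2) _ X :=
    ((hψ.differentiable (by simp) X.2).hasDerivAt.hasFDerivAt).comp X (hasFDerivAt_snd (𝕜 := ℝ))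
  refine (congrArg (· v) (h1.mul h2).fderiv).trans ?_
  simp
  ring

lemma HasWeakDeriv.tensor {v : Rn n × ℝ} {V D : Rn n × ℝ → ℂ}
    (h : HasWeakDeriv (halfSpace n) v V D) (hχ : ContDiff ℝ ∞ χ) (hχc : HasCompactSupport χ)
    (hψ : ContDiff ℝ ∞ ψ) (hψc : HasCompactSupport ψ) (hψs : tsupport ψ ⊆ Ioi 0) :
    ∫ X : Rn n × ℝ, ((fderiv ℝ χ X.1 v.1 * ψ X.2 + χ X.1 * (deriv ψ X.2 * v.2)) • V X +
      (χ X.1 * ψ X.2) • D X) ∂(volume.prod volume) = 0 := by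
  set φ : Rn n × ℝ → ℝ := fun X => χ X.1 * ψ X.2 with hφ
  have hφd : ContDiff ℝ ∞ φ := (hχ.comp contDiff_fst).mul (hψ.comp contDiff_snd)
  have hφc : HasCompactSupport φ := (hχc.isCompact.prod hψc.isCompact).of_isClosed_subset
    (isClosed_tsupport _) (tsupport_tensor_subset χ ψ)
  have hφs : tsupport φ ⊆ halfSpace n := fun X hX => hψs (tsupport_tensor_subset χ ψ hX).2
  have hs' := (tsupport_fderiv_apply_subset' φ v).trans hφs
  have hcont' : Continuous fun X => fderiv ℝ φ X v :=
    (hφd.continuous_fderiv (by simp)).clm_apply continuous_const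
  have h1 := h.2.2 φ hφd hφc hφs
  rw [setIntegral_smul_of_tsupport_subset V hs', setIntegral_smul_of_tsupport_subset D hφs] at h1
  have i1 := integrable_smul_of_tsupport_subset h.1 hcont'
    (hφc.of_isClosed_subset (isClosed_tsupport _) (tsupport_fderiv_apply_subset' φ v)) hs'
  have i2 := integrable_smul_of_tsupport_subset h.2.1 hφd.continuous hφc hφs
  rw [← Measure.volume_eq_prod]
  simp_rw [← fderiv_tensor hχ hψ]
  rw [integral_add i1 i2, h1, neg_add_cancel]

end Tensor

lemma integrableOn_smul_slab {V : Rn n × ℝ → ℂ} (hV : LocallyIntegrableOn V (halfSpace n))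
    {ψ : ℝ → ℝ} (hψ : Continuous ψ) (hψc : HasCompactSupport ψ) (hψs : tsupport ψ ⊆ Ioi 0)
    {K : Set (Rn n)} (hK : IsCompact K) :
    IntegrableOn (fun X => ψ X.2 • V X) (K ×ˢ univ) (volume.prod volume) := by
  have h1 : IntegrableOn V (K ×ˢ tsupport ψ) :=
    hV.integrableOn_compact_subset (fun X hX => hψs hX.2) (hK.prod hψc.isCompact)
  have h2 : IntegrableOn (fun X : Rn n × ℝ => ψ X.2 • V X) (K ×ˢ tsupport ψ) :=
    h1.continuousOn_smul (hψ.comp continuous_snd).continuousOn (hK.prod hψc.isCompact)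
  refine h2.of_forall_sdiff_eq_zero (hK.measurableSet.prod MeasurableSet.univ) fun X hX => ?_
  rw [image_eq_zero_of_notMem_tsupport fun h0 => hX.2 ⟨hX.1.1, h0⟩, zero_smul]

lemma integrableOn_smul_slab_swap {V : Rn n × ℝ → ℂ} (hV : LocallyIntegrableOn V (halfSpace n))
    {χ : Rn n → ℝ} (hχ : Continuous χ) (hχc : HasCompactSupport χ)
    {K : Set ℝ} (hK : IsCompact K) (hKs : K ⊆ Ioi 0) :
    IntegrableOn (fun p : ℝ × Rn n => χ p.2 • V (p.2, p.1)) (K ×ˢ univ) (volume.prod volume) := by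
  have h1 : IntegrableOn V (tsupport χ ×ˢ K) (volume.prod volume) :=
    hV.integrableOn_compact_subset (fun X hX => hKs hX.2) (hχc.isCompact.prod hK)
  have h2 : IntegrableOn (fun X : Rn n × ℝ => χ X.1 • V X) (tsupport χ ×ˢ K)
      (volume.prod volume) :=
    h1.continuousOn_smul (hχ.comp continuous_fst).continuousOn (hχc.isCompact.prod hK)
  have h3 : IntegrableOn (fun X : Rn n × ℝ => χ X.1 • V X) (univ ×ˢ K) (volume.prod volume) := by
    refine h2.of_forall_sdiff_eq_zero (MeasurableSet.univ.prod hK.measurableSet) fun X hX => ?_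
    rw [image_eq_zero_of_notMem_tsupport fun h0 => hX.2 ⟨h0, hX.1.2⟩, zero_smul]
  rw [IntegrableOn, ← Measure.prod_restrict] at h3 ⊢
  exact h3.swap

/-- For almost every `x`, the slice `V (x, ·)` satisfies the weak formulation for a given test
function. -/
lemma HasWeakDeriv.ae_slice_y {V D : Rn n × ℝ → ℂ}
    (h : HasWeakDeriv (halfSpace n) (dirY n) V D) {ψ : ℝ → ℝ}
    (hψ : ContDiff ℝ ∞ ψ) (hψc : HasCompactSupport ψ) (hψs : tsupport ψ ⊆ Ioi 0) :
    ∀ᵐ x, ∫ y, (deriv ψ y • V (x, y) + ψ y • D (x, y)) = 0 := by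
  have hd : Continuous (deriv ψ) := hψ.continuous_deriv (by simp)
  have hsub : tsupport (deriv ψ) ⊆ tsupport ψ :=
    closure_minimal support_deriv_subset (isClosed_tsupport _)
  have := ae_integral_slice_eq_zero (A := Rn n) (B := ℝ) isOpen_univ
    (H := fun X : Rn n × ℝ => deriv ψ X.2 • V X + ψ X.2 • D X)
    (fun K _ hK => (integrableOn_smul_slab h.1 hd
      (hψc.of_isClosed_subset (isClosed_tsupport _) hsub) (hsub.trans hψs) hK).add
      (integrableOn_smul_slab h.2.1 hψ.continuous hψc hψs hK)) fun χ hχ hχc _ => by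
    rw [← h.tensor hχ hχc hψ hψc hψs]
    refine integral_congr_ae (ae_of_all _ fun X => ?_)
    simp [dirY, mul_assoc]
  filter_upwards [this] with x hx using hx (mem_univ x)

/-- For almost every `y > 0`, the slice `V (·, y)` satisfies the weak formulation for a given test
function. -/
lemma HasWeakDeriv.ae_slice_x {v : Rn n} {V D : Rn n × ℝ → ℂ}
    (h : HasWeakDeriv (halfSpace n) (v, 0) V D) {χ : Rn n → ℝ}
    (hχ : ContDiff ℝ ∞ χ) (hχc : HasCompactSupport χ) :
    ∀ᵐ y : ℝ, y ∈ Ioi (0 : ℝ) → ∫ x, (fderiv ℝ χ x v • V (x, y) + χ x • D (x, y)) = 0 := by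
  have hd : Continuous fun x => fderiv ℝ χ x v :=
    (hχ.continuous_fderiv (by simp)).clm_apply continuous_const
  have hdc : HasCompactSupport fun x => fderiv ℝ χ x v :=
    hχc.of_isClosed_subset (isClosed_tsupport _) (tsupport_fderiv_apply_subset' χ v)
  refine ae_integral_slice_eq_zero (A := ℝ) (B := Rn n) isOpen_Ioi
    (H := fun p : ℝ × Rn n => fderiv ℝ χ p.2 v • V (p.2, p.1) + χ p.2 • D (p.2, p.1))
    (fun K hKs hK => (integrableOn_smul_slab_swap h.1 hd hdc hK hKs).add
      (integrableOn_smul_slab_swap h.2.1 hχ.continuous hχc hK hKs)) fun ψ hψ hψc hψs => ?_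
  rw [← h.tensor hχ hχc hψ hψc hψs, ← integral_prod_swap]
  refine integral_congr_ae (ae_of_all _ fun X => ?_)
  simp [mul_comm, mul_left_comm]

/-- Local integrability gives integrability only on compact sets, so Fubini is applied on the
products of the ball of radius N with [1/(N+1), N]; given x and a compact subset of (0,∞), some N
covers both. -/
lemma ae_slice_locallyIntegrableOn {D : Rn n × ℝ → ℂ} (h : LocallyIntegrableOn D (halfSpace n)) :
    ∀ᵐ x, LocallyIntegrableOn (fun y => D (x, y)) (Ioi 0) := by
  have h1 : ∀ N : ℕ, ∀ᵐ x ∂(volume : Measure (Rn n)), x ∈ Metric.closedBall (0 : Rn n) N →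
      IntegrableOn (fun y => D (x, y)) (Icc (1 / ((N : ℝ) + 1)) N) := by
    intro N
    have hK : IntegrableOn D (Metric.closedBall (0 : Rn n) N ×ˢ Icc (1 / ((N : ℝ) + 1)) N)
        (volume.prod volume) := by
      refine h.integrableOn_compact_subset (fun X hX => ?_)
        ((isCompact_closedBall _ _).prod isCompact_Icc)
      exact lt_of_lt_of_le (by positivity) hX.2.1
    rw [IntegrableOn, ← Measure.prod_restrict] at hK
    have := hK.prod_right_ae
    rwa [ae_restrict_iff' Metric.isClosed_closedBall.measurableSet] at this
  filter_upwards [ae_all_iff.2 h1] with x hx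
  rw [locallyIntegrableOn_iff isOpen_Ioi.isLocallyClosed]
  intro K hK hKc
  rcases K.eq_empty_or_nonempty with rfl | hne
  · simp
  obtain ⟨a, ha, hamin⟩ := hKc.exists_isLeast hne
  obtain ⟨b, hb, hbmax⟩ := hKc.exists_isGreatest hne
  have ha0 : 0 < a := hK ha
  obtain ⟨N₁, hN₁⟩ := exists_nat_gt (max (max ‖x‖ b) (1 / a))
  have hxN : ‖x‖ < N₁ := lt_of_le_of_lt ((le_max_left _ _).trans (le_max_left _ _)) hN₁
  have hbN : b < N₁ := lt_of_le_of_lt ((le_max_right _ _).trans (le_max_left _ _)) hN₁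
  have haN : 1 / a < N₁ := lt_of_le_of_lt (le_max_right _ _) hN₁
  refine (hx N₁ (by simpa using hxN.le)).mono_set fun y hy => ⟨?_, (hbmax hy).trans hbN.le⟩
  refine le_trans ?_ (hamin hy)
  rw [div_le_iff₀ (by positivity)]
  rw [div_lt_iff₀ ha0] at haN
  nlinarith

/-- Almost every slice in the `y`-direction is recovered from the weak derivative. -/
lemma HasWeakDeriv.ae_sub_eq_integral {V D : Rn n × ℝ → ℂ}
    (h : HasWeakDeriv (halfSpace n) (dirY n) V D)
    (hc : ∀ x, ContinuousOn (fun y => V (x, y)) (Ioi 0)) :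
    ∀ᵐ x, ∀ b c : ℝ, 0 < b → b ≤ c → V (x, c) - V (x, b) = ∫ t in b..c, D (x, t) := by
  have h1 : ∀ᵐ x ∂(volume : Measure (Rn n)), ∀ (b c : ℚ) (k : ℕ), 0 < b → b ≤ c →
      ∫ y, (deriv (stepDiff k b c) y • V (x, y) + stepDiff k b c y • D (x, y)) = 0 := by
    simp only [ae_all_iff]
    intro b c k hb hbc
    have hbc' : (b : ℝ) ≤ c := by exact_mod_cast hbc
    have hb' : (0 : ℝ) < b := by exact_mod_cast hb
    exact h.ae_slice_y (contDiff_stepDiff k b c) (hasCompactSupport_stepDiff hbc')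
      ((tsupport_stepDiff hbc').trans fun t ht => hb'.trans_le ht.1)
  filter_upwards [h1, ae_slice_locallyIntegrableOn h.2.1] with x hx hD b c hb hbc
  refine sub_eq_integral_of_stepDiff_rat (v := fun y => V (x, y)) (D := fun y => D (x, y)) (hc x) hD
    (fun b c k hb hbc => ?_) hb hbc
  have hbc' : (b : ℝ) ≤ c := by exact_mod_cast hbc
  have hb' : (0 : ℝ) < b := by exact_mod_cast hb
  have hs : tsupport (stepDiff k (b : ℝ) c) ⊆ Ioi 0 :=
    (tsupport_stepDiff hbc').trans fun t ht => hb'.trans_le ht.1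
  have hsub : tsupport (deriv (stepDiff k b c)) ⊆ tsupport (stepDiff k b c) :=
    closure_minimal support_deriv_subset (isClosed_tsupport _)
  have hVl : LocallyIntegrableOn (fun y => V (x, y)) (Ioi 0) :=
    (hc x).locallyIntegrableOn measurableSet_Ioi
  rw [setIntegral_smul_of_tsupport_subset _ (hsub.trans hs),
    setIntegral_smul_of_tsupport_subset _ hs,
    ← add_eq_zero_iff_eq_neg, ← integral_add]
  · exact hx b c k hb hbc
  · exact integrable_smul_of_tsupport_subset hVl
      ((contDiff_stepDiff k b c).continuous_deriv (by simp))
      ((hasCompactSupport_stepDiff hbc').of_isClosed_subset (isClosed_tsupport _) hsub)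
      (hsub.trans hs)
  · exact integrable_smul_of_tsupport_subset hD (contDiff_stepDiff k b c).continuous
      (hasCompactSupport_stepDiff hbc') hs

end Slices

/-! ### The energy of the extension -/

section Energy

open scoped SchwartzMap

variable {n : ℕ} {s : ℝ}

/-- Lebesgue measure on the half-space. -/
abbrev halfMeasure (n : ℕ) : Measure (Rn n × ℝ) :=
  (volume : Measure (Rn n)).prod (volume.restrict (Ioi (0 : ℝ)))

lemma restrict_halfSpace : volume.restrict (halfSpace n) = halfMeasure n :=
  volume_restrict_halfSpace

/-- The weighted square integral `∫ y^{1-2s} |f|²` over the half-space. -/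
def wSq (s : ℝ) (f : Rn n × ℝ → ℂ) : ENNReal :=
  ∫⁻ X, ENNReal.ofReal (X.2 ^ (1 - 2 * s)) * ‖f X‖ₑ ^ 2 ∂halfMeasure n

lemma ae_halfMeasure : ∀ᵐ X ∂halfMeasure n, 0 < X.2 := by
  rw [← restrict_halfSpace]
  exact ae_restrict_mem isOpen_halfSpace.measurableSet

lemma measurable_weight : Measurable fun X : Rn n × ℝ => ENNReal.ofReal (X.2 ^ (1 - 2 * s)) := by
  fun_prop

lemma aemeasurable_wSq {f : Rn n × ℝ → ℂ} (hf : AEStronglyMeasurable f (halfMeasure n)) :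
    AEMeasurable (fun X => ENNReal.ofReal (X.2 ^ (1 - 2 * s)) * ‖f X‖ₑ ^ 2) (halfMeasure n) :=
  measurable_weight.aemeasurable.mul (hf.enorm.pow_const 2)

lemma ofReal_weight_mul {w : ℝ} (hw : 0 ≤ w) (z : ℂ) :
    ENNReal.ofReal (w * ‖z‖ ^ 2) = ENNReal.ofReal w * ‖z‖ₑ ^ 2 := by
  rw [ENNReal.ofReal_mul hw, ENNReal.ofReal_pow (norm_nonneg _), ofReal_norm]

/-- The energy in terms of any choice of weak derivatives. -/
lemma energy_eq_sum {V DY : Rn n × ℝ → ℂ} {D : Fin n → Rn n × ℝ → ℂ}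
    (hD : ∀ i, HasWeakDeriv (halfSpace n) (dirX i) V (D i))
    (hDY : HasWeakDeriv (halfSpace n) (dirY n) V DY) :
    energy s V = ∑ i, wSq s (D i) + wSq s DY := by
  have hm : ∀ i, AEStronglyMeasurable (D i) (halfMeasure n) := fun i => by
    rw [← restrict_halfSpace]; exact (hD i).2.1.aestronglyMeasurable
  have e : ∀ i, weakDeriv (halfSpace n) (dirX i) V =ᵐ[halfMeasure n] D i := fun i => by
    rw [← restrict_halfSpace]
    exact (hasWeakDeriv_weakDeriv ⟨_, hD i⟩).ae_eq isOpen_halfSpace (hD i)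
  have eY : weakDeriv (halfSpace n) (dirY n) V =ᵐ[halfMeasure n] DY := by
    rw [← restrict_halfSpace]
    exact (hasWeakDeriv_weakDeriv ⟨_, hDY⟩).ae_eq isOpen_halfSpace hDY
  simp only [wSq]
  rw [energy, restrict_halfSpace, ← lintegral_finsetSum' _ fun i _ => aemeasurable_wSq (hm i),
    ← lintegral_add_left' (Finset.aemeasurable_fun_sum _ fun i _ => aemeasurable_wSq (hm i))]
  refine lintegral_congr_ae ?_
  filter_upwards [ae_all_iff.2 e, eY, ae_halfMeasure] with X hX hXY hX0
  have hw : 0 ≤ X.2 ^ (1 - 2 * s) := by positivity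
  simp only [hX, hXY, mul_add, Finset.mul_sum]
  rw [ENNReal.ofReal_add (Finset.sum_nonneg fun i _ => by positivity) (by positivity),
    ENNReal.ofReal_sum_of_nonneg fun i _ => by positivity]
  simp only [ofReal_weight_mul hw]

lemma continuousOn_partialY {m : Rn n → ℂ} (hs0 : 0 < s) (hs1 : s < 1) (hm : Rapid m) :
    ContinuousOn (fun X => -(X.2 ^ (2 * s - 1)) • superpos m (flux s) X) (halfSpace n) := by
  have h : ContinuousOn (fun X : Rn n × ℝ => -(X.2 ^ (2 * s - 1))) (halfSpace n) :=
    (continuous_snd.continuousOn.rpow_const fun X hX => Or.inl (ne_of_gt hX)).neg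
  exact h.smul (continuous_superpos hm (continuous_flux hs1) (abs_flux_le hs0 hs1)).continuousOn

lemma HasWeakDeriv.congr_right {E : Type*} [NormedAddCommGroup E] [NormedSpace ℝ E]
    [MeasureSpace E] {Ω : Set E} (hΩ : MeasurableSet Ω) {v : E} {V D D' : E → ℂ}
    (h : HasWeakDeriv Ω v V D) (e : EqOn D D' Ω) (h' : LocallyIntegrableOn D' Ω) :
    HasWeakDeriv Ω v V D' := by
  refine ⟨h.1, h', fun φ hφ hc hs => ?_⟩
  rw [h.2.2 φ hφ hc hs]
  congr 1
  exact setIntegral_congr_fun hΩ fun x hx => by simp only [e hx]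

variable (hs0 : 0 < s) (hs1 : s < 1) (u : 𝓢(Rn n, ℂ))
include hs0 hs1

lemma hasWeakDeriv_extension_dirX (i : Fin n) : HasWeakDeriv (halfSpace n) (dirX i)
    (extension (prof s) u) (superpos (gradMul i u) (prof s)) := by
  have hc : Continuous (superpos (gradMul i u) (prof s)) :=
    continuous_superpos (rapid_gradMul u i) (continuous_prof hs0) (abs_prof_le hs0)
  refine (hasWeakDeriv_of_differentiableAt isOpen_halfSpace
    (fun X hX => (solvesExtension_prof hs0 hs1 u X hX).1) ?_).congr_right
    isOpen_halfSpace.measurableSet (fun X hX => partialX_extension hs0 hs1 u i hX)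
    (hc.locallyIntegrable.locallyIntegrableOn _)
  exact hc.continuousOn.congr fun X hX => partialX_extension hs0 hs1 u i hX

lemma hasWeakDeriv_extension_dirY : HasWeakDeriv (halfSpace n) (dirY n)
    (extension (prof s) u)
    (fun X => -(X.2 ^ (2 * s - 1)) • superpos (fluxMul s u) (flux s) X) := by
  have hc := continuousOn_partialY hs0 hs1 (rapid_fluxMul hs0 u)
  refine (hasWeakDeriv_of_differentiableAt isOpen_halfSpace
    (fun X hX => (solvesExtension_prof hs0 hs1 u X hX).1) ?_).congr_right
    isOpen_halfSpace.measurableSet (fun X hX => partialY_extension hs0 hs1 u hX)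
    (hc.locallyIntegrableOn isOpen_halfSpace.measurableSet)
  exact hc.congr fun X hX => partialY_extension hs0 hs1 u hX

/-- The one-dimensional energy after the scaling `t = r y`. -/
lemma lintegral_scaled_energy {r : ℝ} (hr : 0 ≤ r) :
    ∫⁻ y in Ioi (0 : ℝ), ENNReal.ofReal (y ^ (1 - 2 * s) *
      ((r * prof s (r * y)) ^ 2 + (y ^ (2 * s - 1) * (r ^ (2 * s) * flux s (r * y))) ^ 2)) =
      ENNReal.ofReal (flux s 0 * r ^ (2 * s)) := by
  rcases hr.eq_or_lt with rfl | hr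
  · simp [Real.zero_rpow (by linarith : 2 * s ≠ 0)]
  obtain ⟨h1, h2⟩ := prof_energy hs0 hs1
  set F : ℝ → ℝ := fun t => t ^ (1 - 2 * s) * (prof s t ^ 2 + (t ^ (2 * s - 1) * flux s t) ^ 2)
    with hF
  -- The integrand is r^(2s+1) times the energy density of the profile at ry; the substitution t =
  -- ry removes one power of r.
  have e : ∀ y ∈ Ioi (0 : ℝ), y ^ (1 - 2 * s) *
      ((r * prof s (r * y)) ^ 2 + (y ^ (2 * s - 1) * (r ^ (2 * s) * flux s (r * y))) ^ 2) =
      r ^ (2 * s + 1) * F (r * y) := by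
    intro y hy
    have hy : 0 < y := hy
    have e1 : r ^ (2 * s) = r ^ (2 * s - 1) * r := by
      rw [← Real.rpow_add_one hr.ne']; ring_nf
    have e2 : r ^ (2 * s + 1) = r ^ (2 * s - 1) * r * r := by
      rw [← Real.rpow_add_one hr.ne', ← Real.rpow_add_one hr.ne']; ring_nf
    have e3 : r ^ (2 * s - 1) * r ^ (1 - 2 * s) = 1 := by
      rw [← Real.rpow_add hr]; ring_nf; simp
    simp only [hF]
    rw [e1, e2, Real.mul_rpow hr.le hy.le, Real.mul_rpow hr.le hy.le]
    linear_combination (-(y ^ (1 - 2 * s) * r ^ 2 * (prof s (r * y) ^ 2 +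
      (r ^ (2 * s - 1) * y ^ (2 * s - 1) * flux s (r * y)) ^ 2))) * e3
  rw [setLIntegral_congr_fun measurableSet_Ioi fun y hy => by rw [e y hy],
    ← ofReal_integral_eq_lintegral_ofReal, integral_const_mul, integral_comp_mul_left_Ioi F 0 hr,
    mul_zero, h2]
  · congr 1
    rw [smul_eq_mul, Real.rpow_add_one hr.ne']
    field_simp
  · refine Integrable.const_mul ?_ _
    exact (integrableOn_Ioi_comp_mul_left_iff F 0 hr).2 (by simpa using h1)
  · filter_upwards [ae_restrict_mem measurableSet_Ioi] with y hy
    have hy : 0 < y := hy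
    simp only [hF, Pi.zero_apply]
    positivity

omit hs1 in
lemma aestronglyMeasurable_superpos_prof {m : Rn n → ℂ} (hm : Rapid m) :
    AEStronglyMeasurable (superpos m (prof s)) (halfMeasure n) :=
  (continuous_superpos hm (continuous_prof hs0) (abs_prof_le hs0)).aestronglyMeasurable

/-- Plancherel in x at each height and Tonelli reduce the energy to a y-integral for each frequency.
Since Σ ξ_i² = |ξ|², that integral is the one-dimensional energy scaled by |ξ|. Every quantity is an
extended nonnegative integral, so no integrability is needed. -/
theorem energy_extension_prof : energy s (extension (prof s) u) =
    ENNReal.ofReal (flux s 0) * seminormGSq s (fourierT (u : Rn n → ℂ)) := by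
  rw [energy_eq_sum (hasWeakDeriv_extension_dirX hs0 hs1 u) (hasWeakDeriv_extension_dirY hs0 hs1 u)]
  have hmX : ∀ i, AEStronglyMeasurable (superpos (gradMul i u) (prof s)) (halfMeasure n) :=
    fun i => aestronglyMeasurable_superpos_prof hs0 (rapid_gradMul u i)
  have hmY : AEStronglyMeasurable
      (fun X => -(X.2 ^ (2 * s - 1)) • superpos (fluxMul s u) (flux s) X) (halfMeasure n) := by
    rw [← restrict_halfSpace]
    exact (continuousOn_partialY hs0 hs1 (rapid_fluxMul hs0 u)).aestronglyMeasurable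
      isOpen_halfSpace.measurableSet
  have hX : ∀ i, wSq s (superpos (gradMul i u) (prof s)) = ∫⁻ y in Ioi (0 : ℝ), ∫⁻ ξ : Rn n,
      ENNReal.ofReal (y ^ (1 - 2 * s) * (ξ i * prof s (‖ξ‖ * y)) ^ 2) * ‖hatS u ξ‖ₑ ^ 2 := by
    intro i
    rw [wSq, lintegral_prod_symm _ (aemeasurable_wSq (hmX i))]
    refine setLIntegral_congr_fun measurableSet_Ioi fun y hy => ?_
    have hy : 0 < y := hy
    have hr := (rapid_gradMul u i).mul_profile (continuous_prof hs0) (abs_prof_le hs0) y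
    simp only
    rw [lintegral_const_mul' _ _ ENNReal.ofReal_ne_top]
    simp only [superpos]
    rw [lintegral_fourierTInv_sq hr.integrable hr.memLp_two,
      ← lintegral_const_mul' _ _ ENNReal.ofReal_ne_top]
    refine lintegral_congr fun ξ => ?_
    rw [← ofReal_weight_mul (by positivity), ← ofReal_weight_mul (by positivity)]
    congr 1
    simp only [gradMul, norm_mul, Complex.norm_I, Complex.norm_real, mul_pow, Real.norm_eq_abs,
      sq_abs]
    ring
  have hY : wSq s (fun X => -(X.2 ^ (2 * s - 1)) • superpos (fluxMul s u) (flux s) X) =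
      ∫⁻ y in Ioi (0 : ℝ), ∫⁻ ξ : Rn n, ENNReal.ofReal (y ^ (1 - 2 * s) *
        (y ^ (2 * s - 1) * (‖ξ‖ ^ (2 * s) * flux s (‖ξ‖ * y))) ^ 2) * ‖hatS u ξ‖ₑ ^ 2 := by
    rw [wSq, lintegral_prod_symm _ (aemeasurable_wSq hmY)]
    refine setLIntegral_congr_fun measurableSet_Ioi fun y hy => ?_
    have hy : 0 < y := hy
    have hr := (rapid_fluxMul hs0 u).mul_profile (continuous_flux hs1) (abs_flux_le hs0 hs1) y
    have e : ∀ z : ℂ, ENNReal.ofReal (y ^ (1 - 2 * s)) * ‖-(y ^ (2 * s - 1)) • z‖ₑ ^ 2 =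
        ENNReal.ofReal (y ^ (1 - 2 * s) * (y ^ (2 * s - 1)) ^ 2) * ‖z‖ₑ ^ 2 := by
      intro z
      rw [← ofReal_weight_mul (by positivity), ← ofReal_weight_mul (by positivity), norm_smul,
        norm_neg, Real.norm_of_nonneg (by positivity)]
      ring_nf
    simp only [e]
    rw [lintegral_const_mul' _ _ ENNReal.ofReal_ne_top]
    simp only [superpos]
    rw [lintegral_fourierTInv_sq hr.integrable hr.memLp_two,
      ← lintegral_const_mul' _ _ ENNReal.ofReal_ne_top]
    refine lintegral_congr fun ξ => ?_
    rw [← ofReal_weight_mul (by positivity), ← ofReal_weight_mul (by positivity)]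
    congr 1
    simp only [fluxMul, norm_mul, Complex.norm_real, mul_pow, Real.norm_eq_abs, sq_abs]
    ring
  have hcp := (continuous_prof hs0).measurable
  have hcf := (continuous_flux hs1).measurable
  have hcu := (hatS u).continuous.measurable
  have mX : ∀ i, Measurable fun p : ℝ × Rn n => ENNReal.ofReal (p.1 ^ (1 - 2 * s) *
      (p.2 i * prof s (‖p.2‖ * p.1)) ^ 2) * ‖hatS u p.2‖ₑ ^ 2 := by
    intro i
    fun_prop
  have mY : Measurable fun p : ℝ × Rn n => ENNReal.ofReal (p.1 ^ (1 - 2 * s) *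
        (p.1 ^ (2 * s - 1) * (‖p.2‖ ^ (2 * s) * flux s (‖p.2‖ * p.1))) ^ 2) * ‖hatS u p.2‖ₑ ^ 2 := by
    fun_prop
  have mX' : ∀ i, Measurable fun ξ : Rn n => ∫⁻ y in Ioi (0 : ℝ), ENNReal.ofReal (y ^ (1 - 2 * s) *
      (ξ i * prof s (‖ξ‖ * y)) ^ 2) * ‖hatS u ξ‖ₑ ^ 2 :=
    fun i => Measurable.lintegral_prod_right' ((mX i).comp measurable_swap)
  have mY' : Measurable fun ξ : Rn n => ∫⁻ y in Ioi (0 : ℝ), ENNReal.ofReal (y ^ (1 - 2 * s) *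
        (y ^ (2 * s - 1) * (‖ξ‖ ^ (2 * s) * flux s (‖ξ‖ * y))) ^ 2) * ‖hatS u ξ‖ₑ ^ 2 :=
    Measurable.lintegral_prod_right' (mY.comp measurable_swap)
  simp only [hX]
  rw [hY]
  have hX' : ∀ i, ∫⁻ y in Ioi (0 : ℝ), ∫⁻ ξ : Rn n,
      ENNReal.ofReal (y ^ (1 - 2 * s) * (ξ i * prof s (‖ξ‖ * y)) ^ 2) * ‖hatS u ξ‖ₑ ^ 2 =
      ∫⁻ ξ : Rn n, ∫⁻ y in Ioi (0 : ℝ),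
      ENNReal.ofReal (y ^ (1 - 2 * s) * (ξ i * prof s (‖ξ‖ * y)) ^ 2) * ‖hatS u ξ‖ₑ ^ 2 :=
    fun i => lintegral_lintegral_swap (mX i).aemeasurable
  simp only [hX']
  rw [lintegral_lintegral_swap mY.aemeasurable,
    ← lintegral_finsetSum _ fun i _ => mX' i, ← lintegral_add_right _ mY',
    seminormGSq, ← lintegral_const_mul' _ _ ENNReal.ofReal_ne_top]
  refine lintegral_congr fun ξ => ?_
  have m1 : ∀ i, Measurable fun y : ℝ => ENNReal.ofReal (y ^ (1 - 2 * s) *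
      (ξ i * prof s (‖ξ‖ * y)) ^ 2) * ‖hatS u ξ‖ₑ ^ 2 :=
    fun i => (mX i).comp measurable_prodMk_right
  rw [← lintegral_finsetSum _ fun i _ => m1 i,
    ← lintegral_add_left (Finset.measurable_fun_sum _ fun i _ => m1 i)]
  simp only [← Finset.sum_mul, ← add_mul]
  rw [lintegral_mul_const' _ _ (by simp)]
  have e : ∀ y ∈ Ioi (0 : ℝ), (∑ i, ENNReal.ofReal (y ^ (1 - 2 * s) *
      (ξ i * prof s (‖ξ‖ * y)) ^ 2)) + ENNReal.ofReal (y ^ (1 - 2 * s) *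
        (y ^ (2 * s - 1) * (‖ξ‖ ^ (2 * s) * flux s (‖ξ‖ * y))) ^ 2) =
      ENNReal.ofReal (y ^ (1 - 2 * s) * ((‖ξ‖ * prof s (‖ξ‖ * y)) ^ 2 +
        (y ^ (2 * s - 1) * (‖ξ‖ ^ (2 * s) * flux s (‖ξ‖ * y))) ^ 2)) := by
    intro y hy
    have hy : 0 < y := hy
    rw [← ENNReal.ofReal_sum_of_nonneg fun i _ => by positivity,
      ← ENNReal.ofReal_add (Finset.sum_nonneg fun i _ => by positivity) (by positivity), mul_add,
      mul_pow ‖ξ‖, EuclideanSpace.norm_sq_eq]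
    simp only [mul_pow, Real.norm_eq_abs, sq_abs, Finset.mul_sum, Finset.sum_mul]
  rw [setLIntegral_congr_fun measurableSet_Ioi e, lintegral_scaled_energy hs0 hs1 (norm_nonneg ξ),
    hatS_apply, ENNReal.ofReal_mul (flux_nonneg hs0 0), mul_assoc,
    ofReal_weight_mul (by positivity)]

omit hs1 in
lemma seminormGSq_ne_top : seminormGSq s (fourierT (u : Rn n → ℂ)) ≠ ⊤ := by
  have h := ((rapid_schwartz (hatS u)).norm_rpow_mul hs0.le).memLp_two
  have h2 := ((memLp_two_iff_integrable_sq_norm h.1).1 h).2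
  refine ne_top_of_le_ne_top h2.ne (lintegral_mono fun ξ => ?_)
  simp only
  rw [Real.enorm_of_nonneg (by positivity), norm_mul, Complex.norm_real,
    Real.norm_of_nonneg (by positivity), mul_pow, mul_comm 2 s, Real.rpow_mul (norm_nonneg _),
    Real.rpow_two, hatS_apply]

lemma energy_extension_prof_ne_top : energy s (extension (prof s) u) ≠ ⊤ := by
  rw [energy_extension_prof hs0 hs1]
  exact ENNReal.mul_ne_top ENNReal.ofReal_ne_top (seminormGSq_ne_top hs0 u)

end Energy

/-! ### Integration by parts on horizontal slices -/

section HorizontalSlices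

open scoped ComplexConjugate

variable {n : ℕ}

/-- Smooth cut-off functions exhausting `ℝⁿ`. -/
def cutoff (n k : ℕ) (x : Rn n) : ℝ :=
  (⟨1, 2, one_pos, one_lt_two⟩ : ContDiffBump (0 : Rn n)) (((k : ℝ) + 1)⁻¹ • x)

lemma contDiff_cutoff (k : ℕ) : ContDiff ℝ ∞ (cutoff n k) :=
  (ContDiffBump.contDiff _).comp (contDiff_const_smul _)

lemma hasCompactSupport_cutoff (k : ℕ) : HasCompactSupport (cutoff n k) :=
  (ContDiffBump.hasCompactSupport _).comp_smul (by positivity)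

lemma abs_cutoff_le (k : ℕ) (x : Rn n) : |cutoff n k x| ≤ 1 := by
  rw [cutoff, abs_of_nonneg (ContDiffBump.nonneg _)]
  exact ContDiffBump.le_one _

lemma tendsto_inv_smul (x : Rn n) :
    Tendsto (fun k : ℕ => ((k : ℝ) + 1)⁻¹ • x) atTop (𝓝 0) := by
  have h : Tendsto (fun k : ℕ => ((k : ℝ) + 1)⁻¹) atTop (𝓝 0) := by
    simpa using tendsto_one_div_add_atTop_nhds_zero_nat (𝕜 := ℝ)
  simpa using h.smul_const x

lemma tendsto_cutoff (x : Rn n) : Tendsto (fun k => cutoff n k x) atTop (𝓝 1) := by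
  set b : ContDiffBump (0 : Rn n) := ⟨1, 2, one_pos, one_lt_two⟩
  have h := (b.continuous.tendsto 0).comp (tendsto_inv_smul x)
  rwa [b.one_of_mem_closedBall (by simp [b.rIn_pos.le])] at h

lemma exists_fderiv_cutoff_le (n : ℕ) (v : Rn n) :
    ∃ C, ∀ k x, |fderiv ℝ (cutoff n k) x v| ≤ ((k : ℝ) + 1)⁻¹ * C := by
  set b : ContDiffBump (0 : Rn n) := ⟨1, 2, one_pos, one_lt_two⟩
  obtain ⟨C, hC⟩ := (b.hasCompactSupport.fderiv_apply (𝕜 := ℝ) v).exists_bound_of_continuous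
    ((b.contDiff.continuous_fderiv (n := 1) (by simp)).clm_apply continuous_const)
  refine ⟨C, fun k x => ?_⟩
  have e : fderiv ℝ (cutoff n k) x = ((k : ℝ) + 1)⁻¹ • fderiv ℝ b (((k : ℝ) + 1)⁻¹ • x) :=
    fderiv_comp_smul _
  rw [e, smul_apply, smul_eq_mul, abs_mul, abs_of_nonneg (by positivity)]
  gcongr
  exact hC _

/-- Real and imaginary parts of the truncated characters `χ_k(x) e^{-i x·ξ}`. -/
def cosTest (k : ℕ) (ξ x : Rn n) : ℝ := cutoff n k x * Real.cos (inner ℝ x ξ)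

/-- See `cosTest`. -/
def sinTest (k : ℕ) (ξ x : Rn n) : ℝ := cutoff n k x * Real.sin (inner ℝ x ξ)

lemma contDiff_cosTest (k : ℕ) (ξ : Rn n) : ContDiff ℝ ∞ (cosTest k ξ) :=
  (contDiff_cutoff k).mul (Real.contDiff_cos.comp (contDiff_id.inner ℝ contDiff_const))

lemma contDiff_sinTest (k : ℕ) (ξ : Rn n) : ContDiff ℝ ∞ (sinTest k ξ) :=
  (contDiff_cutoff k).mul (Real.contDiff_sin.comp (contDiff_id.inner ℝ contDiff_const))

lemma hasCompactSupport_cosTest (k : ℕ) (ξ : Rn n) : HasCompactSupport (cosTest k ξ) :=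
  (hasCompactSupport_cutoff k).mul_right

lemma hasCompactSupport_sinTest (k : ℕ) (ξ : Rn n) : HasCompactSupport (sinTest k ξ) :=
  (hasCompactSupport_cutoff k).mul_right

lemma fderiv_cosTest (k : ℕ) (ξ x v : Rn n) : fderiv ℝ (cosTest k ξ) x v =
    fderiv ℝ (cutoff n k) x v * Real.cos (inner ℝ x ξ) -
      cutoff n k x * (Real.sin (inner ℝ x ξ) * inner ℝ v ξ) := by
  have h1 := ((contDiff_cutoff (n := n) k).differentiable (by simp) x).hasFDerivAt
  have h2 : HasFDerivAt (fun x : Rn n => inner ℝ x ξ) _ x :=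
    (hasFDerivAt_id x).inner ℝ (hasFDerivAt_const ξ x)
  refine (congrArg (· v) (h1.mul h2.cos).fderiv).trans ?_
  simp [fderivInnerCLM_apply]
  ring

lemma fderiv_sinTest (k : ℕ) (ξ x v : Rn n) : fderiv ℝ (sinTest k ξ) x v =
    fderiv ℝ (cutoff n k) x v * Real.sin (inner ℝ x ξ) +
      cutoff n k x * (Real.cos (inner ℝ x ξ) * inner ℝ v ξ) := by
  have h1 := ((contDiff_cutoff (n := n) k).differentiable (by simp) x).hasFDerivAt
  have h2 : HasFDerivAt (fun x : Rn n => inner ℝ x ξ) _ x :=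
    (hasFDerivAt_id x).inner ℝ (hasFDerivAt_const ξ x)
  refine (congrArg (· v) (h1.mul h2.sin).fderiv).trans ?_
  simp [fderivInnerCLM_apply]
  ring

/-- The weak derivative identity in the direction `v` against the truncated characters whose
frequency lies in a fixed dense sequence. -/
def TestedWeakDeriv (v : Rn n) (V D : Rn n → ℂ) : Prop :=
  ∀ k j : ℕ, (∫ x, (fderiv ℝ (cosTest k (TopologicalSpace.denseSeq (Rn n) j)) x v • V x +
      cosTest k (TopologicalSpace.denseSeq (Rn n) j) x • D x) = 0) ∧
    ∫ x, (fderiv ℝ (sinTest k (TopologicalSpace.denseSeq (Rn n) j)) x v • V x +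
      sinTest k (TopologicalSpace.denseSeq (Rn n) j) x • D x) = 0

/-- The exceptional heights y depend on the test function; a sequence of cut-offs and a dense
sequence of frequencies keep their union null. -/
lemma HasWeakDeriv.ae_testedWeakDeriv {v : Rn n} {V D : Rn n × ℝ → ℂ}
    (h : HasWeakDeriv (halfSpace n) (v, 0) V D) :
    ∀ᵐ y ∂(volume.restrict (Ioi (0 : ℝ))),
      TestedWeakDeriv v (fun x => V (x, y)) (fun x => D (x, y)) := by
  simp only [TestedWeakDeriv, ae_all_iff]
  intro k j
  filter_upwards [ae_restrict_mem measurableSet_Ioi, ae_restrict_of_ae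
    (h.ae_slice_x (contDiff_cosTest k (TopologicalSpace.denseSeq (Rn n) j))
      (hasCompactSupport_cosTest _ _)), ae_restrict_of_ae
    (h.ae_slice_x (contDiff_sinTest k (TopologicalSpace.denseSeq (Rn n) j))
      (hasCompactSupport_sinTest _ _))] with y hy h1 h2
  exact ⟨h1 hy, h2 hy⟩

lemma integrable_exp_mul {f : Rn n → ℂ} (hf : Integrable f) (ξ : Rn n) :
    Integrable fun x => Complex.exp (-Complex.I * ((inner ℝ x ξ : ℝ) : ℂ)) * f x := by
  refine hf.bdd_mul (c := 1) (Continuous.aestronglyMeasurable (by fun_prop))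
    (ae_of_all _ fun x => ?_)
  have := norm_exp_I_mul (-(inner ℝ x ξ))
  push_cast at this
  rw [neg_mul, ← mul_neg, this]

/-- Testing with a cut-off times a character is the identity "the transform of ∂_v f is i(v·ξ) times
that of f" for the truncated function, at the frequencies of the dense sequence. Truncation makes
both sides transforms of integrable functions, hence continuous, so the identity extends to all
frequencies. -/
lemma fourierT_testedWeakDeriv {v : Rn n} {V D : Rn n → ℂ} (hV : LocallyIntegrable V)
    (hD : LocallyIntegrable D) (h : TestedWeakDeriv v V D) (k : ℕ) :
    Integrable (fun x => fderiv ℝ (cutoff n k) x v • V x + cutoff n k x • D x) ∧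
    Integrable (fun x => cutoff n k x • V x) ∧
    ∀ ξ, fourierT (fun x => fderiv ℝ (cutoff n k) x v • V x + cutoff n k x • D x) ξ =
      Complex.I * ((inner ℝ v ξ : ℝ) : ℂ) * fourierT (fun x => cutoff n k x • V x) ξ := by
  have hi : ∀ {χ : Rn n → ℝ}, ContDiff ℝ ∞ χ → HasCompactSupport χ →
      Integrable fun x => fderiv ℝ χ x v • V x + χ x • D x := by
    intro χ hχ hχc
    exact (hV.integrable_smul_left_of_hasCompactSupport
      ((hχ.continuous_fderiv (by simp)).clm_apply continuous_const)
      (hχc.fderiv_apply (𝕜 := ℝ) v)).add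
      (hD.integrable_smul_left_of_hasCompactSupport hχ.continuous hχc)
  have i1 := hi (contDiff_cutoff k) (hasCompactSupport_cutoff k)
  have i2 : Integrable fun x => cutoff n k x • V x :=
    hV.integrable_smul_left_of_hasCompactSupport (contDiff_cutoff k).continuous
      (hasCompactSupport_cutoff k)
  refine ⟨i1, i2, fun ξ => ?_⟩
  revert ξ
  rw [← funext_iff]
  have c1 := continuous_fourierT i1
  have c2 := continuous_fourierT i2
  refine Continuous.ext_on (TopologicalSpace.denseRange_denseSeq (Rn n)) c1 (by fun_prop) ?_
  rintro _ ⟨j, rfl⟩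
  obtain ⟨h1, h2⟩ := h k j
  set ξ := TopologicalSpace.denseSeq (Rn n) j
  have j1 := integrable_exp_mul i1 ξ
  have j2 := (integrable_exp_mul i2 ξ).const_mul (Complex.I * ((inner ℝ v ξ : ℝ) : ℂ))
  have h3 : ∫ x, (Complex.exp (-Complex.I * ((inner ℝ x ξ : ℝ) : ℂ)) *
      (fderiv ℝ (cutoff n k) x v • V x + cutoff n k x • D x) - Complex.I * ((inner ℝ v ξ : ℝ) : ℂ) *
      (Complex.exp (-Complex.I * ((inner ℝ x ξ : ℝ) : ℂ)) * cutoff n k x • V x)) = 0 := by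
    -- Weak derivatives are tested with real functions only; cosine minus i times sine reassembles
    -- the character.
    have h4 : (∫ x, (fderiv ℝ (cosTest k ξ) x v • V x + cosTest k ξ x • D x)) -
        Complex.I * ∫ x, (fderiv ℝ (sinTest k ξ) x v • V x + sinTest k ξ x • D x) = 0 := by
      rw [h1, h2, mul_zero, sub_zero]
    rw [← integral_const_mul, ← integral_sub (hi (contDiff_cosTest k ξ)
      (hasCompactSupport_cosTest k ξ)) ((hi (contDiff_sinTest k ξ)
      (hasCompactSupport_sinTest k ξ)).const_mul _)] at h4
    rw [← h4]
    refine integral_congr_ae (ae_of_all _ fun x => ?_)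
    have e : Complex.exp (-Complex.I * ((inner ℝ x ξ : ℝ) : ℂ)) =
        ((Real.cos (inner ℝ x ξ) : ℝ) : ℂ) - Complex.I * ((Real.sin (inner ℝ x ξ) : ℝ) : ℂ) := by
      have := Complex.exp_mul_I (-((inner ℝ x ξ : ℝ) : ℂ))
      rw [Complex.cos_neg, Complex.sin_neg] at this
      rw [neg_mul, ← mul_neg, mul_comm, this]
      push_cast
      ring
    simp only [e, fderiv_cosTest, fderiv_sinTest, cosTest, sinTest, Complex.real_smul]
    push_cast
    linear_combination (((inner ℝ v ξ : ℝ) : ℂ) * (cutoff n k x : ℂ) *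
      Complex.sin ((inner ℝ x ξ : ℝ) : ℂ) * V x) * Complex.I_sq
  rw [integral_sub j1 j2, sub_eq_zero, integral_const_mul] at h3
  simp only [fourierT]
  rw [h3, mul_smul_comm]

lemma memLp_fourierTInv {m : Rn n → ℂ} (hm : Rapid m) : MemLp (fourierTInv m) 2 := by
  refine ⟨(continuous_fourierTInv hm.integrable).aestronglyMeasurable, ?_⟩
  have h := hm.memLp_two.2
  rw [eLpNorm_lt_top_iff_lintegral_rpow_enorm_lt_top two_ne_zero ENNReal.ofNat_ne_top] at h ⊢
  simp only [ENNReal.toReal_ofNat, ENNReal.rpow_ofNat] at h ⊢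
  rwa [lintegral_fourierTInv_sq hm.integrable hm.memLp_two]

lemma integrable_mul_conj {α : Type*} [MeasurableSpace α] {μ : Measure α} {f g : α → ℂ}
    (hf : MemLp f 2 μ) (hg : MemLp g 2 μ) : Integrable (fun x => f x * conj (g x)) μ :=
  hf.integrable_mul hg.star

/-- Integration by parts against a superposition of characters. -/
theorem integral_mul_conj_of_testedWeakDeriv {v : Rn n} {V D : Rn n → ℂ} (hV : MemLp V 2)
    (hD : MemLp D 2) (h : TestedWeakDeriv v V D) {m : Rn n → ℂ} (hm : Rapid m) :
    ∫ x, D x * conj (fourierTInv m x) =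
      -∫ x, V x * conj (fourierTInv (fun ξ => Complex.I * ((inner ℝ v ξ : ℝ) : ℂ) * m ξ) x) := by
  set m' : Rn n → ℂ := fun ξ => Complex.I * ((inner ℝ v ξ : ℝ) : ℂ) * m ξ with hm'
  have hr' : Rapid m' := hm.inner_mul v
  set f₁ : ℕ → Rn n → ℂ := fun k x => fderiv ℝ (cutoff n k) x v • V x + cutoff n k x • D x with hf₁
  set f₂ : ℕ → Rn n → ℂ := fun k x => cutoff n k x • V x with hf₂
  have key : ∀ k, ∫ x, f₁ k x * conj (fourierTInv m x) =
      -∫ x, f₂ k x * conj (fourierTInv m' x) := by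
    intro k
    obtain ⟨i1, i2, e⟩ := fourierT_testedWeakDeriv (hV.locallyIntegrable one_le_two)
      (hD.locallyIntegrable one_le_two) h k
    rw [integral_mul_conj_fourierTInv i1 hm.integrable,
      integral_mul_conj_fourierTInv i2 hr'.integrable, ← integral_neg]
    refine integral_congr_ae (ae_of_all _ fun ξ => ?_)
    simp only [e, hm', map_mul, Complex.conj_I, Complex.conj_ofReal]
    ring
  obtain ⟨C, hC⟩ := exists_fderiv_cutoff_le n v
  have hC0 : 0 ≤ C := by
    have := (abs_nonneg _).trans (hC 0 0)
    simpa using this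
  have g1 := memLp_fourierTInv hm
  have g2 := memLp_fourierTInv hr'
  -- The derivative of the cut-off is O(1/k), so the term containing V disappears in the limit,
  -- while the square integrability of V and D provides the dominating function.
  have t1 : Tendsto (fun k => ∫ x, f₁ k x * conj (fourierTInv m x)) atTop
      (𝓝 (∫ x, D x * conj (fourierTInv m x))) := by
    refine tendsto_integral_of_dominated_convergence
      (fun x => C * ‖V x * conj (fourierTInv m x)‖ + ‖D x * conj (fourierTInv m x)‖) (fun k => ?_)
      (((integrable_mul_conj hV g1).norm.const_mul C).add (integrable_mul_conj hD g1).norm)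
      (fun k => ae_of_all _ fun x => ?_) (ae_of_all _ fun x => ?_)
    · have := (fourierT_testedWeakDeriv (hV.locallyIntegrable one_le_two)
        (hD.locallyIntegrable one_le_two) h k).1
      exact this.1.mul g1.star.1
    · simp only [hf₁, norm_mul, RCLike.norm_conj]
      rw [← mul_assoc, ← add_mul]
      gcongr
      refine (norm_add_le _ _).trans ?_
      rw [norm_smul, norm_smul, Real.norm_eq_abs, Real.norm_eq_abs]
      gcongr
      · refine (hC k x).trans (mul_le_of_le_one_left hC0 (inv_le_one_of_one_le₀ ?_))
        have : (0 : ℝ) ≤ k := k.cast_nonneg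
        linarith
      · exact mul_le_of_le_one_left (norm_nonneg _) (abs_cutoff_le k x)
    · have l1 : Tendsto (fun k => fderiv ℝ (cutoff n k) x v) atTop (𝓝 0) := by
        refine squeeze_zero_norm (fun k => hC k x) ?_
        have : Tendsto (fun k : ℕ => ((k : ℝ) + 1)⁻¹) atTop (𝓝 0) := by
          simpa using tendsto_one_div_add_atTop_nhds_zero_nat (𝕜 := ℝ)
        simpa using this.mul_const C
      have := ((l1.smul_const (V x)).add ((tendsto_cutoff x).smul_const (D x))).mul_const
        (conj (fourierTInv m x))
      simpa [hf₁] using this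
  have t2 : Tendsto (fun k => ∫ x, f₂ k x * conj (fourierTInv m' x)) atTop
      (𝓝 (∫ x, V x * conj (fourierTInv m' x))) := by
    refine tendsto_integral_of_dominated_convergence
      (fun x => ‖V x * conj (fourierTInv m' x)‖) (fun k => ?_)
      (integrable_mul_conj hV g2).norm (fun k => ae_of_all _ fun x => ?_) (ae_of_all _ fun x => ?_)
    · exact ((contDiff_cutoff k).continuous.aestronglyMeasurable.smul hV.1).mul g2.star.1
    · simp only [hf₂, norm_mul]
      gcongr
      rw [norm_smul, Real.norm_eq_abs]
      exact mul_le_of_le_one_left (norm_nonneg _) (abs_cutoff_le k x)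
    · have := ((tendsto_cutoff x).smul_const (V x)).mul_const (conj (fourierTInv m' x))
      simpa [hf₂] using this
  refine tendsto_nhds_unique t1 ?_
  simp only [key]
  exact t2.neg

end HorizontalSlices

/-! ### The lower bound for the energy -/

section LowerBound

open scoped SchwartzMap ComplexConjugate

variable {n : ℕ} {s : ℝ}

lemma aestronglyMeasurable_rpow_snd (p : ℝ) :
    AEStronglyMeasurable (fun X : Rn n × ℝ => X.2 ^ p) (halfMeasure n) :=
  Measurable.aestronglyMeasurable (by fun_prop)

lemma integrable_wSq {f : Rn n × ℝ → ℂ} (hf : AEStronglyMeasurable f (halfMeasure n))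
    (hf' : wSq s f ≠ ⊤) :
    Integrable (fun X => X.2 ^ (1 - 2 * s) * ‖f X‖ ^ 2) (halfMeasure n) ∧
      ∫ X, X.2 ^ (1 - 2 * s) * ‖f X‖ ^ 2 ∂halfMeasure n = (wSq s f).toReal := by
  have hm : AEStronglyMeasurable (fun X : Rn n × ℝ => X.2 ^ (1 - 2 * s) * ‖f X‖ ^ 2)
      (halfMeasure n) :=
    (aestronglyMeasurable_rpow_snd _).mul (hf.norm.pow 2)
  have h0 : 0 ≤ᵐ[halfMeasure n] fun X => X.2 ^ (1 - 2 * s) * ‖f X‖ ^ 2 := by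
    filter_upwards [ae_halfMeasure] with X hX
    simp only [Pi.zero_apply]
    positivity
  have e : ∫⁻ X, ENNReal.ofReal (X.2 ^ (1 - 2 * s) * ‖f X‖ ^ 2) ∂halfMeasure n = wSq s f := by
    refine lintegral_congr_ae ?_
    filter_upwards [ae_halfMeasure] with X hX
    exact ofReal_weight_mul (by positivity) _
  refine ⟨⟨hm, ?_⟩, ?_⟩
  · rw [hasFiniteIntegral_iff_ofReal h0, e]
    exact hf'.lt_top
  · rw [integral_eq_lintegral_of_nonneg_ae h0 hm, e]

/-- Young's inequality in the weighted space. -/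
lemma two_re_integral_le {f g : Rn n × ℝ → ℂ} (hf : AEStronglyMeasurable f (halfMeasure n))
    (hg : AEStronglyMeasurable g (halfMeasure n)) (hf' : wSq s f ≠ ⊤) (hg' : wSq s g ≠ ⊤) :
    Integrable (fun X => X.2 ^ (1 - 2 * s) • (f X * conj (g X))) (halfMeasure n) ∧
      2 * (∫ X, X.2 ^ (1 - 2 * s) • (f X * conj (g X)) ∂halfMeasure n).re ≤
        (wSq s f).toReal + (wSq s g).toReal := by
  obtain ⟨f1, f2⟩ := integrable_wSq hf hf'
  obtain ⟨g1, g2⟩ := integrable_wSq hg hg'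
  have hi : Integrable (fun X => X.2 ^ (1 - 2 * s) • (f X * conj (g X))) (halfMeasure n) := by
    refine (f1.add g1).mono' ?_ ?_
    · exact (aestronglyMeasurable_rpow_snd _).smul (hf.mul hg.star)
    · filter_upwards [ae_halfMeasure] with X hX
      have hw : 0 ≤ X.2 ^ (1 - 2 * s) := by positivity
      rw [norm_smul, Real.norm_of_nonneg hw, norm_mul, RCLike.norm_conj, Pi.add_apply, ← mul_add]
      gcongr
      nlinarith [sq_nonneg (‖f X‖ - ‖g X‖), sq_nonneg ‖f X‖, sq_nonneg ‖g X‖]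
  refine ⟨hi, ?_⟩
  rw [← f2, ← g2, ← integral_add f1 g1, ← RCLike.re_eq_complex_re, ← integral_re hi,
    ← integral_const_mul]
  refine integral_mono_ae (hi.re.const_mul 2) (f1.add g1) ?_
  filter_upwards [ae_halfMeasure] with X hX
  have hw : 0 ≤ X.2 ^ (1 - 2 * s) := by positivity
  have h1 : 2 * (f X * conj (g X)).re ≤ ‖f X‖ ^ 2 + ‖g X‖ ^ 2 := by
    have h2 := Complex.re_le_norm (f X * conj (g X))
    rw [norm_mul, RCLike.norm_conj] at h2
    nlinarith [sq_nonneg (‖f X‖ - ‖g X‖)]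
  simp only [RCLike.re_eq_complex_re, Complex.smul_re, smul_eq_mul]
  calc 2 * (X.2 ^ (1 - 2 * s) * (f X * conj (g X)).re)
      = X.2 ^ (1 - 2 * s) * (2 * (f X * conj (g X)).re) := by ring
    _ ≤ X.2 ^ (1 - 2 * s) * (‖f X‖ ^ 2 + ‖g X‖ ^ 2) := by gcongr
    _ = _ := by ring

lemma ae_lt_fst_restrict_Ioi_prod (t : ℝ) :
    ∀ᵐ p ∂((volume.restrict (Ioi t)).prod (volume : Measure (Rn n))), t < p.1 := by
  have e := Measure.prod_restrict (μ := (volume : Measure ℝ)) (ν := (volume : Measure (Rn n)))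
    (Ioi t) univ
  rw [Measure.restrict_univ] at e
  rw [e]
  exact (ae_restrict_mem (measurableSet_Ioi.prod MeasurableSet.univ)).mono fun p hp => hp.1

variable (hs0 : 0 < s) (hs1 : s < 1) (u : 𝓢(Rn n, ℂ))

include hs0 in
-- Quadratic decay of the profile gives |ξ|² g(|ξ|y) ≤ K min(|ξ|², y^(-2)). The decay in y is
-- uniform in ξ, including small frequencies, at the cost of dominating by |û| as well as |ξ|²|û|.
lemma exists_norm_lapMul_prof_le : ∃ K, 0 ≤ K ∧ ∀ y, 0 < y → ∀ ξ : Rn n,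
    ‖lapMul u ξ * ((prof s (‖ξ‖ * y) : ℝ) : ℂ)‖ ≤
      K * min 1 (1 / y ^ 2) * (‖lapMul u ξ‖ + ‖hatS u ξ‖) := by
  obtain ⟨K, hK0, hK⟩ := exists_prof_le_min hs0
  refine ⟨K, hK0, fun y hy ξ => ?_⟩
  rcases eq_or_ne ξ 0 with rfl | hξ
  · have : lapMul u (0 : Rn n) = 0 := by simp [lapMul]
    rw [this, zero_mul, norm_zero]
    positivity
  have hξ0 : 0 < ‖ξ‖ := norm_pos_iff.2 hξ
  have hp := hK (‖ξ‖ * y) (by positivity)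
  have e : ‖lapMul u ξ‖ = ‖ξ‖ ^ 2 * ‖hatS u ξ‖ := by
    rw [lapMul, norm_mul, Complex.norm_real, Real.norm_of_nonneg (by positivity), Real.rpow_two]
  rw [norm_mul, Complex.norm_real, Real.norm_of_nonneg (prof_nonneg hs0 _), e,
    mul_min_of_nonneg _ _ hK0, min_mul_of_nonneg _ _ (by positivity)]
  have hl := min_le_left 1 (1 / (‖ξ‖ * y) ^ 2)
  have hr := min_le_right 1 (1 / (‖ξ‖ * y) ^ 2)
  refine le_min ?_ ?_
  · have h1 : prof s (‖ξ‖ * y) ≤ K := hp.trans (mul_le_of_le_one_right hK0 hl)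
    calc ‖ξ‖ ^ 2 * ‖hatS u ξ‖ * prof s (‖ξ‖ * y) ≤ ‖ξ‖ ^ 2 * ‖hatS u ξ‖ * K := by gcongr
      _ ≤ _ := by nlinarith [mul_nonneg hK0 (norm_nonneg (hatS u ξ))]
  · have h1 : prof s (‖ξ‖ * y) ≤ K * (1 / (‖ξ‖ * y) ^ 2) := hp.trans (by gcongr)
    calc ‖ξ‖ ^ 2 * ‖hatS u ξ‖ * prof s (‖ξ‖ * y)
        ≤ ‖ξ‖ ^ 2 * ‖hatS u ξ‖ * (K * (1 / (‖ξ‖ * y) ^ 2)) := by gcongr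
      _ = K * (1 / y ^ 2) * ‖hatS u ξ‖ := by field_simp
      _ ≤ _ := by gcongr; exact le_add_of_nonneg_left (by positivity)

include hs0 in
/-- Uniform and square-mean bounds for `𝓕⁻¹(|ξ|² û g(|ξ| y))`. -/
lemma exists_superpos_lapMul_le : ∃ (K : ℝ) (N : ENNReal), 0 ≤ K ∧ N ≠ ⊤ ∧ ∀ y, 0 < y →
    (∀ x : Rn n, ‖superpos (lapMul u) (prof s) (x, y)‖ ≤ K * min 1 (1 / y ^ 2)) ∧
    ∫⁻ x : Rn n, ‖superpos (lapMul u) (prof s) (x, y)‖ₑ ^ 2 ≤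
      ENNReal.ofReal (min 1 (1 / y ^ 2)) ^ 2 * N := by
  obtain ⟨K, hK0, hK⟩ := exists_norm_lapMul_prof_le hs0 u
  set b : Rn n → ℝ := fun ξ => ‖lapMul u ξ‖ + ‖hatS u ξ‖ with hb
  have hb0 : ∀ ξ, 0 ≤ b ξ := fun ξ => by positivity
  have hb1 : Integrable b := (rapid_lapMul u).integrable.norm.add
    (rapid_schwartz (hatS u)).integrable.norm
  have hb2 : MemLp b 2 := (rapid_lapMul u).memLp_two.norm.add
    (rapid_schwartz (hatS u)).memLp_two.norm
  have hN := hb2.2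
  rw [eLpNorm_lt_top_iff_lintegral_rpow_enorm_lt_top two_ne_zero ENNReal.ofNat_ne_top] at hN
  simp only [ENNReal.toReal_ofNat, ENNReal.rpow_ofNat] at hN
  refine ⟨fc n * (K * ∫ ξ, b ξ), ENNReal.ofReal K ^ 2 * ∫⁻ ξ, ‖b ξ‖ₑ ^ 2, ?_, ?_, fun y hy => ?_⟩
  · have : 0 ≤ ∫ ξ, b ξ := integral_nonneg hb0
    have := (fc_pos n).le
    positivity
  · exact ENNReal.mul_ne_top (by simp) hN.ne
  have hr := (rapid_lapMul u).mul_profile (continuous_prof hs0) (abs_prof_le hs0) y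
  refine ⟨fun x => ?_, ?_⟩
  · refine (norm_fourierTInv_le _ _).trans ?_
    rw [mul_assoc]
    refine mul_le_mul_of_nonneg_left ?_ (fc_pos n).le
    calc _ ≤ ∫ ξ, K * min 1 (1 / y ^ 2) * b ξ :=
          integral_mono hr.integrable.norm (hb1.const_mul _) fun ξ => hK y hy ξ
      _ = _ := by rw [integral_const_mul]; ring
  · simp only [superpos]
    rw [lintegral_fourierTInv_sq hr.integrable hr.memLp_two, ← mul_assoc, ← mul_pow,
      ← ENNReal.ofReal_mul (by positivity), ← lintegral_const_mul' _ _ (by simp)]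
    refine lintegral_mono fun ξ => ?_
    rw [← mul_pow]
    gcongr
    rw [Real.enorm_of_nonneg (hb0 ξ), ← ENNReal.ofReal_mul (by positivity), ← ofReal_norm]
    refine ENNReal.ofReal_le_ofReal ((hK y hy ξ).trans_eq ?_)
    ring

include hs0 hs1

lemma integral_Ioi_scaled_prof {r t : ℝ} (hr : 0 ≤ r) (ht : 0 ≤ t) :
    ∫ y in Ioi t, y ^ (1 - 2 * s) * (r ^ (2 : ℝ) * prof s (r * y)) =
      r ^ (2 * s) * flux s (r * t) := by
  rcases hr.eq_or_lt with rfl | hr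
  · simp [Real.zero_rpow (by linarith : 2 * s ≠ 0)]
  have e : ∀ y ∈ Ioi t, y ^ (1 - 2 * s) * (r ^ (2 : ℝ) * prof s (r * y)) =
      r ^ (2 * s + 1) * ((r * y) ^ (1 - 2 * s) * prof s (r * y)) := by
    intro y hy
    have hy : 0 < y := ht.trans_lt hy
    have e1 : r ^ (2 : ℝ) = r ^ (2 * s + 1) * r ^ (1 - 2 * s) := by
      rw [← Real.rpow_add hr]; ring_nf
    rw [Real.mul_rpow hr.le hy.le, e1]
    ring
  rw [setIntegral_congr_fun measurableSet_Ioi e, integral_const_mul,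
    integral_comp_mul_left_Ioi (fun τ => τ ^ (1 - 2 * s) * prof s τ) t hr,
    integral_Ioi_weight_prof hs0 hs1 (by positivity), smul_eq_mul, Real.rpow_add_one hr.ne']
  field_simp

/-- The vertical flux is recovered from `𝓕⁻¹(|ξ|² û g(|ξ| y))` by integration. -/
lemma integral_Ioi_superpos_lapMul (x : Rn n) {t : ℝ} (ht : 0 ≤ t) :
    ∫ y in Ioi t, y ^ (1 - 2 * s) • superpos (lapMul u) (prof s) (x, y) =
      superpos (fluxMul s u) (flux s) (x, t) := by
  obtain ⟨K, hK0, hK⟩ := exists_norm_lapMul_prof_le hs0 u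
  set F : ℝ → Rn n → ℂ := fun y ξ => (y ^ (1 - 2 * s)) •
    (Complex.exp (Complex.I * ((inner ℝ x ξ : ℝ) : ℂ)) *
      (lapMul u ξ * ((prof s (‖ξ‖ * y) : ℝ) : ℂ))) with hF
  have hcp := (continuous_prof hs0).measurable
  have hml : Measurable (lapMul u) := by
    have := (hatS u).continuous.measurable
    unfold lapMul
    fun_prop
  have hb1 : Integrable fun ξ => ‖lapMul u ξ‖ + ‖hatS u ξ‖ :=
    (rapid_lapMul u).integrable.norm.add (rapid_schwartz (hatS u)).integrable.norm
  have hi : Integrable (Function.uncurry F) ((volume.restrict (Ioi t)).prod volume) := by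
    have h1 := (((integrableOn_rpow_mul_min (p := 1 - 2 * s) (by linarith) (by linarith)).mono_set
      (Ioi_subset_Ioi ht)).const_mul K).mul_prod hb1
    refine h1.mono' (Measurable.aestronglyMeasurable ?_) ?_
    · simp only [hF, Function.uncurry_def]
      fun_prop
    · filter_upwards [ae_lt_fst_restrict_Ioi_prod t] with p hp
      have hp0 : 0 < p.1 := ht.trans_lt hp
      simp only [hF, Function.uncurry_def]
      rw [norm_smul, Real.norm_of_nonneg (by positivity), norm_mul, norm_exp_I_mul, one_mul]
      calc _ ≤ p.1 ^ (1 - 2 * s) * (K * min 1 (1 / p.1 ^ 2) *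
            (‖lapMul u p.2‖ + ‖hatS u p.2‖)) := by gcongr; exact hK _ hp0 _
        _ = _ := by ring
  have e1 : ∀ y, y ^ (1 - 2 * s) • superpos (lapMul u) (prof s) (x, y) = fc n • ∫ ξ, F y ξ := by
    intro y
    simp only [superpos, fourierTInv, hF]
    rw [integral_smul, smul_comm, ← fc]
  simp only [e1]
  rw [integral_smul, integral_integral_swap hi, superpos, fourierTInv, ← fc]
  congr 1
  refine integral_congr_ae (ae_of_all _ fun ξ => ?_)
  have e2 : ∀ y, F y ξ = (Complex.exp (Complex.I * ((inner ℝ x ξ : ℝ) : ℂ)) * hatS u ξ) *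
      ((y ^ (1 - 2 * s) * (‖ξ‖ ^ (2 : ℝ) * prof s (‖ξ‖ * y)) : ℝ) : ℂ) := by
    intro y
    simp only [hF, lapMul, Complex.real_smul]
    push_cast
    ring
  simp only [e2]
  rw [integral_const_mul, integral_complex_ofReal, integral_Ioi_scaled_prof hs0 hs1
    (norm_nonneg ξ) ht, fluxMul]
  push_cast
  ring

end LowerBound

/-! ### Slices of a competitor, the pairing of gradients, and minimality -/

section Minimality

open scoped SchwartzMap ComplexConjugate

variable {n : ℕ} {s : ℝ}

lemma HasWeakDeriv.aestronglyMeasurable {v : Rn n × ℝ} {V D : Rn n × ℝ → ℂ}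
    (h : HasWeakDeriv (halfSpace n) v V D) :
    AEStronglyMeasurable V (halfMeasure n) ∧ AEStronglyMeasurable D (halfMeasure n) := by
  rw [← restrict_halfSpace]
  exact ⟨h.1.aestronglyMeasurable, h.2.1.aestronglyMeasurable⟩

lemma aemeasurable_weightedSq_slice {D : Rn n × ℝ → ℂ}
    (hD : AEStronglyMeasurable D (halfMeasure n)) :
    AEMeasurable (fun x : Rn n => weightedSq s fun t => D (x, t)) :=
  (aemeasurable_wSq (s := s) hD).lintegral_prod_right'

lemma lintegral_weightedSq_slice {D : Rn n × ℝ → ℂ}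
    (hD : AEStronglyMeasurable D (halfMeasure n)) :
    ∫⁻ x : Rn n, weightedSq s (fun t => D (x, t)) = wSq s D :=
  (lintegral_prod _ (aemeasurable_wSq (s := s) hD)).symm

lemma ae_memLp_slice {D : Rn n × ℝ → ℂ} (hD : AEStronglyMeasurable D (halfMeasure n))
    (hf : wSq s D ≠ ⊤) :
    ∀ᵐ y ∂(volume.restrict (Ioi (0 : ℝ))), MemLp (fun x => D (x, y)) 2 := by
  have hm := aemeasurable_wSq (s := s) hD
  rw [wSq, lintegral_prod_symm _ hm] at hf
  filter_upwards [ae_lt_top' hm.lintegral_prod_left' hf, hD.prodMk_right,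
    ae_restrict_mem measurableSet_Ioi] with y h1 h2 hy
  have hy : 0 < y := hy
  refine ⟨h2, ?_⟩
  rw [lintegral_const_mul' _ _ ENNReal.ofReal_ne_top] at h1
  rw [eLpNorm_lt_top_iff_lintegral_rpow_enorm_lt_top two_ne_zero ENNReal.ofNat_ne_top]
  simp only [ENNReal.toReal_ofNat, ENNReal.rpow_ofNat]
  refine ENNReal.lt_top_of_mul_ne_top_right h1.ne ?_
  rw [Ne, ENNReal.ofReal_eq_zero, not_le]
  positivity

section Vertical

variable (hs0 : 0 < s) {V D : Rn n × ℝ → ℂ}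
  (hD : HasWeakDeriv (halfSpace n) (dirY n) V D)
  (hc : ∀ x, ContinuousOn (fun y => V (x, y)) (Ici 0)) (hf : wSq s D ≠ ⊤)
include hs0 hD hc hf

/-- By Tonelli almost every vertical line has finite weighted energy. As every slice of V is
continuous on [0,∞), the formula holds for the slice itself and starts at the prescribed boundary
value. -/
lemma ae_vertical : ∀ᵐ x : Rn n,
    AEStronglyMeasurable (fun t => D (x, t)) (volume.restrict (Ioi 0)) ∧
    weightedSq s (fun t => D (x, t)) ≠ ⊤ ∧
    ∀ y, 0 ≤ y → V (x, y) - V (x, 0) = ∫ t in Ioc 0 y, D (x, t) := by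
  have hm := hD.aestronglyMeasurable.2
  have hf' : ∫⁻ x : Rn n, weightedSq s (fun t => D (x, t)) ≠ ⊤ := by
    rwa [lintegral_weightedSq_slice hm]
  filter_upwards [hm.prodMk_left, ae_lt_top' (aemeasurable_weightedSq_slice hm) hf',
    hD.ae_sub_eq_integral fun x => (hc x).mono Ioi_subset_Ici_self] with x h1 h2 h3
  exact ⟨h1, h2.ne, fun y hy => sub_eq_integral_Ioc_of_weightedSq (v := fun y => V (x, y)) hs0
    (hc x) h1 h2.ne h3 hy⟩

lemma ae_enorm_sub_le : ∀ᵐ x : Rn n, ∀ y, 0 < y → ‖V (x, y) - V (x, 0)‖ₑ ≤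
    ENNReal.ofReal (y ^ s) * (ENNReal.ofReal ((2 * s) ^ (-1 / 2 : ℝ)) *
      weightedSq s (fun t => D (x, t)) ^ (1 / 2 : ℝ)) := by
  filter_upwards [ae_vertical hs0 hD hc hf] with x ⟨h1, h2, h3⟩ y hy
  rw [h3 y hy.le]
  exact (enorm_integral_le_lintegral_enorm _).trans (lintegral_enorm_Ioc_le hs0 h1 hy)

/-- Nothing is assumed on the size of V. The difference V - u is square integrable in x because the
vertical Cauchy-Schwarz bound, once squared, integrates to a multiple of the energy; adding u back
gives the claim. -/
lemma ae_memLp_sub {u : Rn n → ℂ} (hu : MemLp u 2) (h0 : ∀ x, V (x, 0) = u x) :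
    ∀ᵐ y ∂(volume.restrict (Ioi (0 : ℝ))), MemLp (fun x => V (x, y)) 2 := by
  have hm := hD.aestronglyMeasurable
  filter_upwards [hm.1.prodMk_right, ae_restrict_mem measurableSet_Ioi] with y h1 hy
  have hd : MemLp (fun x => V (x, y) - u x) 2 := by
    refine ⟨h1.sub hu.1, ?_⟩
    rw [eLpNorm_lt_top_iff_lintegral_rpow_enorm_lt_top two_ne_zero ENNReal.ofNat_ne_top]
    simp only [ENNReal.toReal_ofNat, ENNReal.rpow_ofNat]
    have h2 : ∫⁻ x, ‖V (x, y) - u x‖ₑ ^ 2 ≤ ∫⁻ x : Rn n, (ENNReal.ofReal (y ^ s) *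
        ENNReal.ofReal ((2 * s) ^ (-1 / 2 : ℝ))) ^ 2 * weightedSq s (fun t => D (x, t)) := by
      refine lintegral_mono_ae ?_
      filter_upwards [ae_enorm_sub_le hs0 hD hc hf] with x hx
      have h3 := hx y hy
      rw [h0] at h3
      refine (pow_le_pow_left' h3 2).trans_eq ?_
      rw [← mul_assoc, mul_pow, ← ENNReal.rpow_natCast (_ ^ (1 / 2 : ℝ)), ← ENNReal.rpow_mul]
      norm_num
    refine h2.trans_lt ?_
    rw [lintegral_const_mul' _ _ (by finiteness), lintegral_weightedSq_slice hm.2]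
    exact ENNReal.mul_lt_top (by finiteness) hf.lt_top
  have := hd.add hu
  simpa [Pi.add_def] using this

end Vertical

lemma lintegral_mul_rpow_half_le {α : Type*} [MeasurableSpace α] {μ : Measure α}
    {f e : α → ENNReal} (hf : AEMeasurable f μ) (he : AEMeasurable e μ) :
    ∫⁻ x, f x * e x ^ (1 / 2 : ℝ) ∂μ ≤
      (∫⁻ x, f x ^ 2 ∂μ) ^ (1 / 2 : ℝ) * (∫⁻ x, e x ∂μ) ^ (1 / 2 : ℝ) := by
  have h := ENNReal.lintegral_mul_le_Lp_mul_Lq μ Real.HolderConjugate.two_two hf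
    (he.pow_const (1 / 2 : ℝ))
  have e : ∀ x, (e x ^ (1 / 2 : ℝ)) ^ (2 : ℝ) = e x := fun x => by
    rw [← ENNReal.rpow_mul]; norm_num
  simpa only [e, ENNReal.rpow_ofNat, Pi.mul_apply] using h

variable (hs0 : 0 < s) (hs1 : s < 1) (u : 𝓢(Rn n, ℂ)) {V DY : Rn n × ℝ → ℂ}
  {D : Fin n → Rn n × ℝ → ℂ} (hDY : HasWeakDeriv (halfSpace n) (dirY n) V DY)
  (hD : ∀ i, HasWeakDeriv (halfSpace n) (dirX i) V (D i))
  (hV : ∀ x, ContinuousOn (fun y => V (x, y)) (Ici 0) ∧ V (x, 0) = u x)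
  (hfY : wSq s DY ≠ ⊤) (hf : ∀ i, wSq s (D i) ≠ ⊤)

include hs0 hs1 hDY hV hfY in
-- The vertical bound contributes y^s and the square root of the slice energy; Cauchy-Schwarz in x
-- against the L² norm of F⁻¹(|ξ|² û g(|ξ|y)), which is O(min(1, y^(-2))), leaves y^(1-s) min(1,
-- y^(-2)).
lemma integrable_conj_mul_sub : Integrable (fun X => X.2 ^ (1 - 2 * s) •
    (conj (superpos (lapMul u) (prof s) X) * (V X - u X.1))) (halfMeasure n) := by
  obtain ⟨K, N, hK0, hN, hQ⟩ := exists_superpos_lapMul_le hs0 u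
  have hmD := hDY.aestronglyMeasurable
  have hcQ := continuous_superpos (rapid_lapMul u) (continuous_prof hs0) (abs_prof_le hs0)
  have hm : AEStronglyMeasurable (fun X => X.2 ^ (1 - 2 * s) •
      (conj (superpos (lapMul u) (prof s) X) * (V X - u X.1))) (halfMeasure n) :=
    (aestronglyMeasurable_rpow_snd _).smul (hcQ.star.aestronglyMeasurable.mul
      (hmD.1.sub (u.continuous.comp continuous_fst).aestronglyMeasurable))
  refine ⟨hm, ?_⟩
  rw [hasFiniteIntegral_iff_enorm, lintegral_prod_symm _ hm.enorm]
  set c : ENNReal := ENNReal.ofReal ((2 * s) ^ (-1 / 2 : ℝ))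
  set M : ENNReal := c * (N ^ (1 / 2 : ℝ) * wSq s DY ^ (1 / 2 : ℝ)) with hM
  have hMt : M ≠ ⊤ := ENNReal.mul_ne_top ENNReal.ofReal_ne_top (ENNReal.mul_ne_top
    (ENNReal.rpow_ne_top_of_nonneg (by norm_num) hN)
    (ENNReal.rpow_ne_top_of_nonneg (by norm_num) hfY))
  have h1 := (integrableOn_rpow_mul_min (p := 1 - s) (by linarith) (by linarith)).2
  refine lt_of_le_of_lt ?_ (ENNReal.mul_lt_top h1 hMt.lt_top)
  rw [← lintegral_mul_const' _ _ hMt]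
  refine setLIntegral_mono' measurableSet_Ioi fun y hy => ?_
  have hy : 0 < y := hy
  have hyQ := (hQ y hy).2
  calc ∫⁻ x : Rn n, ‖y ^ (1 - 2 * s) • (conj (superpos (lapMul u) (prof s) (x, y)) *
        (V (x, y) - u x))‖ₑ
      ≤ ∫⁻ x : Rn n, (ENNReal.ofReal (y ^ (1 - s)) * c) *
        (‖superpos (lapMul u) (prof s) (x, y)‖ₑ *
          weightedSq s (fun t => DY (x, t)) ^ (1 / 2 : ℝ)) := by
        refine lintegral_mono_ae ?_
        filter_upwards [ae_enorm_sub_le hs0 hDY (fun x => (hV x).1) hfY] with x hx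
        have h2 := hx y hy
        rw [(hV x).2] at h2
        rw [enorm_smul, enorm_mul, RCLike.enorm_conj, Real.enorm_of_nonneg (by positivity)]
        have e : y ^ (1 - s) = y ^ (1 - 2 * s) * y ^ s := by
          rw [← Real.rpow_add hy]; ring_nf
        rw [e, ENNReal.ofReal_mul (by positivity)]
        calc _ ≤ ENNReal.ofReal (y ^ (1 - 2 * s)) * (‖superpos (lapMul u) (prof s) (x, y)‖ₑ *
              (ENNReal.ofReal (y ^ s) * (c * weightedSq s (fun t => DY (x, t)) ^ (1 / 2 : ℝ)))) := by
              gcongr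
          _ = _ := by ring
    _ ≤ (ENNReal.ofReal (y ^ (1 - s)) * c) * (ENNReal.ofReal (min 1 (1 / y ^ 2)) *
          (N ^ (1 / 2 : ℝ) * wSq s DY ^ (1 / 2 : ℝ))) := by
        rw [lintegral_const_mul' _ _ (by finiteness)]
        gcongr
        refine (lintegral_mul_rpow_half_le (Continuous.aemeasurable (by fun_prop))
          (aemeasurable_weightedSq_slice hmD.2)).trans ?_
        rw [lintegral_weightedSq_slice hmD.2, ← mul_assoc]
        gcongr
        refine (ENNReal.rpow_le_rpow hyQ (by norm_num)).trans_eq ?_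
        rw [ENNReal.mul_rpow_of_nonneg _ _ (by norm_num), ← ENNReal.rpow_natCast,
          ← ENNReal.rpow_mul]
        norm_num
    _ = _ := by
        rw [Real.enorm_of_nonneg (by positivity), ENNReal.ofReal_mul (by positivity), hM]
        ring

include hs0 hs1 hDY hV hfY in
/-- Integration by parts in the vertical variable. -/
lemma integral_mul_conj_flux
    (hi : Integrable (fun X => DY X * conj (superpos (fluxMul s u) (flux s) X)) (halfMeasure n)) :
    ∫ X, DY X * conj (superpos (fluxMul s u) (flux s) X) ∂halfMeasure n =
      ∫ X, X.2 ^ (1 - 2 * s) • (conj (superpos (lapMul u) (prof s) X) * (V X - u X.1))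
        ∂halfMeasure n := by
  obtain ⟨K, N, hK0, hN, hQ⟩ := exists_superpos_lapMul_le hs0 u
  have hcQ := continuous_superpos (rapid_lapMul u) (continuous_prof hs0) (abs_prof_le hs0)
  rw [integral_prod _ hi, integral_prod _ (integrable_conj_mul_sub hs0 hs1 u hDY hV hfY)]
  refine integral_congr_ae ?_
  filter_upwards [ae_vertical hs0 hDY (fun x => (hV x).1) hfY] with x ⟨h1, h2, h3⟩
  set q : ℝ → ℂ := fun y => y ^ (1 - 2 * s) • conj (superpos (lapMul u) (prof s) (x, y)) with hq
  have hqm : AEStronglyMeasurable q (volume.restrict (Ioi 0)) := by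
    have hcx : Continuous fun y => conj (superpos (lapMul u) (prof s) (x, y)) :=
      (hcQ.comp (by fun_prop : Continuous fun y : ℝ => (x, y))).star
    have hw : Measurable fun y : ℝ => y ^ (1 - 2 * s) := by fun_prop
    exact hw.aestronglyMeasurable.smul hcx.aestronglyMeasurable
  have hfin : ∫⁻ y in Ioi (0 : ℝ), ‖q y‖ₑ * ∫⁻ t in Ioc 0 y, ‖DY (x, t)‖ₑ ≠ ⊤ := by
    set M := ENNReal.ofReal ((2 * s) ^ (-1 / 2 : ℝ)) *
      weightedSq s (fun t => DY (x, t)) ^ (1 / 2 : ℝ) with hM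
    have hMt : M ≠ ⊤ := ENNReal.mul_ne_top ENNReal.ofReal_ne_top
      (ENNReal.rpow_ne_top_of_nonneg (by norm_num) h2)
    have j1 := ((integrableOn_rpow_mul_min (p := 1 - s) (by linarith) (by linarith)).const_mul K).2
    refine ne_top_of_le_ne_top (ENNReal.mul_lt_top j1 hMt.lt_top).ne ?_
    rw [← lintegral_mul_const' _ _ hMt]
    refine setLIntegral_mono' measurableSet_Ioi fun y hy => ?_
    have hy : 0 < y := hy
    have e : y ^ (1 - s) = y ^ (1 - 2 * s) * y ^ s := by
      rw [← Real.rpow_add hy]; ring_nf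
    calc ‖q y‖ₑ * ∫⁻ t in Ioc 0 y, ‖DY (x, t)‖ₑ
        ≤ (ENNReal.ofReal (y ^ (1 - 2 * s)) * ENNReal.ofReal (K * min 1 (1 / y ^ 2))) *
          (ENNReal.ofReal (y ^ s) * M) := by
          refine mul_le_mul' ?_ (lintegral_enorm_Ioc_le hs0 h1 hy)
          rw [hq, enorm_smul, RCLike.enorm_conj, Real.enorm_of_nonneg (by positivity)]
          gcongr
          rw [← ofReal_norm]
          exact ENNReal.ofReal_le_ofReal ((hQ y hy).1 x)
      _ = _ := by
          rw [Real.enorm_of_nonneg (by positivity)]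
          simp only
          rw [e, ENNReal.ofReal_mul hK0, ENNReal.ofReal_mul hK0, ENNReal.ofReal_mul (by positivity),
            ENNReal.ofReal_mul (by positivity)]
          ring
  have key := integral_mul_tail h1 hqm hfin
  calc ∫ t in Ioi (0 : ℝ), DY (x, t) * conj (superpos (fluxMul s u) (flux s) (x, t))
      = ∫ t in Ioi (0 : ℝ), DY (x, t) * ∫ y in Ioi t, q y := by
        refine setIntegral_congr_fun measurableSet_Ioi fun t ht => ?_
        rw [← integral_Ioi_superpos_lapMul hs0 hs1 u x (le_of_lt ht), ← integral_conj]
        congr 2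
        ext y
        simp [hq]
    _ = ∫ y in Ioi (0 : ℝ), q y * ∫ t in Ioc 0 y, DY (x, t) := key
    _ = _ := by
        refine setIntegral_congr_fun measurableSet_Ioi fun y hy => ?_
        rw [← h3 y (le_of_lt hy), (hV x).2, hq, smul_mul_assoc]

include hs0 hDY hD hV hfY hf in
/-- Integration by parts in the horizontal variables. -/
lemma ae_sum_integral_mul_conj : ∀ᵐ y ∂(volume.restrict (Ioi (0 : ℝ))),
    ∑ i, ∫ x, D i (x, y) * conj (superpos (gradMul i u) (prof s) (x, y)) =
      ∫ x, V (x, y) * conj (superpos (lapMul u) (prof s) (x, y)) := by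
  filter_upwards [ae_all_iff.2 fun i => (hD i).ae_testedWeakDeriv,
    ae_all_iff.2 fun i => ae_memLp_slice (hD i).aestronglyMeasurable.2 (hf i),
    ae_memLp_sub hs0 hDY (fun x => (hV x).1) hfY (rapid_schwartz u).memLp_two
      (fun x => (hV x).2)] with y h1 h2 h3
  have hr : ∀ i, Rapid fun ξ => gradMul i u ξ * ((prof s (‖ξ‖ * y) : ℝ) : ℂ) := fun i =>
    (rapid_gradMul u i).mul_profile (continuous_prof hs0) (abs_prof_le hs0) y
  have e : ∀ i, ∫ x, D i (x, y) * conj (superpos (gradMul i u) (prof s) (x, y)) =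
      -∫ x, V (x, y) * conj (superpos (fun ξ => Complex.I * ((ξ i : ℝ) : ℂ) * gradMul i u ξ)
        (prof s) (x, y)) := by
    intro i
    have := integral_mul_conj_of_testedWeakDeriv h3 (h2 i) (h1 i) (hr i)
    simp only [EuclideanSpace.inner_single_left, map_one, one_mul, ← mul_assoc] at this
    exact this
  have hi : ∀ i, Integrable fun x => V (x, y) *
      conj (superpos (fun ξ => Complex.I * ((ξ i : ℝ) : ℂ) * gradMul i u ξ) (prof s) (x, y)) := by
    intro i
    have := memLp_fourierTInv ((hr i).inner_mul (EuclideanSpace.single i (1 : ℝ)))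
    simp only [EuclideanSpace.inner_single_left, map_one, one_mul, ← mul_assoc] at this
    exact integrable_mul_conj h3 this
  simp only [e]
  rw [Finset.sum_neg_distrib, ← integral_finsetSum _ fun i _ => hi i, ← integral_neg]
  refine integral_congr_ae (ae_of_all _ fun x => ?_)
  simp only
  rw [← Finset.mul_sum, ← map_sum, sum_superpos_gradMul hs0, map_neg, mul_neg, neg_neg]

include hs0 hs1 in
/-- The common value of the pairing with the extension. -/
lemma integral_pairing : ∫ y in Ioi (0 : ℝ), y ^ (1 - 2 * s) •
    ∫ x : Rn n, u x * conj (superpos (lapMul u) (prof s) (x, y)) =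
      ((energy s (extension (prof s) u)).toReal : ℂ) := by
  obtain ⟨K, hK0, hK⟩ := exists_norm_lapMul_prof_le hs0 u
  set F : ℝ → Rn n → ℂ := fun y ξ => (y ^ (1 - 2 * s)) •
    (hatS u ξ * conj (lapMul u ξ * ((prof s (‖ξ‖ * y) : ℝ) : ℂ))) with hF
  have hcp := (continuous_prof hs0).measurable
  have hmu := (hatS u).continuous.measurable
  have hml : Measurable (lapMul u) := by
    unfold lapMul
    fun_prop
  have hb : Integrable fun ξ => ‖hatS u ξ‖ * (‖lapMul u ξ‖ + ‖hatS u ξ‖) :=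
    (rapid_schwartz (hatS u)).memLp_two.norm.integrable_mul
      ((rapid_lapMul u).memLp_two.norm.add (rapid_schwartz (hatS u)).memLp_two.norm)
  have hi : Integrable (Function.uncurry F) ((volume.restrict (Ioi 0)).prod volume) := by
    have h1 := ((integrableOn_rpow_mul_min (p := 1 - 2 * s) (by linarith)
      (by linarith)).const_mul K).mul_prod hb
    refine h1.mono' (Measurable.aestronglyMeasurable ?_) ?_
    · simp only [hF, Function.uncurry_def]
      fun_prop
    · filter_upwards [ae_lt_fst_restrict_Ioi_prod 0] with p hp
      simp only [hF, Function.uncurry_def]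
      rw [norm_smul, Real.norm_of_nonneg (by positivity), norm_mul, RCLike.norm_conj]
      calc _ ≤ p.1 ^ (1 - 2 * s) * (‖hatS u p.2‖ * (K * min 1 (1 / p.1 ^ 2) *
            (‖lapMul u p.2‖ + ‖hatS u p.2‖))) := by gcongr; exact hK _ hp _
        _ = _ := by ring
  -- Parseval moves the pairing at each height to the frequency side. The y-integral is then a
  -- scaled tail integral of the profile started at 0, which gives |ξ|^(2s) `flux s 0`.
  have e1 : ∀ y, y ^ (1 - 2 * s) • ∫ x : Rn n, u x * conj (superpos (lapMul u) (prof s) (x, y)) =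
      ∫ ξ, F y ξ := by
    intro y
    have hr := (rapid_lapMul u).mul_profile (continuous_prof hs0) (abs_prof_le hs0) y
    simp only [superpos, hF]
    rw [integral_mul_conj_fourierTInv (rapid_schwartz u).integrable hr.integrable, integral_smul]
    simp only [hatS_apply]
  simp only [e1]
  rw [integral_integral_swap hi, energy_extension_prof hs0 hs1, ENNReal.toReal_mul,
    ENNReal.toReal_ofReal (flux_nonneg hs0 0), seminormGSq, ← integral_eq_lintegral_of_nonneg_ae,
    ← integral_const_mul, ← integral_complex_ofReal]
  · refine integral_congr_ae (ae_of_all _ fun ξ => ?_)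
    have e2 : ∀ y, F y ξ = ((‖hatS u ξ‖ ^ 2 : ℝ) : ℂ) *
        ((y ^ (1 - 2 * s) * (‖ξ‖ ^ (2 : ℝ) * prof s (‖ξ‖ * y)) : ℝ) : ℂ) := by
      intro y
      have := Complex.mul_conj' (hatS u ξ)
      simp only [hF, lapMul, Complex.real_smul, map_mul, Complex.conj_ofReal]
      push_cast
      rw [← this]
      ring
    simp only [e2]
    rw [integral_const_mul, integral_complex_ofReal, integral_Ioi_scaled_prof hs0 hs1
      (norm_nonneg ξ) le_rfl, mul_zero, hatS_apply]
    push_cast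
    ring
  · exact ae_of_all _ fun ξ => by positivity
  · have hm : Measurable fun ξ => ‖ξ‖ ^ (2 * s) * ‖hatS u ξ‖ ^ 2 := by fun_prop
    simp only [hatS_apply] at hm
    exact hm.aestronglyMeasurable

include hs0 hs1 hDY hV hfY in
-- The weight y^(1-2s) cancels the factor y^(2s-1) of ∂_y U, leaving minus the pairing of the
-- vertical derivative with the flux, to which `integral_mul_conj_flux` applies.
lemma integral_pairing_vertical
    (hiY : Integrable (fun X => X.2 ^ (1 - 2 * s) • (DY X * conj (-(X.2 ^ (2 * s - 1)) •
      superpos (fluxMul s u) (flux s) X))) (halfMeasure n)) :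
    ∫ X, X.2 ^ (1 - 2 * s) • (DY X * conj (-(X.2 ^ (2 * s - 1)) •
      superpos (fluxMul s u) (flux s) X)) ∂halfMeasure n =
      -∫ y in Ioi (0 : ℝ), ∫ x, y ^ (1 - 2 * s) •
        (conj (superpos (lapMul u) (prof s) (x, y)) * (V (x, y) - u x)) := by
  have eflux : (fun X => X.2 ^ (1 - 2 * s) • (DY X * conj (-(X.2 ^ (2 * s - 1)) •
      superpos (fluxMul s u) (flux s) X))) =ᵐ[halfMeasure n]
      fun X => -(DY X * conj (superpos (fluxMul s u) (flux s) X)) := by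
    filter_upwards [ae_halfMeasure] with X hX
    have e : ((X.2 ^ (1 - 2 * s) : ℝ) : ℂ) * ((X.2 ^ (2 * s - 1) : ℝ) : ℂ) = 1 := by
      rw [← Complex.ofReal_mul, ← Real.rpow_add hX]
      ring_nf
      simp
    simp only [Complex.real_smul, Complex.ofReal_neg, map_mul, map_neg, Complex.conj_ofReal]
    linear_combination (-(DY X * conj (superpos (fluxMul s u) (flux s) X))) * e
  have iflux : Integrable (fun X => DY X * conj (superpos (fluxMul s u) (flux s) X))
      (halfMeasure n) := by
    have := hiY.congr eflux
    simpa using this.neg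
  have idiff := integrable_conj_mul_sub hs0 hs1 u hDY hV hfY
  rw [integral_congr_ae eflux, integral_neg, integral_mul_conj_flux hs0 hs1 u hDY hV hfY iflux,
    integral_prod_symm _ idiff]

include hs0 hDY hD hV hfY hf in
lemma sum_integral_pairing_horizontal
    (hiX : ∀ i, Integrable (fun X => X.2 ^ (1 - 2 * s) •
      (D i X * conj (superpos (gradMul i u) (prof s) X))) (halfMeasure n)) :
    Integrable (fun y => y ^ (1 - 2 * s) • ∫ x, V (x, y) *
      conj (superpos (lapMul u) (prof s) (x, y))) (volume.restrict (Ioi 0)) ∧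
    ∑ i, ∫ X, X.2 ^ (1 - 2 * s) • (D i X * conj (superpos (gradMul i u) (prof s) X))
      ∂halfMeasure n = ∫ y in Ioi (0 : ℝ), y ^ (1 - 2 * s) •
        ∫ x, V (x, y) * conj (superpos (lapMul u) (prof s) (x, y)) := by
  have aeX : (fun y => ∑ i, ∫ x, y ^ (1 - 2 * s) •
      (D i (x, y) * conj (superpos (gradMul i u) (prof s) (x, y)))) =ᵐ[volume.restrict (Ioi 0)]
      fun y => y ^ (1 - 2 * s) • ∫ x, V (x, y) * conj (superpos (lapMul u) (prof s) (x, y)) := by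
    filter_upwards [ae_sum_integral_mul_conj hs0 u hDY hD hV hfY hf] with y hy
    rw [← hy, Finset.smul_sum]
    simp only [integral_smul]
  refine ⟨(integrable_finsetSum Finset.univ
    fun i _ => (hiX i).integral_prod_right).congr aeX, ?_⟩
  rw [← integral_congr_ae aeX, integral_finsetSum _ fun i _ => (hiX i).integral_prod_right]
  exact Finset.sum_congr rfl fun i _ => integral_prod_symm _ (hiX i)

lemma smul_integral_sub_eq {f g q : Rn n → ℂ} (hf : MemLp f 2) (hg : MemLp g 2) (hq : MemLp q 2)
    (c : ℝ) : (c • ∫ x, f x * conj (q x)) - ∫ x, c • (conj (q x) * (f x - g x)) =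
      c • ∫ x, g x * conj (q x) := by
  have h : Integrable fun x => conj (q x) * (f x - g x) := by
    simpa [mul_comm] using integrable_mul_conj (hf.sub hg) hq
  rw [integral_smul, ← smul_sub, ← integral_sub (integrable_mul_conj hf hq) h]
  congr 2
  ext x
  ring

include hs0 hs1 hDY hD hV hfY hf in
-- The horizontal part contributes V and the vertical part -(V - u) against the same function, so V
-- cancels and only its trace u remains. The subtraction is made at each height after integrating in
-- x, so joint integrability of V against that function over the half-space is not needed.
lemma sum_integral_pairing
    (hiX : ∀ i, Integrable (fun X => X.2 ^ (1 - 2 * s) •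
      (D i X * conj (superpos (gradMul i u) (prof s) X))) (halfMeasure n))
    (hiY : Integrable (fun X => X.2 ^ (1 - 2 * s) • (DY X * conj (-(X.2 ^ (2 * s - 1)) •
      superpos (fluxMul s u) (flux s) X))) (halfMeasure n)) :
    ∑ i, ∫ X, X.2 ^ (1 - 2 * s) • (D i X * conj (superpos (gradMul i u) (prof s) X))
      ∂halfMeasure n + ∫ X, X.2 ^ (1 - 2 * s) • (DY X * conj (-(X.2 ^ (2 * s - 1)) •
      superpos (fluxMul s u) (flux s) X)) ∂halfMeasure n =
      ((energy s (extension (prof s) u)).toReal : ℂ) := by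
  obtain ⟨iX, bX⟩ := sum_integral_pairing_horizontal hs0 u hDY hD hV hfY hf hiX
  have iY := (integrable_conj_mul_sub hs0 hs1 u hDY hV hfY).integral_prod_right
  have hae : (fun y => (y ^ (1 - 2 * s) •
        ∫ x, V (x, y) * conj (superpos (lapMul u) (prof s) (x, y))) -
      ∫ x, y ^ (1 - 2 * s) • (conj (superpos (lapMul u) (prof s) (x, y)) * (V (x, y) - u x)))
      =ᵐ[volume.restrict (Ioi 0)] fun y => y ^ (1 - 2 * s) •
        ∫ x : Rn n, u x * conj (superpos (lapMul u) (prof s) (x, y)) := by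
    filter_upwards [ae_memLp_sub hs0 hDY (fun x => (hV x).1) hfY (rapid_schwartz u).memLp_two
      (fun x => (hV x).2)] with y h3
    exact smul_integral_sub_eq h3 (rapid_schwartz u).memLp_two (memLp_fourierTInv
      ((rapid_lapMul u).mul_profile (continuous_prof hs0) (abs_prof_le hs0) y)) _
  rw [bX, integral_pairing_vertical hs0 hs1 u hDY hV hfY hiY, ← sub_eq_add_neg,
    ← integral_sub iX iY, integral_congr_ae hae, integral_pairing hs0 hs1 u]

include hs0 hs1 in
-- The real part of the pairing of the two gradients is the energy of the extension, and Young's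
-- inequality bounds twice that by the sum of the two energies. Finiteness of the energy of the
-- extension permits cancelling it once from both sides.
theorem energy_extension_prof_le (hVu : V ∈ extensionClass (u : Rn n → ℂ)) :
    energy s (extension (prof s) u) ≤ energy s V := by
  obtain ⟨⟨hX, hY⟩, hV⟩ := hVu
  choose D hD using hX
  obtain ⟨DY, hDY⟩ := hY
  rcases eq_or_ne (energy s V) ⊤ with htop | htop
  · rw [htop]; exact le_top
  have hEU := energy_extension_prof_ne_top hs0 hs1 u
  have eV := energy_eq_sum (s := s) hD hDY
  have eU := energy_eq_sum (s := s) (hasWeakDeriv_extension_dirX hs0 hs1 u)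
    (hasWeakDeriv_extension_dirY hs0 hs1 u)
  have tV := htop
  have tU := hEU
  rw [eV, ENNReal.add_ne_top, ENNReal.sum_ne_top] at tV
  rw [eU, ENNReal.add_ne_top, ENNReal.sum_ne_top] at tU
  have hf : ∀ i, wSq s (D i) ≠ ⊤ := fun i => tV.1 i (Finset.mem_univ i)
  have hfU : ∀ i, wSq s (superpos (gradMul i u) (prof s)) ≠ ⊤ := fun i =>
    tU.1 i (Finset.mem_univ i)
  have yX := fun i => two_re_integral_le (hD i).aestronglyMeasurable.2
    (hasWeakDeriv_extension_dirX hs0 hs1 u i).aestronglyMeasurable.2 (hf i) (hfU i)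
  have yY := two_re_integral_le hDY.aestronglyMeasurable.2
    (hasWeakDeriv_extension_dirY hs0 hs1 u).aestronglyMeasurable.2 tV.2 tU.2
  have hsum := sum_integral_pairing hs0 hs1 u hDY hD hV tV.2 hf (fun i => (yX i).1) yY.1
  have hre := congrArg Complex.re hsum
  rw [Complex.add_re, Complex.re_sum, Complex.ofReal_re] at hre
  have hle : 2 * (energy s (extension (prof s) u)).toReal ≤
      (energy s V).toReal + (energy s (extension (prof s) u)).toReal := by
    calc 2 * (energy s (extension (prof s) u)).toReal ≤
        ∑ i, ((wSq s (D i)).toReal + (wSq s (superpos (gradMul i u) (prof s))).toReal) +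
        ((wSq s DY).toReal + (wSq s fun X => -(X.2 ^ (2 * s - 1)) •
          superpos (fluxMul s u) (flux s) X).toReal) := by
          rw [← hre, mul_add, Finset.mul_sum]
          exact add_le_add (Finset.sum_le_sum fun i _ => (yX i).2) yY.2
      _ = _ := by
          rw [eV, eU, ENNReal.toReal_add (ENNReal.sum_ne_top.2 tV.1) tV.2,
            ENNReal.toReal_add (ENNReal.sum_ne_top.2 tU.1) tU.2, ENNReal.toReal_sum tV.1,
            ENNReal.toReal_sum tU.1, Finset.sum_add_distrib]
          ring
  exact (ENNReal.toReal_le_toReal hEU htop).1 (by linarith)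

end Minimality

/-! ### Independence of the choice of the minimizer -/

section Congruence

variable {E F : Type*} [NormedAddCommGroup E] [NormedSpace ℝ E] [MeasureSpace E]
  [OpensMeasurableSpace E] [NormedAddCommGroup F] [NormedSpace ℝ F]

lemma HasWeakDeriv.congr_left {Ω : Set E} (hΩ : IsOpen Ω) {v : E} {V W D : E → F}
    (h : HasWeakDeriv Ω v V D) (e : EqOn V W Ω) : HasWeakDeriv Ω v W D := by
  refine ⟨fun x hx => ?_, h.2.1, fun φ hφ hc hs => ?_⟩
  · obtain ⟨U, hU, hi⟩ := h.1 x hx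
    refine ⟨U ∩ Ω, inter_mem hU self_mem_nhdsWithin, ?_⟩
    have hi' : IntegrableOn V (U ∩ Ω) := hi.mono_set inter_subset_left
    refine hi'.congr ?_
    have : ∀ᵐ y ∂(volume.restrict (U ∩ Ω)), y ∈ Ω :=
      ae_mono (Measure.restrict_mono_set volume inter_subset_right)
        (ae_restrict_mem hΩ.measurableSet)
    filter_upwards [this] with y hy using e hy
  · rw [← h.2.2 φ hφ hc hs]
    exact setIntegral_congr_fun hΩ.measurableSet fun x hx => by simp only [e hx]

/-- The two functions have the same set of weak derivatives, so the choice made in `weakDeriv` is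
literally the same and the equality is not merely almost everywhere. -/
lemma weakDeriv_congr {Ω : Set E} (hΩ : IsOpen Ω) {v : E} {V W : E → F} (e : EqOn V W Ω) :
    weakDeriv Ω v V = weakDeriv Ω v W := by
  have h : HasWeakDeriv Ω v V = HasWeakDeriv Ω v W :=
    funext fun D => propext ⟨fun h => h.congr_left hΩ e, fun h => h.congr_left hΩ e.symm⟩
  unfold weakDeriv
  rw [h]

variable {n : ℕ} {s : ℝ} {V W : Rn n × ℝ → ℂ}

lemma energy_congr (e : EqOn V W (halfSpace n)) : energy s V = energy s W := by
  simp only [energy, weakDeriv_congr isOpen_halfSpace e]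

lemma partialX_congr (e : EqOn V W (halfSpace n)) (i : Fin n) :
    EqOn (partialX i V) (partialX i W) (halfSpace n) := fun X hX => by
  rw [partialX, partialX, (e.eventuallyEq_of_mem (isOpen_halfSpace.mem_nhds hX)).fderiv_eq]

lemma partialY_congr (e : EqOn V W (halfSpace n)) :
    EqOn (partialY V) (partialY W) (halfSpace n) := fun X hX => by
  rw [partialY, partialY, (e.eventuallyEq_of_mem (isOpen_halfSpace.mem_nhds hX)).fderiv_eq]

lemma fluxX_congr (e : EqOn V W (halfSpace n)) (i : Fin n) :
    EqOn (fluxX s i V) (fluxX s i W) (halfSpace n) := fun X hX => by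
  rw [fluxX, fluxX, partialX_congr e i hX]

lemma fluxY_congr (e : EqOn V W (halfSpace n)) :
    EqOn (fluxY s V) (fluxY s W) (halfSpace n) := fun X hX => by
  rw [fluxY, fluxY, partialY_congr e hX]

lemma SolvesExtension.congr (h : SolvesExtension s V) (e : EqOn V W (halfSpace n)) :
    SolvesExtension s W := by
  intro X hX
  have hn := isOpen_halfSpace.mem_nhds hX
  obtain ⟨h1, h2, h3, h4⟩ := h X hX
  refine ⟨h1.congr_of_eventuallyEq (e.symm.eventuallyEq_of_mem hn), fun i =>
    (h2 i).congr_of_eventuallyEq ((fluxX_congr e i).symm.eventuallyEq_of_mem hn),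
    h3.congr_of_eventuallyEq ((fluxY_congr e).symm.eventuallyEq_of_mem hn), ?_⟩
  rw [← h4, partialY_congr (fluxY_congr e) hX]
  exact congrArg (· + _) (Finset.sum_congr rfl fun i _ =>
    (partialX_congr (fluxX_congr e i) i hX).symm)

lemma mem_extensionClass_congr {u : Rn n → ℂ} (h : V ∈ extensionClass u)
    (e : ∀ X : Rn n × ℝ, 0 ≤ X.2 → V X = W X) : W ∈ extensionClass u := by
  have e' : EqOn V W (halfSpace n) := fun X hX => e X (le_of_lt hX)
  refine ⟨⟨fun i => (h.1.1 i).imp fun D hD => hD.congr_left isOpen_halfSpace e',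
    h.1.2.imp fun D hD => hD.congr_left isOpen_halfSpace e'⟩, fun x => ⟨?_, ?_⟩⟩
  · exact (h.2 x).1.congr fun y hy => (e (x, y) hy).symm
  · rw [← e (x, 0) le_rfl]
    exact (h.2 x).2

lemma extension_congr {g k : ℝ → ℝ} (h : EqOn g k (Ici 0)) (u : Rn n → ℂ) {X : Rn n × ℝ}
    (hX : 0 ≤ X.2) : extension g u X = extension k u X := by
  have e : ∀ ξ : Rn n, g (‖ξ‖ * X.2) = k (‖ξ‖ * X.2) := fun ξ =>
    h (mul_nonneg (norm_nonneg _) hX)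
  simp only [extension, e]

lemma DistribTendsto.congr {F F' : ℝ → Rn n → ℂ} {f : Rn n → ℂ} (h : DistribTendsto F f)
    (e : ∀ y, 0 < y → F y = F' y) : DistribTendsto F' f := by
  refine ⟨fun y hy => e y hy ▸ h.1 y hy, h.2.1, fun φ hφ hc => (h.2.2 φ hφ hc).congr' ?_⟩
  filter_upwards [self_mem_nhdsWithin] with y hy
  rw [e y hy]

end Congruence

end FracExt

end

/-! ### The extension theorem for an arbitrary minimizer -/

theorem mainTheorem4 (n : ℕ) [NeZero n] (s : ℝ) (hs0 : 0 < s) (hs1 : s < 1) :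
    (∃ g, FracExt.IsProfile s g) ∧
    ∀ g, FracExt.IsProfile s g → FracExt.G s g ≠ ⊤ ∧
      ∀ u : SchwartzMap (FracExt.Rn n) ℂ,
        -- the integrals defining `U` and the fractional Laplacian of `u` converge absolutely
        (∀ y, 0 ≤ y → Integrable
          (fun ξ : FracExt.Rn n => FracExt.fourierT u ξ * ((g (‖ξ‖ * y) : ℝ) : ℂ))) ∧
        (∀ x, Integrable (FracExt.fracIntegrand s u x)) ∧
        -- the equation in the half-space
        FracExt.SolvesExtension s (FracExt.extension g u) ∧
        -- the boundary flux, in the sense of distributions and pointwise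
        FracExt.DistribTendsto
          (fun y x => -FracExt.fluxY s (FracExt.extension g u) (x, y))
          (fun x => FracExt.CSharp s g • FracExt.fracLaplacian s u x) ∧
        (∀ x, Tendsto (fun y => -FracExt.fluxY s (FracExt.extension g u) (x, y)) (𝓝[>] 0)
          (𝓝 (FracExt.CSharp s g • FracExt.fracLaplacian s u x))) ∧
        -- minimality of `U` and the value of the minimum
        FracExt.extension g u ∈ FracExt.extensionClass u ∧
        (∀ V ∈ FracExt.extensionClass (u : FracExt.Rn n → ℂ),
          FracExt.energy s (FracExt.extension g u) ≤ FracExt.energy s V) ∧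
        FracExt.energy s (FracExt.extension g u) =
          ENNReal.ofReal (FracExt.CSharp s g) *
            FracExt.seminormGSq s (FracExt.fourierT (u : FracExt.Rn n → ℂ)) := by
  refine ⟨⟨_, FracExt.isProfile_prof hs0 hs1⟩, fun g hg => ⟨?_, fun u => ?_⟩⟩
  · rw [hg.G_eq hs0 hs1]
    exact ENNReal.ofReal_ne_top
  -- The extension evaluates the profile only at |ξ|y ≥ 0, where every minimizer coincides with
  -- `prof s`; each assertion therefore transfers from the explicit profile to g.
  have hgp := hg.eqOn hs0 hs1
  have e : ∀ X : FracExt.Rn n × ℝ, 0 ≤ X.2 →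
      FracExt.extension (FracExt.prof s) u X = FracExt.extension g u X :=
    fun X hX => (FracExt.extension_congr hgp u hX).symm
  have e' : EqOn (FracExt.extension (FracExt.prof s) u) (FracExt.extension g u)
      (FracExt.halfSpace n) := fun X hX => e X (le_of_lt hX)
  have ef : ∀ y, 0 < y → ∀ x, -FracExt.fluxY s (FracExt.extension (FracExt.prof s) u) (x, y) =
      -FracExt.fluxY s (FracExt.extension g u) (x, y) := fun y hy x =>
    congrArg Neg.neg (FracExt.fluxY_congr e' hy)
  rw [hg.CSharp_eq hs0 hs1, ← FracExt.energy_congr e']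
  refine ⟨fun y hy => ?_, FracExt.integrable_fracIntegrand hs0 hs1 u,
    (FracExt.solvesExtension_prof hs0 hs1 u).congr e',
    (FracExt.distribTendsto_flux_prof hs0 hs1 u).congr fun y hy => funext (ef y hy), fun x => ?_,
    FracExt.mem_extensionClass_congr (FracExt.extension_prof_mem_class hs0 hs1 u) e,
    fun V hV => FracExt.energy_extension_prof_le hs0 hs1 u hV,
    FracExt.energy_extension_prof hs0 hs1 u⟩
  · have h := ((FracExt.rapid_schwartz (FracExt.hatS u)).mul_profile (FracExt.continuous_prof hs0)
      (FracExt.abs_prof_le hs0) y).integrable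
    refine h.congr (ae_of_all _ fun ξ => ?_)
    simp only [FracExt.hatS_apply, hgp (mem_Ici.2 (mul_nonneg (norm_nonneg ξ) hy))]
  · refine (FracExt.tendsto_flux_prof hs0 hs1 u x).congr' ?_
    filter_upwards [self_mem_nhdsWithin] with y hy using ef y hy x
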